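/- For a basis $\mathbf B=(\vec b_1,\dots,\vec b_n)$ of $\mathbb R^n$ ($n\ge 1$) with rational coordinates, let $\mathcal L=\{\sum_i z_i\vec b_i : z_i\in\mathbb Z\}$ be the lattice of dimension $n$ that it generates, $\lambda_1(\mathcal L)=\min_{\vec x\in\mathcal L\setminus\{\vec 0\}}\|\vec x\|$, and $\mathrm{dist}(\vec t,\mathcal L)=\min_{\vec x\in\mathcal L}\|\vec x-\vec t\|$ (Euclidean norm). For $\gamma=\gamma(n)\ge 1$: - $\gamma$-SVP is the search problem: given a basis $\mathbf B$ of a lattice $\mathcal L\subset\mathbb R^n$, output $\vec x\in\mathcal L$ with $0<\|\vec x\|\le\gamma(n)\,\lambda_1(\mathcal L)$. - $\gamma$-CVP is the search problem: given a basis $\mathbf B$ of a lattice $\mathcal L\subset\mathbb R^n$ and a target $\vec t\in\mathbb Q^n$, output $\vec x\in\mathcal L$ with $\|\vec x-\vec t\|\le\gamma(n)\,\mathrm{dist}(\vec t,\mathcal L)$. Rational numbers are represented by the binary expansions of numerator and denominator in lowest terms. **Corollary.** There is an efficient, exactly dimension-preserving reduction from $\sqrt n$-CVP to $\sqrt 2$-SVP.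 That is, there are a deterministic oracle algorithm $M$ and a polynomial $p$ such that, for every oracle $O$ that solves $\sqrt2$-SVP, every $n\ge1$ and every $\sqrt n$-CVP instance $(\mathbf B,\vec t)$ of dimension $n$, the algorithm $M$ with oracle $O$ outputs a solution of this instance within $p(m)$ bit operations (including those for writing queries and reading answers), where $m$ is the bit length of $(\mathbf B,\vec t)$, and every oracle query made by $M$ in this computation is a $\sqrt 2$-SVP instance of the same dimension $n$. -/

import Mathlib

noncomputable section

namespace LatticeProblems

/-! ## A machine model with bit cost

Data are finite binary trees whose leaves carry rational numbers, stored as reduced fractions of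
integers in binary.  Programs are built from elementary operations by composition, pairing,
branching and while-loops, and may query an oracle.  Every elementary operation is charged the
total bit length of the data it reads and writes, and every copy of a value is charged its bit
length, so a computation of cost `T` can be carried out by an oracle Turing machine in time
polynomial in `T`, and conversely. -/

/-- Data: binary trees with rational numbers at the leaves. -/
inductive Val : Type
  | rat (q : ℚ) : Val
  | pair (a b : Val) : Val

namespace Val

/-- Bit length of a value.  A rational number contributes the binary lengths of its numerator and
denominator in lowest terms, and every node of the tree contributes one. -/
def size : Val → ℕ
  | rat q => 1 + Nat.size q.num.natAbs + Nat.size q.den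
  | pair a b => 1 + a.size + b.size

/-- Tests succeed on positive rational numbers. -/
def IsTrue : Val → Prop
  | rat q => 0 < q
  | pair _ _ => False

/-- A finite list of values: nested pairs, closed by a leaf. -/
def ofList : List Val → Val
  | [] => rat 0
  | a :: l => pair a (ofList l)

/-- A rational vector, as the list of its coordinates. -/
def ofVec {n : ℕ} (x : Fin n → ℚ) : Val :=
  ofList (List.ofFn fun i => rat (x i))

/-- A finite sequence of rational vectors, as a list of lists of coordinates. -/
def ofVecs {k n : ℕ} (B : Fin k → Fin n → ℚ) : Val :=
  ofList (List.ofFn fun i => ofVec (B i))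

end Val

/-- Elementary operations. -/
inductive Op : Type
  | id : Op
  | const (q : ℚ) : Op
  | fst : Op
  | snd : Op
  | isLeaf : Op
  | add : Op
  | sub : Op
  | mul : Op
  | div : Op
  | floor : Op

/-- The function computed by an elementary operation.  An operation applied to a value of the
wrong shape, like a division by zero, returns zero. -/
def Op.apply : Op → Val → Val
  | .id, v => v
  | .const q, _ => .rat q
  | .fst, .pair a _ => a
  | .snd, .pair _ b => b
  | .isLeaf, .rat _ => .rat 1
  | .add, .pair (.rat a) (.rat b) => .rat (a + b)
  | .sub, .pair (.rat a) (.rat b) => .rat (a - b)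
  | .mul, .pair (.rat a) (.rat b) => .rat (a * b)
  | .div, .pair (.rat a) (.rat b) => .rat (a / b)
  | .floor, .rat a => .rat (⌊a⌋ : ℤ)
  | _, _ => .rat 0

/-- Oracle programs. -/
inductive Prog : Type
  /-- apply an elementary operation -/
  | op (o : Op) : Prog
  /-- run `f`, then run `g` on its result -/
  | seq (f g : Prog) : Prog
  /-- run `f` and `g` on the same input and pair the results -/
  | pair (f g : Prog) : Prog
  /-- run `c` as a test, then `f` or `g` on the same input -/
  | ite (c f g : Prog) : Prog
  /-- while the test `c` succeeds on the current value, replace that value by its image under `f` -/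
  | loop (c f : Prog) : Prog
  /-- hand the current value to the oracle and receive its answer -/
  | query : Prog

/-- `Run O P v w T qs`: with the oracle `O`, the program `P` on the input `v` halts with the output
`w` at cost `T`, and `qs` is the list of the queries it makes, in order. -/
inductive Run (O : Val → Val) : Prog → Val → Val → ℕ → List Val → Prop
  | op (o : Op) (v : Val) :
      Run O (.op o) v (o.apply v) (1 + v.size + (o.apply v).size) []
  | query (v : Val) :
      Run O .query v (O v) (1 + v.size + (O v).size) [v]
  | seq {f g : Prog} {u v w : Val} {S T : ℕ} {ps qs : List Val} :
      Run O f u v S ps → Run O g v w T qs →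
      Run O (.seq f g) u w (1 + S + T) (ps ++ qs)
  | pair {f g : Prog} {u v w : Val} {S T : ℕ} {ps qs : List Val} :
      Run O f u v S ps → Run O g u w T qs →
      Run O (.pair f g) u (.pair v w) (1 + u.size + S + T) (ps ++ qs)
  | ite_true {c f g : Prog} {u b w : Val} {S T : ℕ} {ps qs : List Val} :
      Run O c u b S ps → b.IsTrue → Run O f u w T qs →
      Run O (.ite c f g) u w (1 + u.size + S + T) (ps ++ qs)
  | ite_false {c f g : Prog} {u b w : Val} {S T : ℕ} {ps qs : List Val} :
      Run O c u b S ps → ¬ b.IsTrue → Run O g u w T qs →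
      Run O (.ite c f g) u w (1 + u.size + S + T) (ps ++ qs)
  | loop_done {c f : Prog} {u b : Val} {S : ℕ} {ps : List Val} :
      Run O c u b S ps → ¬ b.IsTrue →
      Run O (.loop c f) u u (1 + u.size + S) ps
  | loop_step {c f : Prog} {u b v w : Val} {S T R : ℕ} {ps qs rs : List Val} :
      Run O c u b S ps → b.IsTrue → Run O f u v T qs → Run O (.loop c f) v w R rs →
      Run O (.loop c f) u w (1 + u.size + S + T + R) (ps ++ qs ++ rs)

/-! ## Search problems and reductions -/

/-- A search problem whose instances have a dimension: the instances of each dimension, their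
encoding as data, and which data are solutions of an instance. -/
structure SearchProblem where
  Instance : ℕ → Type
  encode : {n : ℕ} → Instance n → Val
  IsSolution : {n : ℕ} → Instance n → Val → Prop

/-- An oracle solves a search problem if it answers every instance by a solution; on other queries
its answers are arbitrary. -/
def SearchProblem.SolvedBy (Q : SearchProblem) (O : Val → Val) : Prop :=
  ∀ (n : ℕ) (J : Q.Instance n), Q.IsSolution J (O (Q.encode J))

/-- An efficient dimension-preserving reduction from `P` to `Q`: one program and one polynomial
such that, for every oracle solving `Q`, the program maps every instance of `P`, of any dimension
`n`, to a solution of it at a cost bounded by the polynomial in the bit length of the instance, and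
all its oracle queries are instances of `Q` of the same dimension `n`. -/
def EfficientDimPreservingReduction (P Q : SearchProblem) : Prop :=
  ∃ (M : Prog) (p : Polynomial ℕ), ∀ O : Val → Val, Q.SolvedBy O →
    ∀ (n : ℕ) (I : P.Instance n),
      ∃ (w : Val) (T : ℕ) (qs : List Val), Run O M (P.encode I) w T qs ∧
        P.IsSolution I w ∧ T ≤ p.eval (P.encode I).size ∧
        ∀ q ∈ qs, ∃ J : Q.Instance n, q = Q.encode J

/-! ## Lattices, SVP and CVP -/

/-- A rational vector as a point of Euclidean space. -/
def ratPoint {n : ℕ} (x : Fin n → ℚ) : EuclideanSpace ℝ (Fin n) :=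
  WithLp.toLp 2 fun i => (x i : ℝ)

/-- A basis of a full-rank lattice in dimension `n ≥ 1`, with rational coordinates. -/
structure LatticeBasis (n : ℕ) where
  one_le : 1 ≤ n
  vec : Fin n → Fin n → ℚ
  linearIndependent : LinearIndependent ℝ fun i => ratPoint (vec i)

/-- The lattice generated by a basis: all integer linear combinations of the basis vectors. -/
def LatticeBasis.lattice {n : ℕ} (B : LatticeBasis n) :
    Submodule ℤ (EuclideanSpace ℝ (Fin n)) :=
  Submodule.span ℤ (Set.range fun i => ratPoint (B.vec i))

/-- The length of a shortest nonzero vector of a lattice. -/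
def lambda₁ {n : ℕ} (L : Submodule ℤ (EuclideanSpace ℝ (Fin n))) : ℝ :=
  sInf {r : ℝ | ∃ x ∈ L, x ≠ 0 ∧ r = ‖x‖}

/-- `γ`-SVP: given a basis of a lattice `L`, output a lattice vector `x` with
`0 < ‖x‖ ≤ γ λ₁(L)`. -/
def SVP (γ : ℕ → ℝ) : SearchProblem where
  Instance n := LatticeBasis n
  encode B := Val.ofVecs B.vec
  IsSolution {n} B w := ∃ x : Fin n → ℚ, w = Val.ofVec x ∧ ratPoint x ∈ B.lattice ∧
    0 < ‖ratPoint x‖ ∧ ‖ratPoint x‖ ≤ γ n * lambda₁ B.lattice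

/-- `γ`-CVP: given a basis of a lattice `L` and a target `t`, output a lattice vector `x` with
`‖x - t‖ ≤ γ dist(t, L)`. -/
def CVP (γ : ℕ → ℝ) : SearchProblem where
  Instance n := LatticeBasis n × (Fin n → ℚ)
  encode I := Val.pair (Val.ofVecs I.1.vec) (Val.ofVec I.2)
  IsSolution {n} I w := ∃ x : Fin n → ℚ, w = Val.ofVec x ∧ ratPoint x ∈ I.1.lattice ∧
    ‖ratPoint x - ratPoint I.2‖ ≤
      γ n * Metric.infDist (ratPoint I.2) (I.1.lattice : Set (EuclideanSpace ℝ (Fin n)))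

end LatticeProblems

end

/-! All guarantees are stated with rational squared lengths: a solver of rank `m` must return a
lattice vector whose squared distance from the target `t` is at most `m * δ`, where `δ` is the
squared distance of `t` from an arbitrary lattice vector (`Solver`). Two tools are used throughout.
First, the oracle also serves lattices of rank below `n`: their bases are padded with orthogonal
vectors too long to take part in its answer (`svp_spec`), so all queries keep dimension `n`. Second,
if the Gram–Schmidt vectors of a list `V` have squared length at most `4 * δ`, then Babai rounding
along `V` adds at most `δ` for each of them (`round_spec`).

Rank below `n` (`levelSolve_spec`). A spare direction `p` makes room for the embedding technique:
look for a short vector in the lattice generated by the basis and `t + σ • p`. A binary search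
yields a height `σ` for which `σ ^ 2 * (p ⬝ᵥ p)` is at most every `δ`, up to a tolerance, while the
short vector has squared length below four times this height. So it involves `t + σ • p` with
coefficient `0` or `±1`. Coefficient `±1` reveals a lattice vector within `3 * δ` of the target,
coefficient `0` a nonzero lattice vector of squared length at most `4 * δ` (`embed_spec`); the
tolerance disappears because squared lengths are multiples of a fixed number. A short vector is made
part of a basis by Euclid's algorithm (`ins_spec`), and the search continues in the projection
orthogonal to it. A close vector is accepted while at least three basis vectors remain, when `3` is
at most the remaining rank; the last one or two are left to a solver for small rank. Rounding along
the inserted vectors completes the factor `m`.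

Raising the rank by one (`raise_spec`). In full rank there is no spare direction. Let `b` be a short
lattice vector and `w` a short dual vector. If `b ⬝ᵥ b ≤ 4 * δ`, project orthogonally to `b`, solve
in rank `m - 1`, lift and round. Otherwise Minkowski's theorem for the lattice and its dual
(`exists_short_pair`) bounds the product of the lengths of `b` and `w` by `2 * m`, so a lattice
vector `x` at squared distance `δ` satisfies `|w ⬝ᵥ (x - t)| < m` and lies in one of `2 * m + 1`
planes; in each of them a problem of rank `m - 1` is solved. Raising from rank zero gives ranks one
and two, which complete the solver for ranks below `n`; raising that one gives rank `n`.

Polynomial cost (`Cmp`) is closed under composition, branching and loops, but loops need a bound for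
all intermediate sizes. Such bounds come from invariants, not from growth per round: vectors stay in
a fixed lattice and so keep a common denominator, and their lengths are controlled by Gram–Schmidt
norms that insertion and reduction keep below a fixed bound (`reduce_good`); together this bounds
bit lengths (`sz_rat_le`). Projections are bounded by Cramer's rule (`exists_den_prj`), Euclid's
algorithm by explicit Bézout coefficients (`EuInv.bounds`). -/

noncomputable section

namespace LatticeProblems

/-! ## Polynomially bounded functions -/

/-- Monotone functions bounded by a polynomial. -/
def PB (b : ℕ → ℕ) : Prop := Monotone b ∧ ∃ p : Polynomial ℕ, ∀ s, b s ≤ p.eval s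

theorem polynomial_nat_monotone (p : Polynomial ℕ) : Monotone fun s => p.eval s := by
  intro a b h
  induction p using Polynomial.induction_on' with
  | add p q hp hq => simpa using add_le_add hp hq
  | monomial n c => simpa using Nat.mul_le_mul_left c (Nat.pow_le_pow_left h n)

namespace PB

theorem const (c : ℕ) : PB fun _ => c := ⟨fun _ _ _ => le_rfl, Polynomial.C c, fun s => by simp⟩

theorem id : PB fun s => s := ⟨fun _ _ h => h, Polynomial.X, fun s => by simp⟩

theorem add {b c : ℕ → ℕ} (hb : PB b) (hc : PB c) : PB fun s => b s + c s := by
  obtain ⟨mb, p, hp⟩ := hb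
  obtain ⟨mc, q, hq⟩ := hc
  exact ⟨mb.add mc, p + q, fun s => by simpa using add_le_add (hp s) (hq s)⟩

theorem mul {b c : ℕ → ℕ} (hb : PB b) (hc : PB c) : PB fun s => b s * c s := by
  obtain ⟨mb, p, hp⟩ := hb
  obtain ⟨mc, q, hq⟩ := hc
  exact ⟨fun x y h => Nat.mul_le_mul (mb h) (mc h), p * q,
    fun s => by simpa using Nat.mul_le_mul (hp s) (hq s)⟩

theorem comp {b c : ℕ → ℕ} (hb : PB b) (hc : PB c) : PB fun s => b (c s) := by
  obtain ⟨mb, p, hp⟩ := hb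
  obtain ⟨mc, q, hq⟩ := hc
  refine ⟨mb.comp mc, p.comp q, fun s => ?_⟩
  rw [Polynomial.eval_comp]
  exact (hp _).trans (polynomial_nat_monotone p (hq s))

theorem pow {b : ℕ → ℕ} (hb : PB b) (k : ℕ) : PB fun s => b s ^ k := by
  obtain ⟨mb, p, hp⟩ := hb
  exact ⟨fun x y h => Nat.pow_le_pow_left (mb h) k, p ^ k,
    fun s => by simpa using Nat.pow_le_pow_left (hp s) k⟩

end PB

/-! ## Encodings -/

/-- Types whose elements are encoded as data. -/
class Enc (α : Type) where
  enc : α → Val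

open Enc

/-- Rational vectors. -/
abbrev Vec (n : ℕ) := Fin n → ℚ

instance : Enc ℚ := ⟨Val.rat⟩
instance {α β : Type} [Enc α] [Enc β] : Enc (α × β) := ⟨fun a => .pair (enc a.1) (enc a.2)⟩
instance {α : Type} [Enc α] : Enc (List α) := ⟨fun l => Val.ofList (l.map enc)⟩
instance {n : ℕ} : Enc (Vec n) := ⟨Val.ofVec⟩

/-- Bit length of the encoding. -/
def sz {α : Type} [Enc α] (a : α) : ℕ := (enc a).size

/-- Vectors and lists of rationals are the same data, so a vector can be processed by list loops and
turned back into a vector at no cost, through `Cmp.congr_enc`. -/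
theorem enc_vec {n : ℕ} (x : Vec n) : enc x = enc (List.ofFn x) := by
  change Val.ofList _ = Val.ofList _
  rw [List.map_ofFn]
  rfl

theorem sz_vec {n : ℕ} (x : Vec n) : sz x = sz (List.ofFn x) := by rw [sz, enc_vec, sz]

theorem sz_prod {α β : Type} [Enc α] [Enc β] (a : α × β) : sz a = 1 + sz a.1 + sz a.2 := rfl

theorem sz_nil {α : Type} [Enc α] : sz ([] : List α) = 2 := by
  simp [sz, enc, Val.ofList, Val.size]

theorem sz_cons {α : Type} [Enc α] (a : α) (l : List α) : sz (a :: l) = 1 + sz a + sz l := rfl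

theorem sz_list {α : Type} [Enc α] (l : List α) : sz l = 2 + (l.map fun x => 1 + sz x).sum := by
  induction l with
  | nil => simp [sz_nil]
  | cons a l ih => rw [sz_cons, ih]; simp; ring

theorem sz_pos {α : Type} [Enc α] (a : α) : 0 < sz a := by
  unfold sz; cases enc a <;> simp [Val.size]

/-- The `2` is the size of the closing leaf `rat 0`, which occurs once on the left and twice on the
right. -/
theorem sz_append {α : Type} [Enc α] (l m : List α) : sz (l ++ m) + 2 = sz l + sz m := by
  simp [sz_list]; ring

theorem sz_reverse {α : Type} [Enc α] (l : List α) : sz l.reverse = sz l := by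
  simp [sz_list, List.sum_reverse]

theorem sz_le_of_mem {α : Type} [Enc α] {a : α} {l : List α} (h : a ∈ l) : sz a ≤ sz l := by
  obtain ⟨s, t, rfl⟩ := List.append_of_mem h
  simp [sz_list]; omega

theorem length_le_sz {α : Type} [Enc α] (l : List α) : l.length ≤ sz l := by
  induction l with
  | nil => simp
  | cons a l ih => rw [sz_cons]; simp; omega

theorem sz_list_le {α : Type} [Enc α] (l : List α) (B : ℕ) (h : ∀ x ∈ l, sz x ≤ B) :
    sz l ≤ 2 + l.length * (1 + B) := by
  induction l with
  | nil => simp [sz_nil]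
  | cons a l ih =>
    rw [sz_cons]
    have h1 := ih fun x hx => h x (by simp [hx])
    have h2 := h a (by simp)
    simp only [List.length_cons, Nat.add_mul]
    omega

theorem sz_take_le {α : Type} [Enc α] (l : List α) (k : ℕ) : sz (l.take k) ≤ sz l := by
  have := sz_append (l.take k) (l.drop k)
  rw [List.take_append_drop] at this
  have : 2 ≤ sz (l.drop k) := by rw [sz_list]; omega
  omega

theorem sz_drop_le {α : Type} [Enc α] (l : List α) (k : ℕ) : sz (l.drop k) ≤ sz l := by
  have := sz_append (l.take k) (l.drop k)
  rw [List.take_append_drop] at this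
  have : 2 ≤ sz (l.take k) := by rw [sz_list]; omega
  omega

theorem dim_le_sz {n : ℕ} (x : Vec n) : n ≤ sz x := by
  rw [sz_vec]; simpa using length_le_sz (List.ofFn x)

theorem sz_coord_le {n : ℕ} (x : Vec n) (j : Fin n) : sz (x j) ≤ sz x := by
  rw [sz_vec]; exact sz_le_of_mem (List.mem_ofFn.2 ⟨j, rfl⟩)

theorem sz_vec_le {n : ℕ} (x : Vec n) (B : ℕ) (h : ∀ j, sz (x j) ≤ B) : sz x ≤ 2 + n * (1 + B) := by
  rw [sz_vec]
  refine (sz_list_le _ B fun y hy => ?_).trans (by simp)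
  obtain ⟨j, rfl⟩ := List.mem_ofFn.1 hy
  exact h j

/-! ### Sizes of rational numbers -/

theorem sz_rat (q : ℚ) : sz q = 1 + Nat.size q.num.natAbs + Nat.size q.den := rfl

theorem den_lt_two_pow_sz (q : ℚ) : q.den < 2 ^ sz q :=
  (Nat.lt_size_self _).trans_le (Nat.pow_le_pow_right (by norm_num) (by rw [sz_rat]; omega))

theorem num_lt_two_pow_sz (q : ℚ) : q.num.natAbs < 2 ^ sz q :=
  (Nat.lt_size_self _).trans_le (Nat.pow_le_pow_right (by norm_num) (by rw [sz_rat]; omega))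

theorem abs_mul_den (q : ℚ) : |q| * q.den = q.num.natAbs := by
  have h := congrArg abs (Rat.mul_den_eq_num q)
  rw [abs_mul, Nat.abs_cast] at h
  rw [h, Nat.cast_natAbs, Int.cast_abs]

theorem abs_le_num (q : ℚ) : |q| ≤ q.num.natAbs := by
  have h := abs_mul_den q
  have hd : (1 : ℚ) ≤ q.den := by exact_mod_cast q.pos
  nlinarith [abs_nonneg q]

theorem abs_lt_two_pow_sz (q : ℚ) : |q| < 2 ^ sz q :=
  (abs_le_num q).trans_lt (by exact_mod_cast num_lt_two_pow_sz q)

/-- `q` has a denominator dividing `D`. -/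
def DivBy (D : ℕ) (q : ℚ) : Prop := ∃ z : ℤ, (D : ℚ) * q = z

theorem DivBy.den_dvd {D : ℕ} {q : ℚ} (hD : 0 < D) (h : DivBy D q) : q.den ∣ D := by
  obtain ⟨z, hz⟩ := h
  have hq : q = (z : ℚ) / ((D : ℤ) : ℚ) := by
    field_simp; push_cast; linarith [hz]
  have := Rat.den_dvd z D
  rw [Rat.divInt_eq_div, ← hq] at this
  exact_mod_cast this

theorem divBy_of_den_dvd {D : ℕ} {q : ℚ} (h : q.den ∣ D) : DivBy D q := by
  obtain ⟨k, rfl⟩ := h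
  refine ⟨k * q.num, ?_⟩
  have := Rat.mul_den_eq_num q
  push_cast
  rw [← this]; ring

theorem DivBy.mono {D E : ℕ} {q : ℚ} (h : DivBy D q) (hE : D ∣ E) : DivBy E q := by
  obtain ⟨k, rfl⟩ := hE
  obtain ⟨z, hz⟩ := h
  exact ⟨k * z, by push_cast; rw [← hz]; ring⟩

theorem DivBy.add {D : ℕ} {q r : ℚ} (h : DivBy D q) (h' : DivBy D r) : DivBy D (q + r) := by
  obtain ⟨z, hz⟩ := h
  obtain ⟨w, hw⟩ := h'
  exact ⟨z + w, by push_cast; rw [← hz, ← hw]; ring⟩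

theorem DivBy.neg {D : ℕ} {q : ℚ} (h : DivBy D q) : DivBy D (-q) := by
  obtain ⟨z, hz⟩ := h
  exact ⟨-z, by push_cast; rw [← hz]; ring⟩

theorem DivBy.sub {D : ℕ} {q r : ℚ} (h : DivBy D q) (h' : DivBy D r) : DivBy D (q - r) := by
  rw [sub_eq_add_neg]; exact h.add h'.neg

theorem DivBy.zero (D : ℕ) : DivBy D 0 := ⟨0, by simp⟩

theorem DivBy.mul {D E : ℕ} {q r : ℚ} (h : DivBy D q) (h' : DivBy E r) : DivBy (D * E) (q * r) := by
  obtain ⟨z, hz⟩ := h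
  obtain ⟨w, hw⟩ := h'
  exact ⟨z * w, by push_cast; rw [← hz, ← hw]; ring⟩

theorem DivBy.int_mul {D : ℕ} {q : ℚ} (z : ℤ) (h : DivBy D q) : DivBy D (z * q) := by
  obtain ⟨w, hz⟩ := h
  exact ⟨z * w, by push_cast; rw [← hz]; ring⟩

theorem divBy_int (D : ℕ) (z : ℤ) : DivBy D z := ⟨D * z, by push_cast; ring⟩

theorem DivBy.sum {ι : Type*} {D : ℕ} (s : Finset ι) (f : ι → ℚ) (h : ∀ i ∈ s, DivBy D (f i)) :
    DivBy D (∑ i ∈ s, f i) := by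
  classical
  induction s using Finset.induction_on with
  | empty => simpa using DivBy.zero D
  | insert a s ha ih =>
    rw [Finset.sum_insert ha]
    exact (h a (by simp)).add (ih fun i hi => h i (by simp [hi]))

/-- A nonzero number with a small denominator is not small. -/
theorem DivBy.one_le_mul_abs {D : ℕ} {q : ℚ} (h : DivBy D q) (hq : q ≠ 0) (hD : 0 < D) :
    1 ≤ (D : ℚ) * |q| := by
  obtain ⟨z, hz⟩ := h
  have hD' : (0 : ℚ) < D := by exact_mod_cast hD
  have h0 : z ≠ 0 := by
    rintro rfl
    simp at hz
    rcases hz with h | h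
    · omega
    · exact hq h
  have : (1 : ℚ) ≤ |(z : ℚ)| := by exact_mod_cast Int.one_le_abs h0
  rwa [← hz, abs_mul, abs_of_pos hD'] at this

/-- The numerator is the absolute value times the denominator, hence at most `2 ^ (k + m)`. This is
the basic tool for bit lengths: a known common denominator and a bound for the magnitude suffice,
however the number was computed. -/
theorem sz_rat_le {q : ℚ} {D k m : ℕ} (hD : 0 < D) (hDk : D ≤ 2 ^ k) (h : DivBy D q)
    (hq : |q| ≤ 2 ^ m) : sz q ≤ 2 * k + m + 3 := by
  have hd : q.den ≤ 2 ^ k := (Nat.le_of_dvd hD (h.den_dvd hD)).trans hDk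
  have h1 : Nat.size q.den ≤ k + 1 := by
    rw [Nat.size_le]
    exact hd.trans_lt (Nat.pow_lt_pow_right (by norm_num) (by omega))
  have h2 : (q.num.natAbs : ℚ) ≤ 2 ^ (k + m) := by
    rw [← abs_mul_den, pow_add, mul_comm]
    have hd' : (q.den : ℚ) ≤ 2 ^ k := by exact_mod_cast hd
    exact mul_le_mul hd' hq (abs_nonneg _) (by positivity)
  have h3 : q.num.natAbs ≤ 2 ^ (k + m) := by exact_mod_cast h2
  have h4 : Nat.size q.num.natAbs ≤ k + m + 1 := by
    rw [Nat.size_le]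
    exact h3.trans_lt (Nat.pow_lt_pow_right (by norm_num) (by omega))
  rw [sz_rat]; omega

/-- The product of all denominators occurring in a value. -/
def Val.den : Val → ℕ
  | .rat q => q.den
  | .pair a b => a.den * b.den

theorem Val.den_pos : ∀ v : Val, 0 < v.den
  | .rat q => q.pos
  | .pair a b => Nat.mul_pos a.den_pos b.den_pos

/-- Denominators multiply where sizes add, so even the product of all denominators has a bit length
linear in the size. -/
theorem Val.den_le : ∀ v : Val, v.den ≤ 2 ^ v.size
  | .rat q => (den_lt_two_pow_sz q).le
  | .pair a b => by
    have h := Nat.mul_le_mul a.den_le b.den_le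
    rw [← pow_add] at h
    exact h.trans (Nat.pow_le_pow_right (by norm_num) (by simp [Val.size]))

/-- A common denominator. -/
def cden {α : Type} [Enc α] (a : α) : ℕ := (enc a).den

theorem cden_pos {α : Type} [Enc α] (a : α) : 0 < cden a := Val.den_pos _

theorem cden_le {α : Type} [Enc α] (a : α) : cden a ≤ 2 ^ sz a := Val.den_le _

theorem cden_dvd_of_mem {α : Type} [Enc α] {a : α} {l : List α} (h : a ∈ l) : cden a ∣ cden l := by
  induction l with
  | nil => simp at h
  | cons b l ih =>
    change _ ∣ cden b * cden l
    rcases List.mem_cons.1 h with rfl | h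
    · exact Dvd.intro _ rfl
    · exact (ih h).mul_left _

theorem cden_prod {α β : Type} [Enc α] [Enc β] (a : α × β) : cden a = cden a.1 * cden a.2 := rfl

theorem divBy_cden (q : ℚ) : DivBy (cden q) q := divBy_of_den_dvd dvd_rfl

theorem divBy_cden_vec {n : ℕ} (x : Vec n) (j : Fin n) : DivBy (cden x) (x j) := by
  have h : cden x = cden (List.ofFn x) := by rw [cden, enc_vec, cden]
  rw [h]
  exact (divBy_cden (x j)).mono (cden_dvd_of_mem (List.mem_ofFn.2 ⟨j, rfl⟩))

theorem abs_coord_le {n : ℕ} (x : Vec n) (j : Fin n) : |x j| ≤ 2 ^ sz x :=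
  (abs_lt_two_pow_sz _).le.trans (pow_le_pow_right₀ (by norm_num) (sz_coord_le x j))

/-! ## Computations of polynomial cost -/

/-- An oracle solving `√2`-SVP, and a dimension. -/
structure Ctx where
  O : Val → Val
  solved : (SVP fun _ => Real.sqrt 2).SolvedBy O
  n : ℕ

/-- The value is an SVP instance of the given dimension. -/
def IsQuery (n : ℕ) (q : Val) : Prop :=
  ∃ J : LatticeBasis n, q = (SVP fun _ => Real.sqrt 2).encode J

/-- One oracle program computes the functions `f i` on the sets `S i`, at polynomial cost and
querying only SVP instances of the dimension given by `i`. -/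
def Cmp {α β : Ctx → Type} [∀ i, Enc (α i)] [∀ i, Enc (β i)] (S : ∀ i, α i → Prop)
    (f : ∀ i, α i → β i) : Prop :=
  ∃ (P : Prog) (b : ℕ → ℕ), PB b ∧ ∀ i a, S i a → ∃ T qs,
    Run i.O P (enc a) (enc (f i a)) T qs ∧ T ≤ b (sz a) ∧ ∀ q ∈ qs, IsQuery i.n q

/-- Every operation pays for the data it writes, so a cost bound is also a bound for the size of the
output. This is what lets cost bounds be composed. -/
theorem Run.size_le {O : Val → Val} {P : Prog} {v w : Val} {T : ℕ} {qs : List Val}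
    (h : Run O P v w T qs) : w.size ≤ T := by
  induction h with
  | op o v => omega
  | query v => omega
  | seq _ _ _ _ => omega
  | pair _ _ _ _ => simp only [Val.size]; omega
  | ite_true _ _ _ _ _ => omega
  | ite_false _ _ _ _ _ => omega
  | loop_done _ _ _ => omega
  | loop_step _ _ _ _ _ _ _ => omega

section
variable {α β γ δ ε : Ctx → Type} [∀ i, Enc (α i)] [∀ i, Enc (β i)] [∀ i, Enc (γ i)]
  [∀ i, Enc (δ i)] [∀ i, Enc (ε i)] {S S' : ∀ i, α i → Prop}

namespace Cmp

theorem sz_le {f : ∀ i, α i → β i} (hf : Cmp S f) :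
    ∃ b, PB b ∧ ∀ i a, S i a → sz (f i a) ≤ b (sz a) := by
  obtain ⟨P, b, hb, h⟩ := hf
  refine ⟨b, hb, fun i a ha => ?_⟩
  obtain ⟨T, qs, hr, hT, -⟩ := h i a ha
  exact hr.size_le.trans hT

theorem mono {f : ∀ i, α i → β i} (hf : Cmp S' f) (h : ∀ i a, S i a → S' i a) : Cmp S f := by
  obtain ⟨P, b, hb, hf⟩ := hf
  exact ⟨P, b, hb, fun i a ha => hf i a (h i a ha)⟩

/-- Programs act on encodings only; functions into different types share a program when their values
have equal encodings. -/
theorem congr_enc {f : ∀ i, α i → β i} {g : ∀ i, α i → γ i} (hf : Cmp S f)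
    (h : ∀ i a, S i a → enc (f i a) = enc (g i a)) : Cmp S g := by
  obtain ⟨P, b, hb, hf⟩ := hf
  exact ⟨P, b, hb, fun i a ha => by rw [← h i a ha]; exact hf i a ha⟩

theorem congr {f g : ∀ i, α i → β i} (hf : Cmp S f) (h : ∀ i a, S i a → f i a = g i a) : Cmp S g :=
  hf.congr_enc fun i a ha => by rw [h i a ha]

theorem of_op {f : ∀ i, α i → β i} (o : Op) (h : ∀ i a, S i a → o.apply (enc a) = enc (f i a))
    (b : ℕ → ℕ) (hb : PB b) (hs : ∀ i a, S i a → sz (f i a) ≤ b (sz a)) : Cmp S f := by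
  refine ⟨.op o, fun s => 1 + s + b s, ((PB.const 1).add PB.id).add hb, fun i a ha => ?_⟩
  refine ⟨_, _, by simpa [h i a ha] using Run.op (O := i.O) o (enc a), ?_, by simp⟩
  have := hs i a ha
  simp only [sz] at this ⊢
  omega

theorem ident : Cmp S (fun _ a => a) :=
  of_op .id (fun _ _ _ => rfl) _ PB.id fun _ _ _ => le_rfl

/-- The size of the intermediate value is known only up to a bound, and the cost of the second
program is evaluated at that bound; for this reason `PB` includes monotonicity. -/
theorem comp {g : ∀ i, α i → β i} {Q : ∀ i, β i → Prop} {f : ∀ i, β i → γ i} (hf : Cmp Q f)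
    (hg : Cmp S g) (h : ∀ i a, S i a → Q i (g i a)) : Cmp S (fun i a => f i (g i a)) := by
  obtain ⟨b, hb, hsz⟩ := hg.sz_le
  obtain ⟨P, p, hp, hf⟩ := hf
  obtain ⟨P', p', hp', hg⟩ := hg
  refine ⟨.seq P' P, fun s => 1 + p' s + p (b s), ((PB.const 1).add hp').add (hp.comp hb),
    fun i a ha => ?_⟩
  obtain ⟨T', qs', hr', hT', hq'⟩ := hg i a ha
  obtain ⟨T, qs, hr, hT, hq⟩ := hf i _ (h i a ha)
  refine ⟨_, _, .seq hr' hr, ?_, ?_⟩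
  · have := hp.1 (hsz i a ha)
    dsimp only; omega
  · intro q h
    rcases List.mem_append.1 h with h | h
    exacts [hq' q h, hq q h]

/-- Composition with a function computable on all inputs. -/
theorem app {g : ∀ i, α i → β i} {f : ∀ i, β i → γ i} (hf : Cmp (fun _ _ => True) f)
    (hg : Cmp S g) : Cmp S (fun i a => f i (g i a)) :=
  hf.comp hg fun _ _ _ => trivial

theorem pair {f : ∀ i, α i → β i} {g : ∀ i, α i → γ i} (hf : Cmp S f) (hg : Cmp S g) :
    Cmp S (fun i a => (f i a, g i a)) := by
  obtain ⟨P, p, hp, hf⟩ := hf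
  obtain ⟨P', p', hp', hg⟩ := hg
  refine ⟨.pair P P', fun s => 1 + s + p s + p' s, (((PB.const 1).add PB.id).add hp).add hp',
    fun i a ha => ?_⟩
  obtain ⟨T, qs, hr, hT, hq⟩ := hf i a ha
  obtain ⟨T', qs', hr', hT', hq'⟩ := hg i a ha
  refine ⟨_, _, .pair hr hr', ?_, ?_⟩
  · simp only [sz] at *; omega
  · intro q h
    rcases List.mem_append.1 h with h | h
    exacts [hq q h, hq' q h]

theorem op_fst : Cmp (α := fun i => β i × γ i) (fun _ _ => True) (fun _ a => a.1) :=
  of_op .fst (fun _ _ _ => rfl) _ PB.id fun _ a _ => by rw [sz_prod]; omega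

theorem op_snd : Cmp (α := fun i => β i × γ i) (fun _ _ => True) (fun _ a => a.2) :=
  of_op .snd (fun _ _ _ => rfl) _ PB.id fun _ a _ => by rw [sz_prod]; omega

theorem fst {f : ∀ i, α i → β i × γ i} (hf : Cmp S f) : Cmp S (fun i a => (f i a).1) :=
  op_fst.app hf

theorem snd {f : ∀ i, α i → β i × γ i} (hf : Cmp S f) : Cmp S (fun i a => (f i a).2) :=
  op_snd.app hf

theorem const (q : ℚ) : Cmp S (fun _ _ => q) :=
  of_op (.const q) (fun _ _ _ => by simp [Op.apply]; rfl) _ (PB.const (sz q)) fun _ _ _ => le_rfl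

/-- The closing leaf of a list is `rat 0`, so the empty list and the number zero are the same datum.
-/
theorem nil : Cmp S (fun i _ => ([] : List (β i))) :=
  (const 0).congr_enc fun _ _ _ => rfl

theorem cons {f : ∀ i, α i → β i} {l : ∀ i, α i → List (β i)} (hf : Cmp S f) (hl : Cmp S l) :
    Cmp S (fun i a => f i a :: l i a) :=
  (hf.pair hl).congr_enc fun _ _ _ => rfl

/-- Each branch has to be computable only where it is taken. Oracle calls and Euclid's algorithm,
which are justified only on valid inputs, depend on this. -/
theorem ite {c : ∀ i, α i → ℚ} {f g : ∀ i, α i → β i} (hc : Cmp S c)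
    (hf : Cmp (fun i a => S i a ∧ 0 < c i a) f) (hg : Cmp (fun i a => S i a ∧ ¬ 0 < c i a) g) :
    Cmp S (fun i a => if 0 < c i a then f i a else g i a) := by
  obtain ⟨P, p, hp, hc⟩ := hc
  obtain ⟨P', p', hp', hf⟩ := hf
  obtain ⟨P'', p'', hp'', hg⟩ := hg
  refine ⟨.ite P P' P'', fun s => 1 + s + p s + p' s + p'' s,
    ((((PB.const 1).add PB.id).add hp).add hp').add hp'', fun i a ha => ?_⟩
  obtain ⟨T, qs, hr, hT, hq⟩ := hc i a ha
  by_cases h : 0 < c i a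
  · obtain ⟨T', qs', hr', hT', hq'⟩ := hf i a ⟨ha, h⟩
    simp only [if_pos h]
    refine ⟨_, _, .ite_true hr h hr', ?_, ?_⟩
    · simp only [sz] at *; omega
    · intro q h
      rcases List.mem_append.1 h with h | h
      exacts [hq q h, hq' q h]
  · obtain ⟨T', qs', hr', hT', hq'⟩ := hg i a ⟨ha, h⟩
    simp only [if_neg h]
    refine ⟨_, _, .ite_false hr h hr', ?_, ?_⟩
    · simp only [sz] at *; omega
    · intro q h
      rcases List.mem_append.1 h with h | h
      exacts [hq q h, hq' q h]

theorem ite' {c : ∀ i, α i → ℚ} {f g : ∀ i, α i → β i} (hc : Cmp S c)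
    (hf : Cmp S f) (hg : Cmp S g) : Cmp S (fun i a => if 0 < c i a then f i a else g i a) :=
  ite hc (hf.mono fun _ _ h => h.1) (hg.mono fun _ _ h => h.1)

end Cmp

/-! ### Arithmetic -/

theorem two_rat_bounds (a b : ℚ) :
    (a.den * b.den : ℕ) ≤ 2 ^ (sz a + sz b) ∧ |a| ≤ 2 ^ sz a ∧ |b| ≤ 2 ^ sz b := by
  refine ⟨?_, (abs_lt_two_pow_sz a).le, (abs_lt_two_pow_sz b).le⟩
  rw [pow_add]
  exact Nat.mul_le_mul (den_lt_two_pow_sz a).le (den_lt_two_pow_sz b).le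

/-- This is `sz_rat_le` with the product of the denominators and both exponents equal to `sz a + sz
b`; sizes are positive, so a sum of the two powers of two is at most their product. -/
theorem sz_add_le (a b : ℚ) : sz (a + b) ≤ 3 * (sz a + sz b) + 3 := by
  obtain ⟨h, ha, hb⟩ := two_rat_bounds a b
  have := sz_rat_le (q := a + b) (m := sz a + sz b) (Nat.mul_pos a.pos b.pos) h
    ((divBy_of_den_dvd (Dvd.intro _ rfl)).add (divBy_of_den_dvd (Dvd.intro_left _ rfl))) (by
      refine (abs_add_le a b).trans ((add_le_add ha hb).trans ?_)
      rw [pow_add]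
      have h1 : (2 : ℚ) ≤ 2 ^ sz a := by
        simpa using pow_le_pow_right₀ (by norm_num : (1 : ℚ) ≤ 2) (sz_pos a)
      have h2 : (2 : ℚ) ≤ 2 ^ sz b := by
        simpa using pow_le_pow_right₀ (by norm_num : (1 : ℚ) ≤ 2) (sz_pos b)
      nlinarith)
  omega

theorem sz_neg (a : ℚ) : sz (-a) = sz a := by simp [sz_rat]

theorem sz_sub_le (a b : ℚ) : sz (a - b) ≤ 3 * (sz a + sz b) + 3 := by
  rw [sub_eq_add_neg, ← sz_neg b]; exact sz_add_le _ _

theorem sz_mul_le (a b : ℚ) : sz (a * b) ≤ 3 * (sz a + sz b) + 3 := by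
  obtain ⟨h, ha, hb⟩ := two_rat_bounds a b
  have := sz_rat_le (q := a * b) (m := sz a + sz b) (Nat.mul_pos a.pos b.pos) h
    ((divBy_of_den_dvd dvd_rfl).mul (divBy_of_den_dvd dvd_rfl)) (by
      rw [abs_mul, pow_add]
      exact mul_le_mul ha hb (abs_nonneg _) (by positivity))
  omega

/-- Inversion exchanges numerator and denominator up to sign; for zero the convention `0⁻¹ = 0`
applies. -/
theorem sz_inv_le (b : ℚ) : sz b⁻¹ ≤ sz b := by
  rcases lt_trichotomy b 0 with h | rfl | h
  · rw [← sz_neg, ← sz_neg b, ← inv_neg]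
    have h' : (0 : ℚ) < -b := by linarith
    generalize -b = c at h'
    have hn : 0 < c.num := Rat.num_pos.2 h'
    rw [sz_rat, sz_rat, Rat.num_inv, Rat.den_inv]
    simp [hn.ne', Int.sign_eq_one_of_pos hn]
    omega
  · simp
  · have hn : 0 < b.num := Rat.num_pos.2 h
    rw [sz_rat, sz_rat, Rat.num_inv, Rat.den_inv]
    simp [hn.ne', Int.sign_eq_one_of_pos hn]
    omega

theorem sz_div_le (a b : ℚ) : sz (a / b) ≤ 3 * (sz a + sz b) + 3 := by
  rw [div_eq_mul_inv]
  have := sz_mul_le a b⁻¹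
  have := sz_inv_le b
  omega

theorem sz_floor_le (a : ℚ) : sz ((⌊a⌋ : ℤ) : ℚ) ≤ sz a + 4 := by
  have h := sz_rat_le (q := ((⌊a⌋ : ℤ) : ℚ)) (D := 1) (k := 0) (m := sz a + 1) one_pos (by simp)
    (divBy_int 1 _) (by
      have h1 := Int.floor_le a
      have h2 := Int.lt_floor_add_one a
      have h3 := abs_lt.1 (abs_lt_two_pow_sz a)
      have h4 : (1 : ℚ) ≤ 2 ^ sz a := one_le_pow₀ (by norm_num)
      rw [pow_succ, abs_le]
      constructor <;> linarith)
  omega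

namespace Cmp

theorem bin {o : Op} {F : ℚ → ℚ → ℚ}
    (ho : ∀ a b, o.apply (.pair (.rat a) (.rat b)) = .rat (F a b))
    (hs : ∀ a b, sz (F a b) ≤ 3 * (sz a + sz b) + 3) {f g : ∀ i, α i → ℚ} (hf : Cmp S f)
    (hg : Cmp S g) : Cmp S (fun i a => F (f i a) (g i a)) := by
  refine app (β := fun _ => ℚ × ℚ) (f := fun _ p => F p.1 p.2)
    (of_op o (fun i a _ => ho _ _) (fun s => 3 * s + 3)
    (((PB.const 3).mul PB.id).add (PB.const 3)) fun i a _ => ?_) (hf.pair hg)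
  have := hs a.1 a.2
  rw [sz_prod]
  omega

theorem add {f g : ∀ i, α i → ℚ} (hf : Cmp S f) (hg : Cmp S g) :
    Cmp S (fun i a => f i a + g i a) := bin (o := .add) (fun _ _ => rfl) sz_add_le hf hg

theorem sub {f g : ∀ i, α i → ℚ} (hf : Cmp S f) (hg : Cmp S g) :
    Cmp S (fun i a => f i a - g i a) := bin (o := .sub) (fun _ _ => rfl) sz_sub_le hf hg

theorem mul {f g : ∀ i, α i → ℚ} (hf : Cmp S f) (hg : Cmp S g) :
    Cmp S (fun i a => f i a * g i a) := bin (o := .mul) (fun _ _ => rfl) sz_mul_le hf hg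

theorem div {f g : ∀ i, α i → ℚ} (hf : Cmp S f) (hg : Cmp S g) :
    Cmp S (fun i a => f i a / g i a) := bin (o := .div) (fun _ _ => rfl) sz_div_le hf hg

theorem floor {f : ∀ i, α i → ℚ} (hf : Cmp S f) :
    Cmp S (fun i a => ((⌊f i a⌋ : ℤ) : ℚ)) :=
  app (β := fun _ => ℚ) (f := fun _ q => ((⌊q⌋ : ℤ) : ℚ))
    (of_op .floor (fun _ _ _ => rfl) (fun s => s + 4) (PB.id.add (PB.const 4))
      fun _ a _ => sz_floor_le a) hf

theorem tail {l : ∀ i, α i → List (β i)} (hl : Cmp S l) : Cmp S (fun i a => (l i a).tail) := by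
  refine app (β := fun i => List (β i)) (f := fun _ l => l.tail)
    (of_op .snd (fun i a _ => ?_) (fun s => s) PB.id fun i a _ => ?_) hl
  · cases a <;> rfl
  · cases a
    · exact le_rfl
    · rw [sz_cons]; simp

/-- The test for a nonempty list. -/
theorem nonempty {l : ∀ i, α i → List (β i)} (hl : Cmp S l) :
    Cmp S (fun i a => if l i a = [] then (0 : ℚ) else 1) := by
  have h : Cmp (α := fun i => List (β i)) (fun _ _ => True)
      (fun _ l => if l = [] then (1 : ℚ) else 0) := by
    refine of_op .isLeaf (fun i a _ => ?_) (fun _ => 5) (PB.const 5) fun i a _ => ?_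
    · cases a <;> rfl
    · split_ifs <;> simp [sz_rat]
  refine ((const 1).sub (h.app hl)).congr fun i a _ => ?_
  by_cases h : l i a = [] <;> simp [h]

/-- On the empty list the machine returns `rat 0`, which need not encode the default element of `β
i`; hence the restriction, which is superfluous for rationals (`headQ`). -/
theorem headI [∀ i, Inhabited (β i)] {l : ∀ i, α i → List (β i)} (hl : Cmp S l)
    (h : ∀ i a, S i a → l i a ≠ []) : Cmp S (fun i a => (l i a).headI) := by
  refine comp (β := fun i => List (β i)) (Q := fun _ l => l ≠ []) (f := fun _ l => l.headI)
    (of_op .fst (fun i a ha => ?_) (fun s => s) PB.id fun i a ha => ?_) hl h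
  · obtain ⟨x, l, rfl⟩ := List.exists_cons_of_ne_nil ha; rfl
  · obtain ⟨x, l, rfl⟩ := List.exists_cons_of_ne_nil ha
    rw [sz_cons]; simp; omega

/-- The head of a list of rational numbers, zero if there is none. -/
theorem headQ {l : ∀ i, α i → List ℚ} (hl : Cmp S l) : Cmp S (fun i a => (l i a).headI) := by
  refine app (β := fun i => List ℚ) (f := fun _ l => l.headI)
    (of_op .fst (fun i a ha => ?_) (fun s => s) PB.id fun i a ha => ?_) hl
  · cases a <;> rfl
  · cases a
    · exact le_rfl
    · rw [sz_cons]; simp; omega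

end Cmp

/-! ### Loops -/

open Classical in
/-- Iterate `f` as long as `c` holds. -/
def untilF {σ : Type} (c : σ → Prop) (f : σ → σ) (a : σ) : σ :=
  if h : ∃ k, ¬ c (f^[k] a) then f^[Nat.find h] a else a

theorem untilF_eq {σ : Type} {c : σ → Prop} {f : σ → σ} {a : σ} {k : ℕ}
    (h : ∀ j < k, c (f^[j] a)) (hk : ¬ c (f^[k] a)) : untilF c f a = f^[k] a := by
  classical
  have hex : ∃ k, ¬ c (f^[k] a) := ⟨k, hk⟩
  have : Nat.find hex = k := by
    rw [Nat.find_eq_iff]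
    exact ⟨hk, fun j hj => not_not.2 (h j hj)⟩
  rw [untilF, dif_pos hex, this]

theorem exists_untilF {σ : Type} {c : σ → Prop} {f : σ → σ} {a : σ} {N : ℕ}
    (h : ∃ k ≤ N, ¬ c (f^[k] a)) :
    ∃ k ≤ N, (∀ j < k, c (f^[j] a)) ∧ ¬ c (f^[k] a) ∧ untilF c f a = f^[k] a := by
  classical
  obtain ⟨k, hk, hc⟩ := h
  have hex : ∃ k, ¬ c (f^[k] a) := ⟨k, hc⟩
  refine ⟨Nat.find hex, (Nat.find_min' hex hc).trans hk, fun j hj => ?_, Nat.find_spec hex, ?_⟩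
  · exact not_not.1 (Nat.find_min hex hj)
  · rw [untilF, dif_pos hex]

theorem iterate_inv {σ : Type} {c I : σ → Prop} {f : σ → σ} (hI : ∀ a, I a → c a → I (f a)) {a : σ}
    (ha : I a) {k : ℕ} (h : ∀ j < k, c (f^[j] a)) : I (f^[k] a) := by
  induction k with
  | zero => exact ha
  | succ k ih =>
    rw [Function.iterate_succ_apply']
    exact hI _ (ih fun j hj => h j (by omega)) (h k (by omega))

/-- A polynomial cost per round does not prevent exponential growth over the rounds, so besides the
number of rounds a bound `b` for all reachable states is required. Then each of the at most `N + 1`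
tests and rounds costs at most a fixed polynomial in the input size. -/
theorem Cmp.loop {c : ∀ i, α i → ℚ} {f : ∀ i, α i → α i} {I : ∀ i, α i → Prop} (hc : Cmp I c)
    (hf : Cmp (fun i a => I i a ∧ 0 < c i a) f) (hS : ∀ i a, S i a → I i a)
    (hI : ∀ i a, I i a → 0 < c i a → I i (f i a))
    (N b : ℕ → ℕ) (hN : PB N) (hb : PB b)
    (hhalt : ∀ i a, S i a → ∃ k ≤ N (sz a), ¬ 0 < c i ((f i)^[k] a))
    (hsz : ∀ i a, S i a → ∀ k, (∀ j < k, 0 < c i ((f i)^[j] a)) → sz ((f i)^[k] a) ≤ b (sz a)) :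
    Cmp S (fun i a => untilF (fun x => 0 < c i x) (f i) a) := by
  obtain ⟨P, p, hp, hc⟩ := hc
  obtain ⟨P', p', hp', hf⟩ := hf
  refine ⟨.loop P P', fun s => (N s + 1) * (1 + b s + p (b s) + p' (b s)),
    (hN.add (PB.const 1)).mul ((((PB.const 1).add hb).add (hp.comp hb)).add (hp'.comp hb)),
    fun i a ha => ?_⟩
  obtain ⟨k, hkN, hlt, hk, heq⟩ :=
    exists_untilF (c := fun x => 0 < c i x) (hhalt i a ha)
  simp only [heq]
  -- Induction on the number `j` of rounds still to come, because `Run.loop_step` builds a run from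
  -- the run of the remaining loop.
  have key : ∀ j, j ≤ k → ∃ T qs, Run i.O (.loop P P') (enc ((f i)^[k - j] a))
      (enc ((f i)^[k] a)) T qs ∧
      T ≤ (j + 1) * (1 + b (sz a) + p (b (sz a)) + p' (b (sz a))) ∧ ∀ q ∈ qs, IsQuery i.n q := by
    intro j
    induction j with
    | zero =>
      intro _
      have hIk : I i ((f i)^[k] a) := iterate_inv (hI i) (hS i a ha) hlt
      obtain ⟨T, qs, hr, hT, hq⟩ := hc i _ hIk
      refine ⟨_, _, .loop_done hr hk, ?_, hq⟩
      have h1 := hsz i a ha k hlt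
      have h2 := hp.1 h1
      simp only [sz, Nat.sub_zero, zero_add, one_mul] at *; omega
    | succ j ih =>
      intro hj
      obtain ⟨T₃, rs, hr₃, hT₃, hq₃⟩ := ih (by omega)
      have hlt' : ∀ l < k - (j + 1), 0 < c i ((f i)^[l] a) := fun l hl => hlt l (by omega)
      have hIk : I i ((f i)^[k - (j + 1)] a) := iterate_inv (hI i) (hS i a ha) hlt'
      have hck := hlt (k - (j + 1)) (by omega)
      obtain ⟨T, qs, hr, hT, hq⟩ := hc i _ hIk
      obtain ⟨T', qs', hr', hT', hq'⟩ := hf i _ ⟨hIk, hck⟩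
      rw [← Function.iterate_succ_apply' (f i), show (k - (j + 1)).succ = k - j by omega] at hr'
      refine ⟨_, _, .loop_step hr hck hr' hr₃, ?_, ?_⟩
      · have h1 := hsz i a ha _ hlt'
        have h2 := hp.1 h1
        have h3 := hp'.1 h1
        rw [Nat.add_mul (j + 1) 1]
        simp only [sz] at *; omega
      · intro q h
        simp only [List.mem_append] at h
        rcases h with (h | h) | h
        exacts [hq q h, hq' q h, hq₃ q h]
  obtain ⟨T, qs, hr, hT, hq⟩ := key k le_rfl
  refine ⟨T, qs, by simpa using hr, hT.trans ?_, hq⟩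
  exact Nat.mul_le_mul_right _ (by omega)

/-- A loop whose variant is halved in each round stops after few rounds. -/
theorem exists_stop {σ : Type} {c I : σ → Prop} {f : σ → σ} (hI : ∀ a, I a → c a → I (f a))
    (φ : σ → ℚ) {m : ℚ} (hφ : ∀ a, I a → c a → φ (f a) ≤ φ a / 2)
    (hc : ∀ a, I a → c a → m ≤ φ a) {a : σ} (ha : I a) {N : ℕ} (hN : φ a < m * 2 ^ N) :
    ∃ k ≤ N, ¬ c (f^[k] a) := by
  by_contra! h
  have hIk : ∀ k ≤ N, I (f^[k] a) := fun k hk => iterate_inv hI ha fun j hj => h j (by omega)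
  have : ∀ k ≤ N, φ (f^[k] a) ≤ φ a / 2 ^ k := by
    intro k
    induction k with
    | zero => simp
    | succ k ih =>
      intro hk
      rw [Function.iterate_succ_apply']
      refine (hφ _ (hIk k (by omega)) (h k (by omega))).trans ?_
      rw [pow_succ, ← div_div]
      have := ih (by omega)
      linarith
  have h1 := this N le_rfl
  have h2 := hc _ (hIk N le_rfl) (h N le_rfl)
  rw [le_div_iff₀ (by positivity)] at h1
  have : m * 2 ^ N ≤ φ (f^[N] a) * 2 ^ N := by gcongr
  linarith

theorem foldl_step_iterate {E B G : Type} [Inhabited G] (F : E × (B × G) → B) (e : E) (k : ℕ) :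
    ∀ (b : B) (l : List G), k ≤ l.length →
    (fun s : E × (B × List G) => (s.1, (F (s.1, (s.2.1, s.2.2.headI)), s.2.2.tail)))^[k] (e, (b, l))
      = (e, ((l.take k).foldl (fun b x => F (e, (b, x))) b, l.drop k)) := by
  induction k with
  | zero => simp
  | succ k ih =>
    intro b l hl
    cases l with
    | nil => simp at hl
    | cons x l =>
      rw [Function.iterate_succ_apply]
      exact (ih _ _ (by simpa using hl)).trans (by simp)

theorem Cmp.foldl [∀ i, Inhabited (γ i)] {F : ∀ i, ε i × (β i × γ i) → β i}
    {Q : ∀ i, ε i × (β i × γ i) → Prop} (hF : Cmp Q F)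
    {e : ∀ i, α i → ε i} {b₀ : ∀ i, α i → β i} {l : ∀ i, α i → List (γ i)}
    (he : Cmp S e) (hb₀ : Cmp S b₀) (hl : Cmp S l)
    (hQ : ∀ i a, S i a → ∀ (l₁ : List (γ i)) x l₂, l i a = l₁ ++ x :: l₂ →
      Q i (e i a, (l₁.foldl (fun b x => F i (e i a, (b, x))) (b₀ i a), x)))
    (b : ℕ → ℕ) (hb : PB b)
    (hsz : ∀ i a, S i a → ∀ l₁ l₂, l i a = l₁ ++ l₂ →
      sz (l₁.foldl (fun b x => F i (e i a, (b, x))) (b₀ i a)) ≤ b (sz a)) :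
    Cmp S (fun i a => (l i a).foldl (fun b x => F i (e i a, (b, x))) (b₀ i a)) := by
  obtain ⟨be, hbe, hse⟩ := he.sz_le
  obtain ⟨bl, hbl, hsl⟩ := hl.sz_le
  have hin := he.pair (hb₀.pair hl)
  obtain ⟨b₁, hb₁, hs₁⟩ := hin.sz_le
  -- the loop on the reachable states
  let st : ∀ i, ε i × (β i × List (γ i)) → ε i × (β i × List (γ i)) := fun i s =>
    (s.1, (F i (s.1, (s.2.1, s.2.2.headI)), s.2.2.tail))
  let I : ∀ i, ε i × (β i × List (γ i)) → Prop := fun i s =>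
    ∀ (l₁ : List (γ i)) x l₂, s.2.2 = l₁ ++ x :: l₂ →
      Q i (s.1, (l₁.foldl (fun b x => F i (s.1, (b, x))) s.2.1, x))
  have hbody : Cmp (fun i s => I i s ∧ 0 < if s.2.2 = [] then (0 : ℚ) else 1) st := by
    refine (fst ident).pair (pair ?_ (tail (snd (snd ident))))
    refine hF.comp ((fst ident).pair ((fst (snd ident)).pair (headI (snd (snd ident)) ?_))) ?_
    · intro i s hs
      by_contra h
      simp [h] at hs
    · rintro i ⟨e, b, l⟩ ⟨hI, hne⟩
      cases l with
      | nil => simp at hne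
      | cons x l => simpa using hI [] x l rfl
  -- The original input `a` is carried along unchanged, since the size bound `b (sz a)` has to be
  -- expressed through the initial state of the loop.
  have hloop : Cmp (α := fun i => α i × (ε i × (β i × List (γ i))))
      (fun i s => S i s.1 ∧ s.2 = (e i s.1, (b₀ i s.1, l i s.1)))
      (fun i s => untilF (fun x : α i × (ε i × (β i × List (γ i))) =>
        0 < if x.2.2.2 = [] then (0 : ℚ) else 1) (fun x => (x.1, st i x.2)) s) := by
    have hit : ∀ i a, ∀ k ≤ (l i a).length,
        (fun x : α i × (ε i × (β i × List (γ i))) => (x.1, st i x.2))^[k]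
          (a, (e i a, (b₀ i a, l i a))) = (a, (e i a, (((l i a).take k).foldl
            (fun b x => F i (e i a, (b, x))) (b₀ i a), (l i a).drop k))) := by
      intro i a k hk
      have : ∀ k (s : ε i × (β i × List (γ i))),
          (fun x : α i × (ε i × (β i × List (γ i))) => (x.1, st i x.2))^[k] (a, s)
            = (a, (st i)^[k] s) := by
        intro k
        induction k with
        | zero => simp
        | succ k ih => intro s; rw [Function.iterate_succ_apply, ih, Function.iterate_succ_apply]
      rw [this, foldl_step_iterate (F i) (e i a) k _ _ hk]
    refine Cmp.loop (I := fun i x => I i x.2) (nonempty (snd (snd (snd ident))))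
      ((fst ident).pair (hbody.comp (snd ident) fun i a h => h)) ?_ ?_
      (fun s => s) (fun s => 1 + s + (1 + s + (1 + b s + s))) PB.id
      (((PB.const 1).add PB.id).add (((PB.const 1).add PB.id).add (((PB.const 1).add hb).add PB.id)))
      ?_ ?_
    · rintro i ⟨a, s⟩ ⟨ha, hs⟩
      dsimp only at ha hs
      subst hs
      exact hQ i a ha
    · rintro i ⟨a, e, b, l⟩ hI hne
      cases l with
      | nil => simp at hne
      | cons x l =>
        intro l₁ y l₂ h
        simp only [st, List.tail] at h
        exact hI (x :: l₁) y l₂ (by simp [h])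
    · rintro i ⟨a, s⟩ ⟨ha, hs⟩
      dsimp only at ha hs
      subst hs
      refine ⟨(l i a).length, ?_, ?_⟩
      · have := length_le_sz (l i a)
        simp only [sz_prod]; omega
      · rw [hit i a _ le_rfl]; simp
    · rintro i ⟨a, s⟩ ⟨ha, hs⟩ k hk
      dsimp only at ha hs
      subst hs
      have hkl : k ≤ (l i a).length := by
        by_contra! h
        have := hk _ h
        rw [hit i a _ le_rfl] at this
        simp at this
      rw [hit i a k hkl]
      have h1 := hsz i a ha ((l i a).take k) ((l i a).drop k) (by simp)
      have h2 := sz_drop_le (l i a) k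
      have h3 := hb.1 (show sz a ≤ sz (a, (e i a, (b₀ i a, l i a))) by simp only [sz_prod]; omega)
      simp only [sz_prod] at *
      omega
  have := fst (snd (snd (hloop.comp (ident.pair hin) fun i a ha => ⟨ha, rfl⟩)))
  refine this.congr fun i a ha => ?_
  have hst : ∀ k (s : ε i × (β i × List (γ i))),
      (fun x : α i × (ε i × (β i × List (γ i))) => (x.1, st i x.2))^[k] (a, s)
        = (a, (st i)^[k] s) := by
    intro k
    induction k with
    | zero => simp
    | succ k ih => intro s; rw [Function.iterate_succ_apply, ih, Function.iterate_succ_apply]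
  rw [untilF_eq (k := (l i a).length)]
  · rw [hst, foldl_step_iterate (F i) (e i a) _ _ _ le_rfl]
    simp
  · intro j hj
    rw [hst, foldl_step_iterate (F i) (e i a) _ _ _ hj.le]
    have : (l i a).drop j ≠ [] := by simpa using hj
    simp [this]
  · rw [hst, foldl_step_iterate (F i) (e i a) _ _ _ le_rfl]
    simp

end

/-! ## Lists and vectors -/

section
variable {α β γ δ ε : Ctx → Type} [∀ i, Enc (α i)] [∀ i, Enc (β i)] [∀ i, Enc (γ i)]
  [∀ i, Enc (δ i)] [∀ i, Enc (ε i)] {S : ∀ i, α i → Prop}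

namespace Cmp

theorem reverse [∀ i, Inhabited (γ i)] {l : ∀ i, α i → List (γ i)} (hl : Cmp S l) :
    Cmp S (fun i a => (l i a).reverse) := by
  obtain ⟨b, hb, hs⟩ := hl.sz_le
  refine (foldl (ε := fun _ => ℚ) (β := fun i => List (γ i)) (Q := fun _ _ => True)
    (F := fun _ s => s.2.2 :: s.2.1)
    (cons (snd (snd ident)) (fst (snd ident))) (const 0) nil hl (fun _ _ _ _ _ _ _ => trivial)
    b hb ?_).congr ?_
  · intro i a ha l₁ l₂ h
    have := hs i a ha
    have h1 := sz_append l₁ l₂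
    rw [← h] at h1
    have : 2 ≤ sz l₂ := by rw [sz_list]; omega
    simp only [List.foldl_flip_cons_eq_append', List.append_nil, sz_reverse]
    omega
  · intro i a _
    simp

theorem append [∀ i, Inhabited (γ i)] {l m : ∀ i, α i → List (γ i)} (hl : Cmp S l)
    (hm : Cmp S m) : Cmp S (fun i a => l i a ++ m i a) := by
  obtain ⟨b, hb, hs⟩ := hl.sz_le
  obtain ⟨b', hb', hs'⟩ := hm.sz_le
  refine (foldl (ε := fun _ => ℚ) (β := fun i => List (γ i)) (Q := fun _ _ => True)
    (F := fun _ s => s.2.2 :: s.2.1)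
    (cons (snd (snd ident)) (fst (snd ident))) (const 0) hm hl.reverse (fun _ _ _ _ _ _ _ => trivial)
    (fun s => b s + b' s) (hb.add hb') ?_).congr ?_
  · intro i a ha l₁ l₂ h
    have := hs i a ha
    have := hs' i a ha
    have h1 := sz_append l₁ l₂
    rw [← h, sz_reverse] at h1
    have : 2 ≤ sz l₂ := by rw [sz_list]; omega
    have := sz_append l₁.reverse (m i a)
    rw [sz_reverse] at this
    simp only [List.foldl_flip_cons_eq_append']
    omega
  · intro i a _
    simp

/-- The fold prepends its results, so it runs over the reversed list. -/
theorem map [∀ i, Inhabited (γ i)] [∀ i, Inhabited (δ i)] {F : ∀ i, ε i × γ i → δ i}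
    {Q : ∀ i, ε i × γ i → Prop} (hF : Cmp Q F) {e : ∀ i, α i → ε i} {l : ∀ i, α i → List (γ i)}
    (he : Cmp S e) (hl : Cmp S l) (hQ : ∀ i a, S i a → ∀ x ∈ l i a, Q i (e i a, x)) :
    Cmp S (fun i a => (l i a).map fun x => F i (e i a, x)) := by
  obtain ⟨b, hb, hs⟩ := (he.pair hl).sz_le
  obtain ⟨b', hb', hs'⟩ := hF.sz_le
  have key : ∀ i a (l₁ : List (γ i)),
      l₁.foldl (fun (c : List (δ i)) x => F i (e i a, x) :: c) []
        = l₁.reverse.map fun x => F i (e i a, x) := by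
    intro i a l₁
    induction l₁ using List.reverseRecOn with
    | nil => simp
    | append_singleton l x ih => simp [ih]
  refine (foldl (ε := ε) (β := fun i => List (δ i)) (Q := fun i s => Q i (s.1, s.2.2))
    (F := fun i s => F i (s.1, s.2.2) :: s.2.1)
    (cons (hF.comp ((fst ident).pair (snd (snd ident))) fun _ _ h => h) (fst (snd ident)))
    he nil hl.reverse ?_
    (fun s => 2 + b s * (1 + b' (b s)))
    ((PB.const 2).add (hb.mul ((PB.const 1).add (hb'.comp hb)))) ?_).congr ?_
  · intro i a ha l₁ x l₂ h
    refine hQ i a ha x ?_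
    rw [← List.mem_reverse, h]; simp
  · intro i a ha l₁ l₂ h
    have h0 := hs i a ha
    rw [sz_prod] at h0
    dsimp only at h0
    rw [key]
    refine (sz_list_le _ (b' (b (sz a))) ?_).trans ?_
    · intro y hy
      obtain ⟨x, hx, rfl⟩ := List.mem_map.1 hy
      have hx' : x ∈ l i a := by
        rw [← List.mem_reverse, h]; simp at hx; simp [hx]
      refine (hs' i _ (hQ i a ha x hx')).trans (hb'.1 ?_)
      have := sz_le_of_mem hx'
      rw [sz_prod]; dsimp only; omega
    · have h1 := length_le_sz (l i a)
      have h2 : (l i a).length = l₁.length + l₂.length := by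
        rw [← List.length_reverse, h]; simp
      refine Nat.add_le_add_left (Nat.mul_le_mul_right _ ?_) _
      simp; omega
  · intro i a _
    simp only [key, List.reverse_reverse]

theorem map' [∀ i, Inhabited (γ i)] [∀ i, Inhabited (δ i)] {F : ∀ i, ε i × γ i → δ i}
    (hF : Cmp (fun _ _ => True) F) {e : ∀ i, α i → ε i} {l : ∀ i, α i → List (γ i)}
    (he : Cmp S e) (hl : Cmp S l) : Cmp S (fun i a => (l i a).map fun x => F i (e i a, x)) :=
  map hF he hl fun _ _ _ _ _ => trivial

theorem filter [∀ i, Inhabited (γ i)] {F : ∀ i, ε i × γ i → ℚ}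
    (hF : Cmp (fun _ _ => True) F) {e : ∀ i, α i → ε i} {l : ∀ i, α i → List (γ i)}
    (he : Cmp S e) (hl : Cmp S l) :
    Cmp S (fun i a => (l i a).filter fun x => 0 < F i (e i a, x)) := by
  obtain ⟨b, hb, hs⟩ := hl.sz_le
  have key : ∀ i a (l₁ : List (γ i)),
      l₁.foldl (fun (c : List (γ i)) x => if 0 < F i (e i a, x) then x :: c else c) []
        = l₁.reverse.filter fun x => 0 < F i (e i a, x) := by
    intro i a l₁
    induction l₁ using List.reverseRecOn with
    | nil => simp
    | append_singleton l x ih => simp [ih, List.filter_cons]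
  refine (foldl (ε := ε) (β := fun i => List (γ i)) (Q := fun _ _ => True)
    (F := fun i s => if 0 < F i (s.1, s.2.2) then s.2.2 :: s.2.1 else s.2.1)
    (ite' (hF.app ((fst ident).pair (snd (snd ident))))
      (cons (snd (snd ident)) (fst (snd ident))) (fst (snd ident)))
    he nil hl.reverse (fun _ _ _ _ _ _ _ => trivial) b hb ?_).congr ?_
  · intro i a ha l₁ l₂ h
    have h0 := hs i a ha
    rw [key]
    have h1 := sz_append l₁ l₂
    rw [← h, sz_reverse] at h1
    have h3 : 2 ≤ sz l₂ := by rw [sz_list]; omega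
    have h2 : ∀ (p : γ i → Bool) (l : List (γ i)), sz (l.filter p) ≤ sz l := by
      intro p l
      induction l with
      | nil => simp
      | cons x l ih => rw [List.filter_cons]; split_ifs <;> simp only [sz_cons] <;> omega
    have := h2 (fun x => 0 < F i (e i a, x)) l₁.reverse
    rw [sz_reverse] at this
    omega
  · intro i a _
    simp only [key, List.reverse_reverse]

theorem drop [∀ i, Inhabited (γ i)] [∀ i, Inhabited (δ i)] {l : ∀ i, α i → List (γ i)}
    {m : ∀ i, α i → List (δ i)} (hl : Cmp S l) (hm : Cmp S m) :
    Cmp S (fun i a => (m i a).drop (l i a).length) := by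
  obtain ⟨b, hb, hs⟩ := hm.sz_le
  have key : ∀ i (l₁ : List (γ i)) (m : List (δ i)),
      l₁.foldl (fun (c : List (δ i)) _ => c.tail) m = m.drop l₁.length := by
    intro i l₁
    induction l₁ with
    | nil => simp
    | cons x l ih => intro m; simp [ih, List.drop_tail]
  refine (foldl (ε := fun _ => ℚ) (β := fun i => List (δ i)) (Q := fun _ _ => True)
    (F := fun i s => s.2.1.tail) (tail (fst (snd ident)))
    (const 0) hm hl (fun _ _ _ _ _ _ _ => trivial) b hb ?_).congr ?_
  · intro i a ha l₁ l₂ h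
    rw [key]
    exact (sz_drop_le _ _).trans (hs i a ha)
  · intro i a _
    simp only [key]

end Cmp

/-! ### Sums -/

theorem divBy_list_sum {D : ℕ} (l : List ℚ) (h : ∀ x ∈ l, DivBy D x) : DivBy D l.sum := by
  induction l with
  | nil => simpa using DivBy.zero D
  | cons a l ih =>
    rw [List.sum_cons]
    exact (h a (by simp)).add (ih fun x hx => h x (by simp [hx]))

theorem abs_list_sum_le {M : ℚ} (l : List ℚ) (h : ∀ x ∈ l, |x| ≤ M) :
    |l.sum| ≤ l.length * M := by
  induction l with
  | nil => simp
  | cons a l ih =>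
    rw [List.sum_cons]
    refine (abs_add_le _ _).trans ?_
    have := h a (by simp)
    have := ih fun x hx => h x (by simp [hx])
    push_cast [List.length_cons]
    linarith

theorem nat_cast_le_two_pow (n : ℕ) : (n : ℚ) ≤ 2 ^ n := by
  exact_mod_cast Nat.lt_two_pow_self.le

theorem sz_sum_le (l : List ℚ) : sz l.sum ≤ 4 * sz l + 3 := by
  have := sz_rat_le (q := l.sum) (m := sz l + sz l) (cden_pos l) (cden_le l)
    (divBy_list_sum l fun x hx => (divBy_cden x).mono (cden_dvd_of_mem hx)) (by
      refine (abs_list_sum_le l fun x hx => (abs_lt_two_pow_sz x).le.trans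
        (pow_le_pow_right₀ (by norm_num) (sz_le_of_mem hx))).trans ?_
      rw [pow_add]
      have : (l.length : ℚ) ≤ 2 ^ sz l := (nat_cast_le_two_pow _).trans
        (pow_le_pow_right₀ (by norm_num) (length_le_sz l))
      gcongr)
  omega

theorem sz_vec_le_of {n : ℕ} {x : Vec n} {D k m : ℕ} (hD : 0 < D) (hDk : D ≤ 2 ^ k)
    (h : ∀ j, DivBy D (x j)) (hm : ∀ j, |x j| ≤ 2 ^ m) : sz x ≤ 2 + n * (1 + (2 * k + m + 3)) :=
  sz_vec_le x _ fun j => sz_rat_le hD hDk (h j) (hm j)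

theorem foldl_sub_apply {n : ℕ} (l : List (Vec n)) (x : Vec n) (j : Fin n) :
    l.foldl (· - ·) x j = x j - (l.map fun y => y j).sum := by
  induction l generalizing x with
  | nil => simp
  | cons a l ih => simp [ih]; ring

theorem foldl_sub_eq {n : ℕ} (l : List (Vec n)) (x : Vec n) :
    l.foldl (· - ·) x = x - l.sum := by
  induction l generalizing x with
  | nil => simp
  | cons a l ih => simp [ih]; abel

/-- Iterating `sz_sub_le` would give an exponential bound. Instead the result is a difference of
sums with one common denominator and a magnitude bounded term by term. -/
theorem sz_foldl_sub_le {n : ℕ} (l : List (Vec n)) (x : Vec n) :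
    sz (l.foldl (· - ·) x) ≤ 2 + n * (5 * (sz x + sz l) + 5) := by
  have := sz_vec_le_of (x := l.foldl (· - ·) x) (m := 2 * (sz x + sz l) + 1) (k := sz x + sz l)
    (Nat.mul_pos (cden_pos x) (cden_pos l))
    (by rw [pow_add]; exact Nat.mul_le_mul (cden_le x) (cden_le l)) ?_ ?_
  · refine this.trans (Nat.add_le_add_left (Nat.mul_le_mul_left _ ?_) _)
    omega
  · intro j
    rw [foldl_sub_apply]
    refine ((divBy_cden_vec x j).mono (Dvd.intro _ rfl)).sub (divBy_list_sum _ ?_)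
    intro y hy
    obtain ⟨v, hv, rfl⟩ := List.mem_map.1 hy
    exact (divBy_cden_vec v j).mono ((cden_dvd_of_mem hv).mul_left _)
  · intro j
    rw [foldl_sub_apply]
    have h1 := abs_list_sum_le (M := 2 ^ sz l) (l.map fun y => y j) (by
      intro y hy
      obtain ⟨v, hv, rfl⟩ := List.mem_map.1 hy
      exact (abs_coord_le v j).trans (pow_le_pow_right₀ (by norm_num) (sz_le_of_mem hv)))
    rw [List.length_map] at h1
    have h2 : (l.length : ℚ) ≤ 2 ^ sz l := (nat_cast_le_two_pow _).trans
        (pow_le_pow_right₀ (by norm_num) (length_le_sz l))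
    have h3 : (l.length : ℚ) * 2 ^ sz l ≤ 2 ^ (2 * (sz x + sz l)) := by
      calc (l.length : ℚ) * 2 ^ sz l ≤ 2 ^ sz l * 2 ^ sz l := by gcongr
        _ = 2 ^ (2 * sz l) := by rw [← pow_add]; congr 1; ring
        _ ≤ _ := pow_le_pow_right₀ (by norm_num) (by omega)
    have h4 : |x j| ≤ 2 ^ (2 * (sz x + sz l)) :=
      (abs_coord_le x j).trans (pow_le_pow_right₀ (by norm_num) (by omega))
    rw [pow_succ]
    refine (abs_sub _ _).trans ?_
    linarith

namespace Cmp

theorem sum {l : ∀ i, α i → List ℚ} (hl : Cmp S l) : Cmp S (fun i a => (l i a).sum) := by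
  obtain ⟨b, hb, hs⟩ := hl.sz_le
  refine (foldl (ε := fun _ => ℚ) (β := fun i => ℚ) (γ := fun i => ℚ) (Q := fun _ _ => True)
    (F := fun i s => s.2.1 + s.2.2) (add (fst (snd ident)) (snd (snd ident)))
    (const 0) (const 0) hl (fun _ _ _ _ _ _ _ => trivial)
    (fun s => 4 * b s + 3) (((PB.const 4).mul hb).add (PB.const 3)) ?_).congr ?_
  · intro i a ha l₁ l₂ h
    have h1 := sz_sum_le l₁
    have h2 := sz_append l₁ l₂
    have h3 : 2 ≤ sz l₂ := by rw [sz_list]; omega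
    have h4 := hs i a ha
    rw [h] at h4
    rw [← List.sum_eq_foldl]
    omega
  · intro i a _
    rw [List.sum_eq_foldl]

/-- Coordinatewise combination of two vectors. -/
theorem vzip {F : ∀ i, ε i × (ℚ × ℚ) → ℚ} (hF : Cmp (fun _ _ => True) F)
    {e : ∀ i, α i → ε i} {x y : ∀ i, α i → Vec i.n} (he : Cmp S e) (hx : Cmp S x) (hy : Cmp S y) :
    Cmp S (fun i a => (fun j => F i (e i a, (x i a j, y i a j)) : Vec i.n)) := by
  obtain ⟨be, hbe, hse⟩ := he.sz_le
  obtain ⟨bx, hbx, hsx⟩ := hx.sz_le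
  obtain ⟨by', hby, hsy⟩ := hy.sz_le
  obtain ⟨b', hb', hs'⟩ := hF.sz_le
  let B : ℕ → ℕ := fun s => b' (be s + bx s + by' s + 2)
  have hB : PB B := hb'.comp (((hbe.add hbx).add hby).add (PB.const 2))
  have hx' : Cmp S (fun i a => List.ofFn (x i a)) := hx.congr_enc fun i a _ => enc_vec _
  have hy' : Cmp S (fun i a => List.ofFn (y i a)) := hy.congr_enc fun i a _ => enc_vec _
  have key : ∀ i a (lx ly acc : List ℚ), lx.length = ly.length →
      lx.foldl (fun (c : List ℚ × List ℚ) x => (c.1.tail, F i (e i a, (x, c.1.headI)) :: c.2))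
        (ly, acc) = ([], (List.zipWith (fun x y => F i (e i a, (x, y))) lx ly).reverse ++ acc) := by
    intro i a lx
    induction lx with
    | nil => intro ly acc h; cases ly <;> simp_all
    | cons x lx ih =>
      intro ly acc h
      cases ly with
      | nil => simp at h
      | cons y ly => simp [ih ly _ (by simpa using h)]
  have key' : ∀ i a (lx ly acc : List ℚ), lx.length ≤ ly.length →
      lx.foldl (fun (c : List ℚ × List ℚ) x => (c.1.tail, F i (e i a, (x, c.1.headI)) :: c.2))
        (ly, acc) = (ly.drop lx.length,
          (List.zipWith (fun x y => F i (e i a, (x, y))) lx ly).reverse ++ acc) := by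
    intro i a lx
    induction lx with
    | nil => intro ly acc h; simp
    | cons x lx ih =>
      intro ly acc h
      cases ly with
      | nil => simp at h
      | cons y ly => simp [ih ly _ (by simpa using h)]
  -- The fold runs over the coordinates of `x`; its state holds the unread coordinates of `y` and
  -- the results so far, in reverse order.
  have := foldl (ε := ε) (β := fun _ => List ℚ × List ℚ) (γ := fun _ => ℚ) (Q := fun _ _ => True)
    (F := fun i s => (s.2.1.1.tail, F i (s.1, (s.2.2, s.2.1.1.headI)) :: s.2.1.2))
    ((tail (fst (fst (snd ident)))).pair (cons (hF.app ((fst ident).pair ((snd (snd ident)).pair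
      (headQ (fst (fst (snd ident))))))) (snd (fst (snd ident)))))
    he (hy'.pair nil) hx' (fun _ _ _ _ _ _ _ => trivial)
    (fun s => 1 + by' s + (2 + bx s * (1 + B s)))
    (((PB.const 1).add hby).add ((PB.const 2).add (hbx.mul ((PB.const 1).add hB)))) ?_
  · refine (reverse (snd this)).congr_enc fun i a _ => ?_
    rw [key i a _ _ _ (by simp), enc_vec]
    congr 1
    apply List.ext_getElem <;> simp
  · intro i a ha l₁ l₂ h
    have hlen : l₁.length + l₂.length = i.n := by
      have := congrArg List.length h
      simpa using this.symm
    rw [key' i a _ _ _ (by simp; omega), sz_prod]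
    have h1 := sz_drop_le (List.ofFn (y i a)) l₁.length
    have h2 := hsy i a ha
    rw [sz_vec] at h2
    have h3 : sz ((List.zipWith (fun x y => F i (e i a, (x, y))) l₁ (List.ofFn (y i a))).reverse
        ++ []) ≤ 2 + bx (sz a) * (1 + B (sz a)) := by
      rw [List.append_nil, sz_reverse]
      refine (sz_list_le _ (B (sz a)) ?_).trans ?_
      · intro z hz
        rw [List.mem_iff_getElem] at hz
        obtain ⟨k, hk, rfl⟩ := hz
        rw [List.getElem_zipWith]
        refine (hs' i _ trivial).trans (hb'.1 ?_)
        simp only [List.length_zipWith, lt_min_iff] at hk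
        have h4 : sz (l₁[k]) ≤ bx (sz a) := by
          refine le_trans ?_ (hsx i a ha)
          rw [sz_vec, h]
          exact sz_le_of_mem (by simp)
        have h5 : sz ((List.ofFn (y i a))[k]) ≤ by' (sz a) :=
          (sz_le_of_mem (List.getElem_mem _)).trans h2
        have := hse i a ha
        rw [sz_prod, sz_prod]
        dsimp only
        omega
      · refine Nat.add_le_add_left (Nat.mul_le_mul_right _ ?_) _
        have := dim_le_sz (x i a)
        have := hsx i a ha
        simp; omega
    dsimp only at *
    omega

theorem vsub {x y : ∀ i, α i → Vec i.n} (hx : Cmp S x) (hy : Cmp S y) :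
    Cmp S (fun i a => x i a - y i a) :=
  vzip (ε := fun _ => ℚ) (F := fun _ s => s.2.1 - s.2.2)
    (sub (fst (snd ident)) (snd (snd ident))) (const 0) hx hy

theorem vadd {x y : ∀ i, α i → Vec i.n} (hx : Cmp S x) (hy : Cmp S y) :
    Cmp S (fun i a => x i a + y i a) :=
  vzip (ε := fun _ => ℚ) (F := fun _ s => s.2.1 + s.2.2)
    (add (fst (snd ident)) (snd (snd ident))) (const 0) hx hy

theorem smul {q : ∀ i, α i → ℚ} {x : ∀ i, α i → Vec i.n} (hq : Cmp S q) (hx : Cmp S x) :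
    Cmp S (fun i a => q i a • x i a) :=
  vzip (ε := fun _ => ℚ) (F := fun _ s => s.1 * s.2.1)
    (mul (fst ident) (fst (snd ident))) hq hx hx

theorem dot {x y : ∀ i, α i → Vec i.n} (hx : Cmp S x) (hy : Cmp S y) :
    Cmp S (fun i a => x i a ⬝ᵥ y i a) := by
  have := vzip (ε := fun _ => ℚ) (F := fun _ s => s.2.1 * s.2.2)
    (mul (fst (snd ident)) (snd (snd ident))) (const 0) hx hy
  have h : Cmp S (fun i a => List.ofFn fun j => x i a j * y i a j) :=
    this.congr_enc fun i a _ => enc_vec _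
  exact h.sum.congr fun i a _ => by rw [List.sum_ofFn]; rfl

theorem foldl_sub {x : ∀ i, α i → Vec i.n} {l : ∀ i, α i → List (Vec i.n)} (hx : Cmp S x)
    (hl : Cmp S l) : Cmp S (fun i a => (l i a).foldl (· - ·) (x i a)) := by
  obtain ⟨b, hb, hs⟩ := hl.sz_le
  obtain ⟨b', hb', hs'⟩ := hx.sz_le
  refine foldl (ε := fun _ => ℚ) (β := fun i => Vec i.n) (γ := fun i => Vec i.n)
    (Q := fun _ _ => True) (F := fun i s => s.2.1 - s.2.2)
    (vsub (fst (snd ident)) (snd (snd ident)))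
    (const 0) hx hl (fun _ _ _ _ _ _ _ => trivial)
    (fun s => 2 + b' s * (5 * (b' s + b s) + 5)) ((PB.const 2).add (hb'.mul
      (((PB.const 5).mul (hb'.add hb)).add (PB.const 5)))) ?_
  intro i a ha l₁ l₂ h
  refine (sz_foldl_sub_le l₁ (x i a)).trans ?_
  have h2 := sz_append l₁ l₂
  have h3 : 2 ≤ sz l₂ := by rw [sz_list]; omega
  have h4 := hs i a ha
  have h5 := hs' i a ha
  have h6 := dim_le_sz (x i a)
  rw [h] at h4
  refine Nat.add_le_add_left (Nat.mul_le_mul ?_ ?_) _ <;> omega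

end Cmp

end

/-! ## Projections, Gram–Schmidt vectors, dual bases -/

section
variable {n : ℕ}

theorem dot_self_nonneg (x : Vec n) : 0 ≤ x ⬝ᵥ x :=
  Finset.sum_nonneg fun _ _ => mul_self_nonneg _

theorem dot_self_pos {x : Vec n} (h : x ≠ 0) : 0 < x ⬝ᵥ x :=
  (dot_self_nonneg x).lt_of_ne' fun h' => h (dotProduct_self_eq_zero.1 h')

/-- The subspace spanned by a list of vectors. -/
def sp (C : List (Vec n)) : Submodule ℚ (Vec n) := Submodule.span ℚ {x | x ∈ C}

/-- The lattice generated by a list of vectors. -/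
def latt (C : List (Vec n)) : Submodule ℤ (Vec n) := Submodule.span ℤ {x | x ∈ C}

theorem mem_sp {C : List (Vec n)} {x : Vec n} (h : x ∈ C) : x ∈ sp C := Submodule.subset_span h

theorem mem_latt {C : List (Vec n)} {x : Vec n} (h : x ∈ C) : x ∈ latt C := Submodule.subset_span h

theorem sp_le {C : List (Vec n)} {W : Submodule ℚ (Vec n)} : sp C ≤ W ↔ ∀ x ∈ C, x ∈ W :=
  Submodule.span_le

theorem latt_le {C : List (Vec n)} {W : Submodule ℤ (Vec n)} : latt C ≤ W ↔ ∀ x ∈ C, x ∈ W :=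
  Submodule.span_le

@[simp] theorem sp_nil : sp ([] : List (Vec n)) = ⊥ := by simp [sp]

@[simp] theorem latt_nil : latt ([] : List (Vec n)) = ⊥ := by simp [latt]

theorem sp_append (C D : List (Vec n)) : sp (C ++ D) = sp C ⊔ sp D := by
  rw [sp, sp, sp, ← Submodule.span_union]; congr 1; ext; simp

theorem latt_append (C D : List (Vec n)) : latt (C ++ D) = latt C ⊔ latt D := by
  rw [latt, latt, latt, ← Submodule.span_union]; congr 1; ext; simp

theorem sp_cons (c : Vec n) (D : List (Vec n)) : sp (c :: D) = sp [c] ⊔ sp D := sp_append [c] D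

theorem latt_cons (c : Vec n) (D : List (Vec n)) : latt (c :: D) = latt [c] ⊔ latt D :=
  latt_append [c] D

theorem latt_le_sp (C : List (Vec n)) {x : Vec n} (h : x ∈ latt C) : x ∈ sp C := by
  have : latt C ≤ (sp C).restrictScalars ℤ := latt_le.2 fun x hx => mem_sp hx
  exact this h

theorem sp_le_of_latt_le {C D : List (Vec n)} (h : latt C ≤ latt D) : sp C ≤ sp D :=
  sp_le.2 fun _ hx => latt_le_sp D (h (mem_latt hx))

theorem sp_eq_of_latt_eq {C D : List (Vec n)} (h : latt C = latt D) : sp C = sp D :=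
  le_antisymm (sp_le_of_latt_le h.le) (sp_le_of_latt_le h.ge)

theorem mem_latt_singleton {c x : Vec n} : x ∈ latt [c] ↔ ∃ k : ℤ, (k : ℚ) • c = x := by
  simp only [latt, List.mem_singleton, Set.ofPred_eq_eq_singleton, Submodule.mem_span_singleton,
    Int.cast_smul_eq_zsmul]

theorem mem_sp_singleton {c x : Vec n} : x ∈ sp [c] ↔ ∃ k : ℚ, k • c = x := by
  simp [sp, Submodule.mem_span_singleton]

theorem intCast_smul_mem {W : Submodule ℤ (Vec n)} {x : Vec n} (k : ℤ) (h : x ∈ W) :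
    (k : ℚ) • x ∈ W := by
  rw [Int.cast_smul_eq_zsmul]; exact W.smul_mem k h

theorem list_sum_mem_latt {C : List (Vec n)} {l : List (Vec n)} (h : ∀ x ∈ l, x ∈ latt C) :
    l.sum ∈ latt C := by
  induction l with
  | nil => simp
  | cons a l ih => simpa using add_mem (h a (by simp)) (ih fun x hx => h x (by simp [hx]))

theorem dot_eq_zero_of_sp {C : List (Vec n)} {p : Vec n} (h : ∀ y ∈ C, p ⬝ᵥ y = 0) {y : Vec n}
    (hy : y ∈ sp C) : p ⬝ᵥ y = 0 := by
  induction hy using Submodule.span_induction with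
  | mem x hx => exact h x hx
  | zero => simp
  | add x y _ _ hx hy => rw [dotProduct_add, hx, hy, add_zero]
  | smul a x _ hx => rw [dotProduct_smul, hx, smul_zero]

/-! ### Orthogonal projections -/

/-- `p` is the component of `x` orthogonal to `W`. -/
def IsPrj (W : Submodule ℚ (Vec n)) (x p : Vec n) : Prop := x - p ∈ W ∧ ∀ y ∈ W, p ⬝ᵥ y = 0

theorem IsPrj.unique {W : Submodule ℚ (Vec n)} {x p q : Vec n} (hp : IsPrj W x p)
    (hq : IsPrj W x q) : p = q := by
  have h : p - q ∈ W := by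
    have := W.sub_mem hq.1 hp.1
    simpa using this
  have h0 : (p - q) ⬝ᵥ (p - q) = 0 := by
    rw [sub_dotProduct, hp.2 _ h, hq.2 _ h, sub_zero]
  exact sub_eq_zero.1 (dotProduct_self_eq_zero.1 h0)

/-- Subtract from `x` its components along pairwise orthogonal vectors. -/
def prjO (u : List (Vec n)) (x : Vec n) : Vec n :=
  (u.map fun y => ((x ⬝ᵥ y) / (y ⬝ᵥ y)) • y).foldl (· - ·) x

/-- Vectors paired with their Gram–Schmidt vectors. -/
def gp (C : List (Vec n)) : List (Vec n × Vec n) :=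
  C.foldl (fun acc c => acc ++ [(c, prjO (acc.map Prod.snd) c)]) []

/-- Gram–Schmidt vectors. -/
def gso (C : List (Vec n)) : List (Vec n) := (gp C).map Prod.snd

/-- The component of `x` orthogonal to a list of vectors. -/
def prj (C : List (Vec n)) (x : Vec n) : Vec n := prjO (gso C) x

theorem gp_append_singleton (C : List (Vec n)) (c : Vec n) :
    gp (C ++ [c]) = gp C ++ [(c, prj C c)] := by
  simp [gp, prj, gso]

theorem gso_append_singleton (C : List (Vec n)) (c : Vec n) :
    gso (C ++ [c]) = gso C ++ [prj C c] := by
  simp [gso, gp_append_singleton]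

@[simp] theorem gso_nil : gso ([] : List (Vec n)) = [] := rfl

theorem gso_length (C : List (Vec n)) : (gso C).length = C.length := by
  induction C using List.reverseRecOn with
  | nil => rfl
  | append_singleton C c ih => simp [gso_append_singleton, ih]

theorem prjO_spec {u : List (Vec n)} (hu : u.Pairwise fun a b => a ⬝ᵥ b = 0) (x : Vec n) :
    IsPrj (sp u) x (prjO u x) := by
  have hsum : ∀ z ∈ u, (u.map fun y => ((x ⬝ᵥ y) / (y ⬝ᵥ y)) • y).sum ⬝ᵥ z = x ⬝ᵥ z := by
    induction u with
    | nil => simp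
    | cons a u ih =>
      rw [List.pairwise_cons] at hu
      intro z hz
      rw [List.map_cons, List.sum_cons, add_dotProduct, smul_dotProduct, smul_eq_mul]
      rcases List.mem_cons.1 hz with rfl | hz
      · have h0 : (u.map fun y => ((x ⬝ᵥ y) / (y ⬝ᵥ y)) • y).sum ⬝ᵥ z = 0 := by
          rw [dotProduct_comm]
          refine dot_eq_zero_of_sp (C := u) hu.1 ?_
          refine list_sum_mem (S := sp u) fun v hv => ?_
          obtain ⟨y, hy, rfl⟩ := List.mem_map.1 hv
          exact Submodule.smul_mem _ _ (mem_sp hy)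
        rw [h0, add_zero]
        -- Zero vectors are allowed in `u`: division by zero returns zero and they contribute
        -- nothing.
        by_cases hz0 : z = 0
        · simp [hz0]
        · exact div_mul_cancel₀ _ (dot_self_pos hz0).ne'
      · rw [hu.1 z hz, mul_zero, zero_add, ih hu.2 z hz]
  rw [prjO, foldl_sub_eq]
  refine ⟨?_, fun y hy => dot_eq_zero_of_sp (fun z hz => ?_) hy⟩
  · rw [sub_sub_cancel]
    refine list_sum_mem (S := sp u) fun v hv => ?_
    obtain ⟨y, hy, rfl⟩ := List.mem_map.1 hv
    exact Submodule.smul_mem _ _ (mem_sp hy)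
  · rw [sub_dotProduct, hsum z hz, sub_self]

theorem gso_spec (C : List (Vec n)) :
    sp (gso C) = sp C ∧ (gso C).Pairwise fun a b => a ⬝ᵥ b = 0 := by
  induction C using List.reverseRecOn with
  | nil => simp
  | append_singleton C c ih =>
    have hp := prjO_spec ih.2 c
    rw [← prj, ih.1] at hp
    rw [gso_append_singleton]
    constructor
    · rw [sp_append, sp_append, ih.1]
      apply le_antisymm
      · refine sup_le le_sup_left (sp_le.2 fun x hx => ?_)
        rw [List.mem_singleton] at hx
        subst hx
        have : prj C c = c - (c - prj C c) := by abel
        rw [this]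
        exact Submodule.sub_mem _ (Submodule.mem_sup_right (mem_sp (by simp)))
          (Submodule.mem_sup_left hp.1)
      · refine sup_le le_sup_left (sp_le.2 fun x hx => ?_)
        rw [List.mem_singleton] at hx
        subst hx
        have : x = (x - prj C x) + prj C x := by abel
        rw [this]
        refine Submodule.add_mem _ (Submodule.mem_sup_left hp.1)
          (Submodule.mem_sup_right (mem_sp ?_))
        simp
    · rw [List.pairwise_append]
      refine ⟨ih.2, by simp, fun a ha b hb => ?_⟩
      rw [List.mem_singleton] at hb
      subst hb
      rw [dotProduct_comm]
      exact hp.2 a (ih.1 ▸ mem_sp ha)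

theorem prj_spec (C : List (Vec n)) (x : Vec n) : IsPrj (sp C) x (prj C x) := by
  have := prjO_spec (gso_spec C).2 x
  rwa [(gso_spec C).1] at this

theorem sub_prj_mem (C : List (Vec n)) (x : Vec n) : x - prj C x ∈ sp C := (prj_spec C x).1

theorem prj_dot {C : List (Vec n)} {y : Vec n} (x : Vec n) (hy : y ∈ sp C) :
    prj C x ⬝ᵥ y = 0 := (prj_spec C x).2 y hy

theorem prj_eq {C : List (Vec n)} {x p : Vec n} (h : x - p ∈ sp C) (h' : ∀ y ∈ sp C, p ⬝ᵥ y = 0) :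
    prj C x = p := (prj_spec C x).unique ⟨h, h'⟩

/-- Projection as a linear map. -/
def prjL (C : List (Vec n)) : Vec n →ₗ[ℚ] Vec n where
  toFun := prj C
  map_add' x y := prj_eq (by
      have := add_mem (sub_prj_mem C x) (sub_prj_mem C y)
      convert this using 1; abel) fun z hz => by
    rw [add_dotProduct, prj_dot x hz, prj_dot y hz, add_zero]
  map_smul' a x := prj_eq (by
      have := (sp C).smul_mem a (sub_prj_mem C x)
      rwa [smul_sub] at this) fun z hz => by
    rw [RingHom.id_apply, smul_dotProduct, prj_dot x hz, smul_zero]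

theorem prj_add (C : List (Vec n)) (x y : Vec n) : prj C (x + y) = prj C x + prj C y :=
  (prjL C).map_add x y

theorem prj_sub (C : List (Vec n)) (x y : Vec n) : prj C (x - y) = prj C x - prj C y :=
  (prjL C).map_sub x y

theorem prj_smul (C : List (Vec n)) (a : ℚ) (x : Vec n) : prj C (a • x) = a • prj C x :=
  (prjL C).map_smul a x

theorem prj_list_sum (C : List (Vec n)) (l : List (Vec n)) :
    prj C l.sum = (l.map (prj C)).sum := map_list_sum (prjL C) l

theorem prj_eq_zero {C : List (Vec n)} {x : Vec n} : prj C x = 0 ↔ x ∈ sp C := by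
  constructor
  · intro h
    have := sub_prj_mem C x
    rwa [h, sub_zero] at this
  · intro h
    exact prj_eq (by simpa using h) (by simp)

theorem prj_of_dot_eq_zero {C : List (Vec n)} {x : Vec n} (h : ∀ y ∈ C, x ⬝ᵥ y = 0) :
    prj C x = x :=
  prj_eq (by simp) fun _ hy => dot_eq_zero_of_sp h hy

@[simp] theorem prj_nil (x : Vec n) : prj [] x = x := prj_of_dot_eq_zero (by simp)

theorem pythagoras {x y : Vec n} (h : x ⬝ᵥ y = 0) : (x + y) ⬝ᵥ (x + y) = x ⬝ᵥ x + y ⬝ᵥ y := by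
  rw [add_dotProduct, dotProduct_add, dotProduct_add, h, dotProduct_comm y x, h]; ring

theorem prj_norm_le {C : List (Vec n)} {x y : Vec n} (hy : y ∈ sp C) :
    prj C x ⬝ᵥ prj C x ≤ (x - y) ⬝ᵥ (x - y) := by
  have h : x - y = prj C x + ((x - prj C x) - y) := by abel
  have h0 := prj_dot x (Submodule.sub_mem _ (sub_prj_mem C x) hy)
  rw [h, pythagoras h0]
  linarith [dot_self_nonneg ((x - prj C x) - y)]

theorem prj_norm_le_self (C : List (Vec n)) (x : Vec n) : prj C x ⬝ᵥ prj C x ≤ x ⬝ᵥ x := by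
  simpa using prj_norm_le (C := C) (x := x) (y := 0) (Submodule.zero_mem _)

theorem sp_map_prj (V F : List (Vec n)) : sp V ⊔ sp (F.map (prj V)) = sp (V ++ F) := by
  rw [sp_append]
  apply le_antisymm
  · refine sup_le le_sup_left (sp_le.2 fun x hx => ?_)
    obtain ⟨y, hy, rfl⟩ := List.mem_map.1 hx
    have : prj V y = y - (y - prj V y) := by abel
    rw [this]
    exact Submodule.sub_mem _ (Submodule.mem_sup_right (mem_sp hy))
      (Submodule.mem_sup_left (sub_prj_mem V y))
  · refine sup_le le_sup_left (sp_le.2 fun x hx => ?_)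
    have : x = (x - prj V x) + prj V x := by abel
    rw [this]
    exact Submodule.add_mem _ (Submodule.mem_sup_left (sub_prj_mem V x))
      (Submodule.mem_sup_right (mem_sp (List.mem_map_of_mem hx)))

theorem prj_mem_sp_map {V F : List (Vec n)} {x : Vec n} (hx : x ∈ sp (V ++ F)) :
    prj V x ∈ sp (F.map (prj V)) := by
  rw [sp_append] at hx
  obtain ⟨y, hy, z, hz, rfl⟩ := Submodule.mem_sup.1 hx
  rw [prj_add, prj_eq_zero.2 hy, zero_add]
  clear hx
  induction hz using Submodule.span_induction with
  | mem x hx => exact mem_sp (List.mem_map_of_mem hx)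
  | zero => rw [prj_eq_zero.2 (Submodule.zero_mem _)]; exact Submodule.zero_mem _
  | add x y _ _ hx hy => rw [prj_add]; exact Submodule.add_mem _ hx hy
  | smul a x _ hx => rw [prj_smul]; exact Submodule.smul_mem _ _ hx

theorem prj_mem_latt_map {V F : List (Vec n)} {x : Vec n} (hx : x ∈ latt (V ++ F)) :
    prj V x ∈ latt (F.map (prj V)) := by
  rw [latt_append] at hx
  obtain ⟨y, hy, z, hz, rfl⟩ := Submodule.mem_sup.1 hx
  rw [prj_add, prj_eq_zero.2 (latt_le_sp _ hy), zero_add]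
  clear hx
  induction hz using Submodule.span_induction with
  | mem x hx => exact mem_latt (List.mem_map_of_mem hx)
  | zero => rw [prj_eq_zero.2 (Submodule.zero_mem _)]; exact Submodule.zero_mem _
  | add x y _ _ hx hy => rw [prj_add]; exact Submodule.add_mem _ hx hy
  | smul a x _ hx =>
    have := prj_smul V a x
    rw [Int.cast_smul_eq_zsmul] at this
    rw [this]; exact intCast_smul_mem _ hx

/-! ### Independent lists -/

/-- The vectors of the list are linearly independent. -/
def Indep (C : List (Vec n)) : Prop := C.length ≤ Module.finrank ℚ (sp C)

theorem finrank_sp_le (C : List (Vec n)) : Module.finrank ℚ (sp C) ≤ C.length := by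
  classical
  have h : sp C = Submodule.span ℚ (C.toFinset : Set (Vec n)) := by
    rw [sp]; congr 1; ext; simp
  rw [h]
  exact (finrank_span_finset_le_card _).trans (List.toFinset_card_le _)

theorem Indep.finrank_eq {C : List (Vec n)} (h : Indep C) : Module.finrank ℚ (sp C) = C.length :=
  le_antisymm (finrank_sp_le C) h

theorem indep_iff {C : List (Vec n)} : Indep C ↔ LinearIndependent ℚ C.get := by
  have hr : Set.range C.get = {x | x ∈ C} := by ext; simp [List.mem_iff_get]
  rw [linearIndependent_iff_card_eq_finrank_span, Set.finrank, hr, ← sp, Fintype.card_fin]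
  exact ⟨fun h => h.finrank_eq.symm, fun h => h.le⟩

theorem indep_of_sp_eq {C D : List (Vec n)} (h : Indep C) (hs : sp C = sp D)
    (hl : C.length = D.length) : Indep D := by rwa [Indep, ← hs, ← hl]

theorem Indep.nodup {C : List (Vec n)} (h : Indep C) : C.Nodup :=
  List.nodup_iff_injective_get.2 (indep_iff.1 h).injective

theorem Indep.right {V F : List (Vec n)} (h : Indep (V ++ F)) : Indep F := by
  have h1 := Submodule.finrank_add_le_finrank_add_finrank (sp V) (sp F)
  rw [← sp_append, h.finrank_eq, List.length_append] at h1
  have := finrank_sp_le V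
  unfold Indep; omega

/-- `V` and the projected vectors still span a space of dimension `V.length + F.length`, which
leaves no room for a relation. -/
theorem Indep.map_prj {V F : List (Vec n)} (h : Indep (V ++ F)) : Indep (F.map (prj V)) := by
  have h1 := Submodule.finrank_add_le_finrank_add_finrank (sp V) (sp (F.map (prj V)))
  rw [sp_map_prj, h.finrank_eq, List.length_append] at h1
  have := finrank_sp_le V
  unfold Indep; rw [List.length_map]; omega

theorem Indep.append_singleton {C : List (Vec n)} {c : Vec n} (h : Indep C) (hc : c ∉ sp C) :
    Indep (C ++ [c]) := by
  have h1 : sp C < sp (C ++ [c]) := by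
    refine lt_of_le_of_ne (by rw [sp_append]; exact le_sup_left) fun he => hc ?_
    rw [he]; exact mem_sp (by simp)
  have h2 := Submodule.finrank_lt_finrank_of_lt h1
  rw [h.finrank_eq] at h2
  unfold Indep; simp; omega

theorem Indep.ne_zero {C : List (Vec n)} (h : Indep C) {c : Vec n} (hc : c ∈ C) : c ≠ 0 := by
  obtain ⟨k, rfl⟩ := List.mem_iff_get.1 hc
  exact (indep_iff.1 h).ne_zero k

/-! ### Dual bases -/

/-- The other vectors of a list. -/
def others (C : List (Vec n)) (c : Vec n) : List (Vec n) :=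
  C.filter fun x => 0 < (x - c) ⬝ᵥ (x - c)

/-- The dual basis vector belonging to a basis vector. -/
def dualv (C : List (Vec n)) (c : Vec n) : Vec n :=
  (1 / (prj (others C c) c ⬝ᵥ prj (others C c) c)) • prj (others C c) c

/-- The machine tests only the positivity of rationals, so two vectors are told apart by their
squared distance. -/
theorem mem_others {C : List (Vec n)} {c x : Vec n} : x ∈ others C c ↔ x ∈ C ∧ x ≠ c := by
  simp only [others, List.mem_filter, decide_eq_true_eq]
  refine and_congr_right fun _ => ⟨fun h he => ?_, fun h => dot_self_pos (sub_ne_zero.2 h)⟩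
  simp [he] at h

theorem sp_others {C : List (Vec n)} {c : Vec n} (hc : c ∈ C) : sp C = sp [c] ⊔ sp (others C c) := by
  apply le_antisymm
  · refine sp_le.2 fun x hx => ?_
    by_cases h : x = c
    · exact Submodule.mem_sup_left (mem_sp (by simp [h]))
    · exact Submodule.mem_sup_right (mem_sp (mem_others.2 ⟨hx, h⟩))
  · refine sup_le (sp_le.2 fun x hx => ?_) (sp_le.2 fun x hx => mem_sp (mem_others.1 hx).1)
    rw [List.mem_singleton] at hx
    exact mem_sp (hx ▸ hc)

theorem not_mem_sp_others {C : List (Vec n)} (h : Indep C) {c : Vec n} (hc : c ∈ C) :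
    c ∉ sp (others C c) := by
  intro hm
  have h1 : sp C = sp (others C c) := by
    rw [sp_others hc]
    exact sup_eq_right.2 (sp_le.2 fun x hx => by rw [List.mem_singleton] at hx; rwa [hx])
  have h2 := finrank_sp_le (others C c)
  rw [← h1, h.finrank_eq] at h2
  have h3 : (others C c).length < C.length := by
    rw [others, List.length_filter_lt_length_iff_exists]
    exact ⟨c, hc, by simp⟩
  omega

theorem prj_others_pos {C : List (Vec n)} (h : Indep C) {c : Vec n} (hc : c ∈ C) :
    0 < prj (others C c) c ⬝ᵥ prj (others C c) c :=
  dot_self_pos fun h0 => not_mem_sp_others h hc (prj_eq_zero.1 h0)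

theorem dualv_dot_self {C : List (Vec n)} (h : Indep C) {c : Vec n} (hc : c ∈ C) :
    dualv C c ⬝ᵥ c = 1 := by
  have h1 := prj_dot c (sub_prj_mem (others C c) c)
  rw [dotProduct_sub, sub_eq_zero] at h1
  rw [dualv, smul_dotProduct, h1, smul_eq_mul, one_div_mul_cancel (prj_others_pos h hc).ne']

theorem dualv_dot_of_ne {C : List (Vec n)} {c x : Vec n} (hx : x ∈ C) (hne : x ≠ c) :
    dualv C c ⬝ᵥ x = 0 := by
  rw [dualv, smul_dotProduct, prj_dot c (mem_sp (mem_others.2 ⟨hx, hne⟩)), smul_zero]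

theorem dualv_mem {C : List (Vec n)} {c : Vec n} (hc : c ∈ C) : dualv C c ∈ sp C := by
  refine Submodule.smul_mem _ _ ?_
  have : prj (others C c) c = c - (c - prj (others C c) c) := by abel
  rw [this]
  refine Submodule.sub_mem _ (mem_sp hc) ?_
  rw [sp_others hc]
  exact Submodule.mem_sup_right (sub_prj_mem _ _)

theorem sum_map_eq_single {l : List (Vec n)} (hl : l.Nodup) {c : Vec n} (hc : c ∈ l)
    (f : Vec n → Vec n) (hf : ∀ x ∈ l, x ≠ c → f x = 0) : (l.map f).sum = f c := by
  induction l with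
  | nil => simp at hc
  | cons a l ih =>
    rw [List.nodup_cons] at hl
    rw [List.map_cons, List.sum_cons]
    rcases List.mem_cons.1 hc with rfl | hc
    · rw [List.sum_eq_zero, add_zero]
      intro y hy
      obtain ⟨x, hx, rfl⟩ := List.mem_map.1 hy
      exact hf x (by simp [hx]) fun h => hl.1 (h ▸ hx)
    · rw [ih hl.2 hc fun x hx => hf x (by simp [hx]), hf a (by simp) (fun h => hl.1 (h ▸ hc)),
        zero_add]

theorem sum_map_smul_add (l : List (Vec n)) (f g : Vec n → ℚ) :
    (l.map fun c => (f c + g c) • c).sum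
      = (l.map fun c => f c • c).sum + (l.map fun c => g c • c).sum := by
  induction l with
  | nil => simp
  | cons a l ih => simp only [List.map_cons, List.sum_cons, add_smul] at ih ⊢; rw [ih]; abel

theorem sum_map_smul_smul (l : List (Vec n)) (a : ℚ) (f : Vec n → ℚ) :
    (l.map fun c => (a * f c) • c).sum = a • (l.map fun c => f c • c).sum := by
  induction l with
  | nil => simp
  | cons a l ih => simp [ih, smul_smul]

/-- Expansion of a vector in a basis. -/
theorem dual_expand {C : List (Vec n)} (h : Indep C) {y : Vec n} (hy : y ∈ sp C) :
    (C.map fun c => (y ⬝ᵥ dualv C c) • c).sum = y := by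
  induction hy using Submodule.span_induction with
  | mem x hx =>
    rw [sum_map_eq_single h.nodup hx (fun c => (x ⬝ᵥ dualv C c) • c)]
    · rw [dotProduct_comm, dualv_dot_self h hx, one_smul]
    · intro c _ hne
      rw [dotProduct_comm, dualv_dot_of_ne hx hne.symm, zero_smul]
  | zero => rw [List.sum_eq_zero]; simp
  | add x y _ _ hx hy =>
    simp only [add_dotProduct]
    rw [sum_map_smul_add, hx, hy]
  | smul a x _ hx =>
    simp only [smul_dotProduct, smul_eq_mul]
    rw [sum_map_smul_smul, hx]

theorem dot_dualv_int {C : List (Vec n)} (h : Indep C) {y c : Vec n} (hy : y ∈ latt C)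
    (hc : c ∈ C) : ∃ z : ℤ, y ⬝ᵥ dualv C c = z := by
  induction hy using Submodule.span_induction with
  | mem x hx =>
    by_cases hne : x = c
    · exact ⟨1, by rw [hne, dotProduct_comm, dualv_dot_self h hc]; simp⟩
    · exact ⟨0, by rw [dotProduct_comm, dualv_dot_of_ne hx hne]; simp⟩
  | zero => exact ⟨0, by simp⟩
  | add x y _ _ hx hy =>
    obtain ⟨a, ha⟩ := hx
    obtain ⟨b, hb⟩ := hy
    exact ⟨a + b, by rw [add_dotProduct, ha, hb]; push_cast; rfl⟩
  | smul a x _ hx =>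
    obtain ⟨b, hb⟩ := hx
    refine ⟨a * b, ?_⟩
    rw [← Int.cast_smul_eq_zsmul ℚ, smul_dotProduct, hb]; push_cast; rfl

theorem mem_latt_of_dual {C : List (Vec n)} (h : Indep C) {y : Vec n} (hy : y ∈ sp C)
    (hz : ∀ c ∈ C, ∃ z : ℤ, y ⬝ᵥ dualv C c = z) : y ∈ latt C := by
  rw [← dual_expand h hy]
  refine list_sum_mem_latt fun x hx => ?_
  obtain ⟨c, hc, rfl⟩ := List.mem_map.1 hx
  obtain ⟨z, hz⟩ := hz c hc
  rw [hz]
  exact intCast_smul_mem z (mem_latt hc)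

theorem dualv_unique {C : List (Vec n)} (h : Indep C) {c v : Vec n} (hc : c ∈ C) (hv : v ∈ sp C)
    (h1 : v ⬝ᵥ c = 1) (h0 : ∀ x ∈ C, x ≠ c → v ⬝ᵥ x = 0) : dualv C c = v := by
  have hm : v - dualv C c ∈ sp C := Submodule.sub_mem _ hv (dualv_mem hc)
  have : (v - dualv C c) ⬝ᵥ (v - dualv C c) = 0 := by
    refine dot_eq_zero_of_sp (fun x hx => ?_) hm
    rw [sub_dotProduct]
    by_cases hne : x = c
    · rw [hne, h1, dualv_dot_self h hc, sub_self]
    · rw [h0 x hx hne, dualv_dot_of_ne hx hne, sub_self]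
  exact (sub_eq_zero.1 (dotProduct_self_eq_zero.1 this)).symm

/-- The dual basis. -/
def dual (C : List (Vec n)) : List (Vec n) := C.map (dualv C)

/-- A vector of the span of `C` that is orthogonal to all dual vectors has only zero coefficients in
`dual_expand` and therefore vanishes; apply this to the component of `y` orthogonal to the dual
basis. -/
theorem sp_dual {C : List (Vec n)} (h : Indep C) : sp (dual C) = sp C := by
  have hle : sp (dual C) ≤ sp C := sp_le.2 fun x hx => by
    obtain ⟨c, hc, rfl⟩ := List.mem_map.1 hx
    exact dualv_mem hc
  refine le_antisymm hle fun y hy => ?_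
  rw [← prj_eq_zero]
  have hp : prj (dual C) y ∈ sp C := by
    have : prj (dual C) y = y - (y - prj (dual C) y) := by abel
    rw [this]
    exact Submodule.sub_mem _ hy (hle (sub_prj_mem _ _))
  rw [← dual_expand h hp, List.sum_eq_zero]
  intro x hx
  obtain ⟨c, hc, rfl⟩ := List.mem_map.1 hx
  rw [prj_dot y (mem_sp (C := dual C) (List.mem_map_of_mem hc)), zero_smul]

theorem Indep.dual {C : List (Vec n)} (h : Indep C) : Indep (dual C) :=
  indep_of_sp_eq h (sp_dual h).symm (by simp [LatticeProblems.dual])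

theorem dualv_dual {C : List (Vec n)} (h : Indep C) {c : Vec n} (hc : c ∈ C) :
    dualv (dual C) (dualv C c) = c := by
  refine dualv_unique h.dual (List.mem_map_of_mem hc) ?_ ?_ ?_
  · rw [sp_dual h]; exact mem_sp hc
  · rw [dotProduct_comm, dualv_dot_self h hc]
  · intro x hx hne
    obtain ⟨d, hd, rfl⟩ := List.mem_map.1 hx
    rw [dotProduct_comm]
    exact dualv_dot_of_ne hc fun h => hne (by rw [h])

theorem dual_dual {C : List (Vec n)} (h : Indep C) : dual (dual C) = C := by
  rw [dual, dual, List.map_map]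
  conv_rhs => rw [← List.map_id C]
  exact List.map_congr_left fun c hc => dualv_dual h hc

theorem mem_latt_iff_dual {C : List (Vec n)} (h : Indep C) {y : Vec n} :
    y ∈ latt C ↔ y ∈ sp C ∧ ∀ d ∈ latt (dual C), ∃ z : ℤ, y ⬝ᵥ d = z := by
  constructor
  · intro hy
    refine ⟨latt_le_sp _ hy, fun d hd => ?_⟩
    induction hd using Submodule.span_induction with
    | mem x hx =>
      obtain ⟨c, hc, rfl⟩ := List.mem_map.1 hx
      exact dot_dualv_int h hy hc
    | zero => exact ⟨0, by simp⟩
    | add u v _ _ hu hv =>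
      obtain ⟨a, ha⟩ := hu
      obtain ⟨b, hb⟩ := hv
      exact ⟨a + b, by rw [dotProduct_add, ha, hb]; push_cast; rfl⟩
    | smul a v _ hv =>
      obtain ⟨b, hb⟩ := hv
      refine ⟨a * b, ?_⟩
      rw [← Int.cast_smul_eq_zsmul ℚ, dotProduct_smul, hb]; push_cast; rfl
  · rintro ⟨hy, hd⟩
    exact mem_latt_of_dual h hy fun c hc => hd _ (mem_latt (List.mem_map_of_mem hc))

/-- The dual of a basis of the dual lattice is a basis of the lattice. -/
theorem latt_dual_eq {C E : List (Vec n)} (hC : Indep C) (hE : Indep E)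
    (h : latt E = latt (dual C)) : latt (dual E) = latt C := by
  ext y
  rw [mem_latt_iff_dual hC, mem_latt_iff_dual hE.dual, dual_dual hE, h, sp_dual hE,
    sp_eq_of_latt_eq h, sp_dual hC]

/-! ### The nearest plane algorithm -/

/-- Babai's nearest plane algorithm: the difference of a vector and a nearby lattice vector. -/
def np (C : List (Vec n)) (x : Vec n) : Vec n :=
  (gp C).reverse.foldl
    (fun y p => y - ((⌊(y ⬝ᵥ p.2) / (p.2 ⬝ᵥ p.2) + 1 / 2⌋ : ℤ) : ℚ) • p.1) x

theorem np_append_singleton (C : List (Vec n)) (c x : Vec n) :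
    np (C ++ [c]) x = np C (x - ((⌊(x ⬝ᵥ prj C c) / (prj C c ⬝ᵥ prj C c) + 1 / 2⌋ : ℤ) : ℚ) • c) := by
  simp [np, gp_append_singleton]

theorem sub_np_mem (C : List (Vec n)) (x : Vec n) : x - np C x ∈ latt C := by
  induction C using List.reverseRecOn generalizing x with
  | nil => simp [np, gp]
  | append_singleton C c ih =>
    rw [np_append_singleton]
    generalize (⌊(x ⬝ᵥ prj C c) / (prj C c ⬝ᵥ prj C c) + 1 / 2⌋ : ℤ) = q
    have h := ih (x - (q : ℚ) • c)
    have h2 : x - np C (x - (q : ℚ) • c) = (x - (q : ℚ) • c - np C (x - (q : ℚ) • c)) + (q : ℚ) • c := by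
      abel
    rw [h2, latt_append]
    exact add_mem (Submodule.mem_sup_left h)
      (Submodule.mem_sup_right (intCast_smul_mem q (mem_latt (by simp))))

theorem prj_append_singleton (C : List (Vec n)) (c x : Vec n) :
    prj (C ++ [c]) x = prj C x - ((x ⬝ᵥ prj C c) / (prj C c ⬝ᵥ prj C c)) • prj C c := by
  rw [prj, prj, prjO, gso_append_singleton, List.map_append, List.foldl_append]
  rfl

theorem round_error (r : ℚ) : (r - ((⌊r + 1 / 2⌋ : ℤ) : ℚ)) ^ 2 ≤ 1 / 4 := by
  have h1 := Int.floor_le (r + 1 / 2)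
  have h2 := Int.lt_floor_add_one (r + 1 / 2)
  nlinarith

/-- A round for the last vector `c` leaves the component orthogonal to the whole list unchanged and
makes the coefficient along the Gram–Schmidt vector of `c` at most one half; the remaining rounds
subtract vectors orthogonal to both parts. The factor `4` in the denominator is the square of this
one half. -/
theorem np_norm_le (C : List (Vec n)) (x : Vec n) :
    np C x ⬝ᵥ np C x ≤ prj C x ⬝ᵥ prj C x + (((gso C).map fun u => u ⬝ᵥ u).sum) / 4 := by
  induction C using List.reverseRecOn generalizing x with
  | nil => simp [np, gp]
  | append_singleton C c ih =>
    rw [np_append_singleton, gso_append_singleton, prj_append_singleton]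
    set p := prj C c with hp
    set r := (x ⬝ᵥ p) / (p ⬝ᵥ p) with hr
    refine (ih _).trans ?_
    have hpx : prj C (x - ((⌊r + 1 / 2⌋ : ℤ) : ℚ) • c)
        = (prj C x - r • p) + (r - ((⌊r + 1 / 2⌋ : ℤ) : ℚ)) • p := by
      rw [prj_sub, prj_smul, ← hp, sub_smul]; abel
    have h0 : (prj C x - r • p) ⬝ᵥ p = 0 := by
      by_cases h : p = 0
      · rw [h]; simp
      · have h1 : x ⬝ᵥ p = prj C x ⬝ᵥ p := by
          have : (x - prj C x) ⬝ᵥ p = 0 := by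
            rw [dotProduct_comm]; exact prj_dot c (sub_prj_mem C x)
          rwa [sub_dotProduct, sub_eq_zero] at this
        rw [sub_dotProduct, smul_dotProduct, smul_eq_mul, hr,
          div_mul_cancel₀ _ (dot_self_pos h).ne', h1, sub_self]
    rw [hpx, pythagoras (by rw [dotProduct_smul, h0, smul_zero]), List.map_append, List.sum_append]
    have h2 : ((r - ((⌊r + 1 / 2⌋ : ℤ) : ℚ)) • p) ⬝ᵥ ((r - ((⌊r + 1 / 2⌋ : ℤ) : ℚ)) • p)
        ≤ (p ⬝ᵥ p) / 4 := by
      rw [smul_dotProduct, dotProduct_smul, smul_eq_mul, smul_eq_mul, ← mul_assoc, ← sq]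
      have := mul_le_mul_of_nonneg_right (round_error r) (dot_self_nonneg p)
      linarith
    simp only [List.map_cons, List.map_nil, List.sum_cons, List.sum_nil, add_zero]
    linarith

/-! ### Lifting from projected lattices -/

/-- The vectors of `F`, with the coefficients of `y` in the projected basis. -/
def coefs (V F : List (Vec n)) (y : Vec n) : List (Vec n × ℚ) :=
  F.map fun f => (f, y ⬝ᵥ dualv (F.map (prj V)) (prj V f))

/-- The integer combination of `F` whose projection is `y`. -/
def lift (V F : List (Vec n)) (y : Vec n) : Vec n :=
  (F.map fun f => (-(y ⬝ᵥ dualv (F.map (prj V)) (prj V f))) • f).foldl (· - ·) 0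

/-- `lift` is written as an iterated subtraction of negated terms so that `Cmp.foldl_sub` computes
it; the sum is the form used in proofs. -/
theorem lift_eq (V F : List (Vec n)) (y : Vec n) :
    lift V F y = ((coefs V F y).map fun p => p.2 • p.1).sum := by
  rw [lift, coefs, foldl_sub_eq, List.map_map, zero_sub]
  simp [Function.comp_def, List.sum_neg]

theorem coefs_int {V F : List (Vec n)} (h : Indep (F.map (prj V))) {y : Vec n}
    (hy : y ∈ latt (F.map (prj V))) : ∀ p ∈ coefs V F y, ∃ z : ℤ, p.2 = z := by
  intro p hp
  obtain ⟨f, hf, rfl⟩ := List.mem_map.1 hp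
  exact dot_dualv_int h hy (List.mem_map_of_mem hf)

theorem prj_lift {V F : List (Vec n)} (h : Indep (F.map (prj V))) {y : Vec n}
    (hy : y ∈ sp (F.map (prj V))) : prj V (lift V F y) = y := by
  rw [lift_eq, prj_list_sum, coefs, List.map_map, List.map_map]
  conv_rhs => rw [← dual_expand h hy, List.map_map]
  refine congrArg List.sum (List.map_congr_left fun f _ => ?_)
  simp [prj_smul]

theorem lift_mem {V F : List (Vec n)} (h : Indep (F.map (prj V))) {y : Vec n}
    (hy : y ∈ latt (F.map (prj V))) : lift V F y ∈ latt F := by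
  rw [lift_eq]
  refine list_sum_mem_latt fun x hx => ?_
  obtain ⟨p, hp, rfl⟩ := List.mem_map.1 hx
  obtain ⟨z, hz⟩ := coefs_int h hy p hp
  obtain ⟨f, hf, rfl⟩ := List.mem_map.1 hp
  dsimp only at hz ⊢
  rw [hz]
  exact intCast_smul_mem z (mem_latt hf)

end

/-! ## Sizes of projections -/

section
variable {n : ℕ}

theorem abs_dot_le {x y : Vec n} {X Y : ℚ} (hx : ∀ j, |x j| ≤ X) (hy : ∀ j, |y j| ≤ Y) :
    |x ⬝ᵥ y| ≤ n * (X * Y) := by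
  refine (Finset.abs_sum_le_sum_abs _ _).trans ?_
  refine (Finset.sum_le_sum (g := fun _ => X * Y) fun j _ => ?_).trans (by simp)
  rw [abs_mul]
  exact mul_le_mul (hx j) (hy j) (abs_nonneg _) ((abs_nonneg _).trans (hx j))

theorem divBy_dot {x y : Vec n} {D E : ℕ} (hx : ∀ j, DivBy D (x j)) (hy : ∀ j, DivBy E (y j)) :
    DivBy (D * E) (x ⬝ᵥ y) :=
  DivBy.sum _ _ fun j _ => (hx j).mul (hy j)

theorem sq_coord_le (x : Vec n) (j : Fin n) : x j ^ 2 ≤ x ⬝ᵥ x := by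
  rw [sq]
  exact Finset.single_le_sum (f := fun j => x j * x j) (fun _ _ => mul_self_nonneg _)
    (Finset.mem_univ j)

/-- By Cramer's rule, the coefficients of the component of `x` inside the span have the determinant
of an integral Gram matrix as a denominator, and this determinant has polynomial bit length. -/
theorem exists_den_prj (C : List (Vec n)) (x : Vec n) :
    ∃ Δ : ℕ, 0 < Δ ∧ Δ ≤ 2 ^ (sz C + sz x + 6 * (sz C + sz x) ^ 2) ∧
      ∀ j, DivBy Δ (prj C x j) := by
  classical
  set s := sz C + sz x with hs
  -- `C` may be dependent; a maximal independent subfamily spans the same space and has a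
  -- nonsingular Gram matrix.
  obtain ⟨κ, a, ha, hspan, hli⟩ := exists_linearIndependent' ℚ C.get
  have : Fintype κ := Fintype.ofInjective a ha
  let c : κ → Vec n := fun k => C.get (a k)
  have hspan' : Submodule.span ℚ (Set.range c) = sp C := by
    have : Set.range C.get = {x | x ∈ C} := by ext; simp [List.mem_iff_get]
    rw [sp, ← this, ← hspan]; rfl
  let D := cden C * cden x
  have hD : 0 < D := Nat.mul_pos (cden_pos C) (cden_pos x)
  have hDs : D ≤ 2 ^ s := by
    rw [hs, pow_add]; exact Nat.mul_le_mul (cden_le C) (cden_le x)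
  have hcD : ∀ k j, DivBy D (c k j) := fun k j =>
    (divBy_cden_vec (c k) j).mono ((cden_dvd_of_mem (List.get_mem C (a k))).mul_right _)
  have hxD : ∀ j, DivBy D (x j) := fun j => (divBy_cden_vec x j).mono (Dvd.intro_left _ rfl)
  -- Multiplication by `D * D` makes the Gram matrix and the right-hand side of the normal equations
  -- integral.
  choose G hG using fun k l => divBy_dot (hcD k) (hcD l)
  choose b hb using fun k => divBy_dot hxD (hcD k)
  let A : Matrix κ κ ℤ := Matrix.of fun k l => G l k
  -- coefficients of the projection
  obtain ⟨μ, hμ⟩ : ∃ μ : κ → ℚ, ∑ k, μ k • c k = x - prj C x := by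
    have := sub_prj_mem C x
    rw [← hspan', Submodule.mem_span_range_iff_exists_fun] at this
    exact this
  have hAμ : (A.map (Int.cast : ℤ → ℚ)).mulVec μ = fun k => (b k : ℚ) := by
    funext k
    have h0 : (x - prj C x) ⬝ᵥ c k = x ⬝ᵥ c k := by
      rw [sub_dotProduct, prj_dot x (mem_sp (List.get_mem C (a k))), sub_zero]
    rw [← hμ, sum_dotProduct] at h0
    simp only [Matrix.mulVec, dotProduct, Matrix.map_apply, A, Matrix.of_apply]
    rw [← hb k, ← h0, Finset.mul_sum]
    refine Finset.sum_congr rfl fun l _ => ?_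
    rw [← hG l k, smul_dotProduct, smul_eq_mul]; ring
  -- A kernel vector would give a combination of the `c k` orthogonal to every `c k`, hence to
  -- itself, hence zero.
  have hdet : A.det ≠ 0 := by
    intro h0
    have h1 : (A.map (Int.cast : ℤ → ℚ)).det = 0 := by
      have := Int.cast_det (R := ℚ) A
      rw [← this, h0]; simp
    obtain ⟨v, hv, hv0⟩ := Matrix.exists_mulVec_eq_zero_iff.2 h1
    apply hv
    have h2 : ∀ k, (∑ l, v l • c l) ⬝ᵥ c k = 0 := by
      intro k
      have := congrFun hv0 k
      simp only [Matrix.mulVec, dotProduct, Matrix.map_apply, A, Matrix.of_apply,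
        Pi.zero_apply, ← hG] at this
      have h3 : (((D * D : ℕ)) : ℚ) * ((∑ l, v l • c l) ⬝ᵥ c k) = 0 := by
        rw [sum_dotProduct, Finset.mul_sum, ← this]
        refine Finset.sum_congr rfl fun l _ => ?_
        rw [smul_dotProduct, smul_eq_mul]
        simp only [dotProduct]; ring
      rcases mul_eq_zero.1 h3 with h | h
      · exact absurd (by exact_mod_cast h) (Nat.mul_pos hD hD).ne'
      · exact h
    have h3 : (∑ l, v l • c l) ⬝ᵥ (∑ l, v l • c l) = 0 := by
      rw [dotProduct_sum]
      exact Finset.sum_eq_zero fun k _ => by rw [dotProduct_smul, h2, smul_zero]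
    have h4 := dotProduct_self_eq_zero.1 h3
    funext k
    exact Fintype.linearIndependent_iff.1 hli v h4 k
  -- Multiplying the normal equations by the adjugate, which is again integral, exhibits the
  -- determinant as a denominator of all coefficients.
  have hμint : ∀ k, ∃ z : ℤ, (A.det : ℚ) * μ k = z := by
    intro k
    have h1 : ((A.map (Int.cast : ℤ → ℚ)).adjugate * A.map (Int.cast : ℤ → ℚ)).mulVec μ
        = (A.map (Int.cast : ℤ → ℚ)).adjugate.mulVec fun k => (b k : ℚ) := by
      rw [← hAμ, Matrix.mulVec_mulVec]
    rw [Matrix.adjugate_mul, Matrix.smul_mulVec, Matrix.one_mulVec] at h1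
    have h2 := congrFun h1 k
    have h3 : (A.map (Int.cast : ℤ → ℚ)).det = (A.det : ℚ) := (Int.cast_det (R := ℚ) A).symm
    rw [Pi.smul_apply, smul_eq_mul, h3] at h2
    refine ⟨∑ l, A.adjugate k l * b l, ?_⟩
    rw [h2]
    have h4 : (A.map (Int.cast : ℤ → ℚ)).adjugate = A.adjugate.map (Int.cast : ℤ → ℚ) :=
      ((Int.castRingHom ℚ).map_adjugate A).symm
    rw [h4]
    simp [Matrix.mulVec, dotProduct]
  refine ⟨D * A.det.natAbs, Nat.mul_pos hD (Int.natAbs_pos.2 hdet), ?_, fun j => ?_⟩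
  · have hn : (n : ℚ) ≤ 2 ^ s := by
      have := dim_le_sz x
      exact (nat_cast_le_two_pow n).trans (pow_le_pow_right₀ (by norm_num) (by omega))
    have hentry : ∀ k l, |A k l| ≤ 2 ^ (5 * s) := by
      intro k l
      have h1 : |((A k l : ℤ) : ℚ)| ≤ 2 ^ (5 * s) := by
        change |((G l k : ℤ) : ℚ)| ≤ _
        have hck : ∀ k j, |c k j| ≤ 2 ^ s := fun k j => (abs_coord_le (c k) j).trans
          (pow_le_pow_right₀ (by norm_num) ((sz_le_of_mem (List.get_mem C (a k))).trans (by omega)))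
        rw [← hG l k, abs_mul, Nat.abs_cast]
        have h2 := abs_dot_le (hck l) (hck k)
        have h3 : (D : ℚ) ≤ 2 ^ s := by exact_mod_cast hDs
        calc ((D * D : ℕ) : ℚ) * |c l ⬝ᵥ c k| ≤ (2 ^ s * 2 ^ s) * (2 ^ s * (2 ^ s * 2 ^ s)) := by
              push_cast
              gcongr
              exact h2.trans (by gcongr)
          _ = 2 ^ (5 * s) := by ring
      exact_mod_cast h1
    have hdl : |A.det| ≤ 2 ^ (6 * s ^ 2) := by
      have h1 := Matrix.det_le (A := A) (abv := AbsoluteValue.abs) (x := 2 ^ (5 * s)) hentry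
      rw [AbsoluteValue.abs_apply] at h1
      have hr : Fintype.card κ ≤ s := by
        have := Fintype.card_le_of_injective a ha
        rw [Fintype.card_fin] at this
        have := length_le_sz C
        omega
      refine h1.trans ?_
      have h2 : (Fintype.card κ).factorial ≤ 2 ^ (s ^ 2) := by
        refine (Nat.factorial_le_pow _).trans ?_
        calc Fintype.card κ ^ Fintype.card κ ≤ s ^ s :=
              (Nat.pow_le_pow_left hr _).trans (by
                rcases Nat.eq_zero_or_pos s with h | h
                · have : Fintype.card κ = 0 := by omega
                  rw [this, h]
                · exact Nat.pow_le_pow_right h hr)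
          _ ≤ (2 ^ s) ^ s := Nat.pow_le_pow_left Nat.lt_two_pow_self.le _
          _ = 2 ^ (s ^ 2) := by rw [← pow_mul, sq]
      rw [nsmul_eq_mul]
      calc (((Fintype.card κ).factorial : ℕ) : ℤ) * (2 ^ (5 * s)) ^ Fintype.card κ
          ≤ 2 ^ (s ^ 2) * (2 ^ (5 * s)) ^ s := by
            gcongr
            · exact_mod_cast h2
            · exact one_le_pow₀ (by norm_num)
        _ = 2 ^ (6 * s ^ 2) := by rw [← pow_mul, ← pow_add]; congr 1; ring
    rw [pow_add]
    refine Nat.mul_le_mul hDs ?_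
    have : ((A.det.natAbs : ℕ) : ℤ) ≤ 2 ^ (6 * s ^ 2) := by rwa [Int.natCast_natAbs]
    exact_mod_cast this
  · have h1 : prj C x j = x j - ∑ k, μ k * c k j := by
      have := congrFun hμ j
      rw [Finset.sum_apply] at this
      simp only [Pi.smul_apply, smul_eq_mul, Pi.sub_apply] at this
      rw [this]; ring
    rw [h1]
    refine ((hxD j).mono (Dvd.intro _ rfl)).sub (DivBy.sum _ _ fun k _ => ?_)
    obtain ⟨z, hz⟩ := hμint k
    obtain ⟨w, hw⟩ := hcD k j
    have h2 : ((A.det.natAbs : ℕ) : ℚ) * μ k = ((A.det.sign * z : ℤ) : ℚ) := by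
      have : ((A.det.natAbs : ℕ) : ℚ) = (A.det.sign : ℚ) * A.det := by
        have := Int.sign_mul_self_eq_natAbs A.det
        have h : (((A.det.natAbs : ℕ) : ℤ) : ℚ) = ((A.det.sign * A.det : ℤ) : ℚ) := by rw [this]
        rwa [Int.cast_natCast, Int.cast_mul] at h
      rw [this, mul_assoc, hz]; push_cast; ring
    refine ⟨A.det.sign * z * w, ?_⟩
    push_cast at h2 ⊢
    rw [← hw, ← h2]; ring

theorem abs_coord_prj_le (C : List (Vec n)) (x : Vec n) (j : Fin n) :
    |prj C x j| ≤ 2 ^ (2 * sz x) := by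
  have h1 := (sq_coord_le (prj C x) j).trans (prj_norm_le_self C x)
  have h2 := (le_abs_self _).trans (abs_dot_le (abs_coord_le x) (abs_coord_le x))
  have h3 : (n : ℚ) ≤ 2 ^ sz x := (nat_cast_le_two_pow n).trans
    (pow_le_pow_right₀ (by norm_num) (dim_le_sz x))
  refine abs_le_of_sq_le_sq ?_ (by positivity)
  refine h1.trans (h2.trans ?_)
  calc (n : ℚ) * (2 ^ sz x * 2 ^ sz x) ≤ 2 ^ sz x * (2 ^ sz x * 2 ^ sz x) := by gcongr
    _ = 2 ^ (3 * sz x) := by ring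
    _ ≤ 2 ^ (4 * sz x) := pow_le_pow_right₀ (by norm_num) (by omega)
    _ = _ := by ring

/-- Bound for the size of a projection. -/
def prjB (s : ℕ) : ℕ := 2 + s * (1 + (2 * (s + 6 * s ^ 2) + 2 * s + 3))

theorem pb_prjB : PB prjB :=
  (PB.const 2).add (PB.id.mul ((PB.const 1).add ((((PB.const 2).mul
    (PB.id.add ((PB.const 6).mul (PB.id.pow 2)))).add ((PB.const 2).mul PB.id)).add (PB.const 3))))

theorem sz_prj_le (C : List (Vec n)) (x : Vec n) : sz (prj C x) ≤ prjB (sz C + sz x) := by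
  obtain ⟨Δ, h0, hΔ, hd⟩ := exists_den_prj C x
  refine (sz_vec_le_of h0 hΔ hd (abs_coord_prj_le C x)).trans ?_
  have := dim_le_sz x
  exact Nat.add_le_add_left (Nat.mul_le_mul (by omega) (by omega)) _

theorem exists_of_mem_gp {C : List (Vec n)} {p : Vec n × Vec n} (hp : p ∈ gp C) :
    ∃ C₁ C₂, C = C₁ ++ p.1 :: C₂ ∧ p.2 = prj C₁ p.1 := by
  induction C using List.reverseRecOn with
  | nil => simp [gp] at hp
  | append_singleton C c ih =>
    rw [gp_append_singleton, List.mem_append, List.mem_singleton] at hp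
    rcases hp with hp | rfl
    · obtain ⟨C₁, C₂, h, h'⟩ := ih hp
      exact ⟨C₁, C₂ ++ [c], by conv_lhs => rw [h]
                               simp, h'⟩
    · exact ⟨C, [], rfl, rfl⟩

/-- Bound for the size of the list of Gram–Schmidt vectors. -/
def gpB (s : ℕ) : ℕ := 2 + s * (1 + (1 + s + prjB (2 * s)))

theorem pb_gpB : PB gpB :=
  (PB.const 2).add (PB.id.mul ((PB.const 1).add (((PB.const 1).add PB.id).add
    (pb_prjB.comp ((PB.const 2).mul PB.id)))))

/-- Each Gram–Schmidt vector is bounded as a projection of one input vector away from a prefix of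
the input. A bound in terms of the preceding Gram–Schmidt vectors would compound. -/
theorem sz_gp_le (C : List (Vec n)) : sz (gp C) ≤ gpB (sz C) := by
  refine (sz_list_le _ (1 + sz C + prjB (2 * sz C)) fun p hp => ?_).trans ?_
  · obtain ⟨C₁, C₂, h, h'⟩ := exists_of_mem_gp hp
    have h1 : sz p.1 ≤ sz C := sz_le_of_mem (by rw [h]; simp)
    have h2 : sz C₁ ≤ sz C := by
      have := sz_take_le C C₁.length
      rwa [h, List.take_left, ← h] at this
    have h3 := (sz_prj_le C₁ p.1).trans (pb_prjB.1 (show sz C₁ + sz p.1 ≤ 2 * sz C by omega))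
    rw [sz_prod, h']
    omega
  · have : (gp C).length = C.length := by simpa [gso] using gso_length C
    rw [this]
    exact Nat.add_le_add_left (Nat.mul_le_mul_right _ (length_le_sz C)) _

/-! ### Sizes in the nearest plane algorithm -/

/-- The rounds of the nearest plane algorithm. -/
def npL (L : List (Vec n × Vec n)) (x : Vec n) : Vec n :=
  L.foldl (fun y p => y - ((⌊(y ⬝ᵥ p.2) / (p.2 ⬝ᵥ p.2) + 1 / 2⌋ : ℤ) : ℚ) • p.1) x

/-- Only integer multiples of vectors with denominator `D` are subtracted, so the denominator never
changes; magnitudes grow by a factor of at most `2 ^ (7 * s)` per round, which is still a linear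
number of bits per round. -/
theorem npL_bounds {D s : ℕ} (hs : 0 < s) (hn : n ≤ s) (L : List (Vec n × Vec n))
    (hD : ∀ p ∈ L, ∀ j, DivBy D (p.1 j)) (h1 : ∀ p ∈ L, sz p ≤ s) (m : ℕ) (x : Vec n)
    (hx : ∀ j, DivBy D (x j)) (hm : ∀ j, |x j| ≤ 2 ^ m) :
    ∀ j, DivBy D (npL L x j) ∧ |npL L x j| ≤ 2 ^ (m + 7 * s * L.length) := by
  induction L generalizing x m with
  | nil => intro j; exact ⟨hx j, by simpa [npL] using hm j⟩
  | cons p L ih =>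
    rw [npL, List.foldl_cons, ← npL]
    set r := (x ⬝ᵥ p.2) / (p.2 ⬝ᵥ p.2) + 1 / 2 with hr
    have hp := h1 p (by simp)
    rw [sz_prod] at hp
    have hrb : |((⌊r⌋ : ℤ) : ℚ)| ≤ 2 ^ (m + 4 * s) + 2 := by
      have hr' : |r| ≤ 2 ^ (m + 4 * s) + 1 := by
        refine (abs_add_le _ _).trans ?_
        have : |(1 / 2 : ℚ)| ≤ 1 := by rw [abs_of_pos] <;> norm_num
        refine add_le_add ?_ this
        by_cases h0 : p.2 = 0
        · rw [h0]; simp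
        · have hpp := dot_self_pos h0
          have hd := divBy_dot (divBy_cden_vec p.2) (divBy_cden_vec p.2)
          -- The quotient is bounded because its divisor, being nonzero with a denominator of at
          -- most `2 * s` bits, cannot be small.
          have hd1 := hd.one_le_mul_abs hpp.ne' (Nat.mul_pos (cden_pos _) (cden_pos _))
          rw [abs_of_pos hpp] at hd1
          rw [abs_div, abs_of_pos hpp, div_le_iff₀ hpp]
          have hE : ((cden p.2 * cden p.2 : ℕ) : ℚ) ≤ 2 ^ s * 2 ^ s := by
            have : cden p.2 ≤ 2 ^ s := (cden_le _).trans
              (Nat.pow_le_pow_right (by norm_num) (by omega))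
            exact_mod_cast Nat.mul_le_mul this this
          have hdot := abs_dot_le hm (fun j => (abs_coord_le p.2 j).trans
            (pow_le_pow_right₀ (by norm_num) (by omega : sz p.2 ≤ s)))
          have hnn : (n : ℚ) ≤ 2 ^ s := (nat_cast_le_two_pow n).trans
            (pow_le_pow_right₀ (by norm_num) hn)
          have h2 : (1 : ℚ) ≤ 2 ^ s * 2 ^ s * (p.2 ⬝ᵥ p.2) :=
            hd1.trans (mul_le_mul_of_nonneg_right hE hpp.le)
          calc |x ⬝ᵥ p.2| ≤ 2 ^ s * (2 ^ m * 2 ^ s) := hdot.trans (by gcongr)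
            _ ≤ 2 ^ s * (2 ^ m * 2 ^ s) * (2 ^ s * 2 ^ s * (p.2 ⬝ᵥ p.2)) :=
                le_mul_of_one_le_right (by positivity) h2
            _ = _ := by ring
      have h3 := Int.floor_le r
      have h4 := Int.lt_floor_add_one r
      rw [abs_le] at hr' ⊢
      constructor <;> linarith
    have hx' : ∀ j, DivBy D ((x - ((⌊r⌋ : ℤ) : ℚ) • p.1) j) := fun j =>
      (hx j).sub ((hD p (by simp) j).int_mul _)
    have hm' : ∀ j, |(x - ((⌊r⌋ : ℤ) : ℚ) • p.1) j| ≤ 2 ^ (m + 7 * s) := fun j => by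
      rw [Pi.sub_apply, Pi.smul_apply, smul_eq_mul]
      refine (abs_sub _ _).trans ?_
      rw [abs_mul]
      have h5 : |p.1 j| ≤ 2 ^ s := (abs_coord_le p.1 j).trans
            (pow_le_pow_right₀ (by norm_num) (by omega))
      have h6 : (1 : ℚ) ≤ 2 ^ m := one_le_pow₀ (by norm_num)
      have h7 : (2 : ℚ) ≤ 2 ^ s := by
        simpa using pow_le_pow_right₀ (by norm_num : (1 : ℚ) ≤ 2) hs
      calc |x j| + |((⌊r⌋ : ℤ) : ℚ)| * |p.1 j| ≤ 2 ^ m + (2 ^ (m + 4 * s) + 2) * 2 ^ s := by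
            gcongr; exact hm j
        _ = 2 ^ m * 1 + (2 ^ m * (2 ^ s) ^ 4 + 2) * 2 ^ s := by ring
        _ ≤ 2 ^ m * (2 ^ s) ^ 5 + (2 ^ m * (2 ^ s) ^ 4 + 2 ^ m * (2 ^ s) ^ 4) * 2 ^ s := by
            gcongr
            · exact one_le_pow₀ (by linarith)
            · calc (2 : ℚ) ≤ 1 * (2 ^ s) ^ 1 := by simpa using h7
                _ ≤ 2 ^ m * (2 ^ s) ^ 4 := by gcongr; linarith; norm_num
        _ = 3 * (2 ^ m * (2 ^ s) ^ 5) := by ring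
        _ ≤ (2 ^ s * 2 ^ s) * (2 ^ m * (2 ^ s) ^ 5) := by gcongr; nlinarith
        _ = _ := by ring
    intro j
    have := ih (fun q hq => hD q (by simp [hq])) (fun q hq => h1 q (by simp [hq])) (m + 7 * s) _
      hx' hm' j
    refine ⟨this.1, this.2.trans (le_of_eq ?_)⟩
    rw [List.length_cons]; ring

theorem sz_npL_le (L : List (Vec n × Vec n)) (x : Vec n) :
    sz (npL L x) ≤ 2 + n * (1 + (2 * (sz L + sz x) +
      (sz x + 7 * (sz L + sz x) * (sz L + sz x)) + 3)) := by
  have hs := sz_pos x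
  have hn := dim_le_sz x
  have hb := npL_bounds (n := n) (D := cden L * cden x) (s := sz L + sz x) (by omega) (by omega) L
    (fun p hp j => (divBy_cden_vec p.1 j).mono (by
      have h1 := cden_dvd_of_mem hp
      rw [cden_prod] at h1
      exact ((Dvd.intro _ rfl).trans h1).mul_right _))
    (fun p hp => (sz_le_of_mem hp).trans (by omega)) (sz x) x
    (fun j => (divBy_cden_vec x j).mono (Dvd.intro_left _ rfl)) (abs_coord_le x)
  refine sz_vec_le_of (Nat.mul_pos (cden_pos L) (cden_pos x)) ?_ (fun j => (hb j).1)
    fun j => (hb j).2.trans (pow_le_pow_right₀ (by norm_num) ?_)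
  · rw [pow_add]; exact Nat.mul_le_mul (cden_le L) (cden_le x)
  · have := length_le_sz L
    exact Nat.add_le_add_left (Nat.mul_le_mul_left _ (by omega)) _

end

/-! ### Computing projections and dual bases -/

namespace Cmp

section
variable {α : Ctx → Type} [∀ i, Enc (α i)] {S : ∀ i, α i → Prop}

theorem prjO {u : ∀ i, α i → List (Vec i.n)} {x : ∀ i, α i → Vec i.n} (hu : Cmp S u)
    (hx : Cmp S x) : Cmp S (fun i a => prjO (u i a) (x i a)) :=
  foldl_sub hx (map' (ε := fun i => Vec i.n) (γ := fun i => Vec i.n) (δ := fun i => Vec i.n)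
    (F := fun _ s => ((s.1 ⬝ᵥ s.2) / (s.2 ⬝ᵥ s.2)) • s.2)
    (smul (div (dot (fst ident) (snd ident)) (dot (snd ident) (snd ident))) (snd ident)) hx hu)

theorem gp {C : ∀ i, α i → List (Vec i.n)} (hC : Cmp S C) : Cmp S (fun i a => gp (C i a)) := by
  obtain ⟨b, hb, hs⟩ := hC.sz_le
  refine foldl (ε := fun _ => ℚ) (β := fun i => List (Vec i.n × Vec i.n)) (γ := fun i => Vec i.n)
    (Q := fun _ _ => True)
    (F := fun i s => s.2.1 ++ [(s.2.2, LatticeProblems.prjO (s.2.1.map Prod.snd) s.2.2)])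
    (append (fst (snd ident)) (cons ((snd (snd ident)).pair (prjO (map' (ε := fun _ => ℚ)
      (γ := fun i => Vec i.n × Vec i.n) (δ := fun i => Vec i.n) (F := fun _ s => s.2.2)
      (snd (snd ident)) (const 0) (fst (snd ident))) (snd (snd ident)))) nil))
    (const 0) nil hC (fun _ _ _ _ _ _ _ => trivial) (fun s => gpB (b s)) (pb_gpB.comp hb) ?_
  intro i a ha l₁ l₂ h
  refine (sz_gp_le l₁).trans (pb_gpB.1 ?_)
  have h2 := sz_append l₁ l₂
  have h3 : 2 ≤ sz l₂ := by rw [sz_list]; omega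
  have h4 := hs i a ha
  rw [h] at h4
  omega

theorem gso {C : ∀ i, α i → List (Vec i.n)} (hC : Cmp S C) : Cmp S (fun i a => gso (C i a)) :=
  map' (ε := fun _ => ℚ) (γ := fun i => Vec i.n × Vec i.n) (δ := fun i => Vec i.n)
    (F := fun _ s => s.2.2) (snd (snd ident)) (const 0) (gp hC)

theorem prj {C : ∀ i, α i → List (Vec i.n)} {x : ∀ i, α i → Vec i.n} (hC : Cmp S C)
    (hx : Cmp S x) : Cmp S (fun i a => prj (C i a) (x i a)) := prjO (gso hC) hx

theorem mapPrj {C F : ∀ i, α i → List (Vec i.n)} (hC : Cmp S C) (hF : Cmp S F) :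
    Cmp S (fun i a => (F i a).map (LatticeProblems.prj (C i a))) :=
  map' (ε := fun i => List (Vec i.n)) (γ := fun i => Vec i.n) (δ := fun i => Vec i.n)
    (F := fun _ s => LatticeProblems.prj s.1 s.2) (prj (fst ident) (snd ident)) hC hF

theorem np {C : ∀ i, α i → List (Vec i.n)} {x : ∀ i, α i → Vec i.n} (hC : Cmp S C)
    (hx : Cmp S x) : Cmp S (fun i a => np (C i a) (x i a)) := by
  have hL := reverse (gp hC)
  obtain ⟨b, hb, hs⟩ := hL.sz_le
  obtain ⟨b', hb', hs'⟩ := hx.sz_le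
  refine foldl (ε := fun _ => ℚ) (β := fun i => Vec i.n) (γ := fun i => Vec i.n × Vec i.n)
    (Q := fun _ _ => True)
    (F := fun i s => s.2.1 - ((⌊(s.2.1 ⬝ᵥ s.2.2.2) / (s.2.2.2 ⬝ᵥ s.2.2.2) + 1 / 2⌋ : ℤ) : ℚ) •
      s.2.2.1) ?_ (const 0) hx hL (fun _ _ _ _ _ _ _ => trivial)
    (fun s => 2 + b' s * (1 + (2 * (b s + b' s) + (b' s + 7 * (b s + b' s) * (b s + b' s)) + 3)))
    ?_ ?_
  · have hy : Cmp (α := fun i => ℚ × (Vec i.n × (Vec i.n × Vec i.n))) (fun _ _ => True)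
        (fun _ s => s.2.1) := fst (snd ident)
    have hu : Cmp (α := fun i => ℚ × (Vec i.n × (Vec i.n × Vec i.n))) (fun _ _ => True)
        (fun _ s => s.2.2.2) := snd (snd (snd ident))
    exact vsub hy (smul (floor (add (div (dot hy hu) (dot hu hu)) (const (1 / 2))))
      (fst (snd (snd ident))))
  · have h1 := hb.add hb'
    exact (PB.const 2).add (hb'.mul ((PB.const 1).add ((((PB.const 2).mul h1).add
      (hb'.add (((PB.const 7).mul h1).mul h1))).add (PB.const 3))))
  · intro i a ha l₁ l₂ h
    have h2 := sz_append l₁ l₂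
    have h3 : 2 ≤ sz l₂ := by rw [sz_list]; omega
    have h4 := hs i a ha
    rw [h] at h4
    have h5 := hs' i a ha
    have h6 := dim_le_sz (x i a)
    refine (sz_npL_le l₁ (x i a)).trans ?_
    refine Nat.add_le_add_left (Nat.mul_le_mul (by omega) ?_) _
    have h7 : 7 * (sz l₁ + sz (x i a)) * (sz l₁ + sz (x i a))
        ≤ 7 * (b (sz a) + b' (sz a)) * (b (sz a) + b' (sz a)) :=
      Nat.mul_le_mul (by omega) (by omega)
    omega

theorem others {C : ∀ i, α i → List (Vec i.n)} {x : ∀ i, α i → Vec i.n} (hC : Cmp S C)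
    (hx : Cmp S x) : Cmp S (fun i a => others (C i a) (x i a)) :=
  filter (ε := fun i => Vec i.n) (γ := fun i => Vec i.n)
    (F := fun _ s => (s.2 - s.1) ⬝ᵥ (s.2 - s.1))
    (dot (vsub (snd ident) (fst ident)) (vsub (snd ident) (fst ident))) hx hC

theorem dualv {C : ∀ i, α i → List (Vec i.n)} {x : ∀ i, α i → Vec i.n} (hC : Cmp S C)
    (hx : Cmp S x) : Cmp S (fun i a => dualv (C i a) (x i a)) := by
  have := prj (others hC hx) hx
  exact smul (div (const 1) (dot this this)) this

theorem dual {C : ∀ i, α i → List (Vec i.n)} (hC : Cmp S C) : Cmp S (fun i a => dual (C i a)) :=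
  map' (ε := fun i => List (Vec i.n)) (γ := fun i => Vec i.n) (δ := fun i => Vec i.n)
    (F := fun _ s => LatticeProblems.dualv s.1 s.2) (dualv (fst ident) (snd ident)) hC hC

theorem coefs {V F : ∀ i, α i → List (Vec i.n)} {y : ∀ i, α i → Vec i.n} (hV : Cmp S V)
    (hF : Cmp S F) (hy : Cmp S y) : Cmp S (fun i a => coefs (V i a) (F i a) (y i a)) :=
  map' (ε := fun i => List (Vec i.n) × (List (Vec i.n) × Vec i.n)) (γ := fun i => Vec i.n)
    (δ := fun i => Vec i.n × ℚ)
    (F := fun _ s => (s.2, s.1.2.2 ⬝ᵥ LatticeProblems.dualv s.1.1 (LatticeProblems.prj s.1.2.1 s.2)))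
    ((snd ident).pair (dot (snd (snd (fst ident))) (dualv (fst (fst ident))
      (prj (fst (snd (fst ident))) (snd ident))))) ((mapPrj hV hF).pair (hV.pair hy)) hF

theorem lift {V F : ∀ i, α i → List (Vec i.n)} {y : ∀ i, α i → Vec i.n} (hV : Cmp S V)
    (hF : Cmp S F) (hy : Cmp S y) : Cmp S (fun i a => lift (V i a) (F i a) (y i a)) :=
  foldl_sub ((vsub hy hy).congr fun _ _ _ => sub_self _)
    (map' (ε := fun i => List (Vec i.n) × (List (Vec i.n) × Vec i.n)) (γ := fun i => Vec i.n)
    (δ := fun i => Vec i.n)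
    (F := fun _ s => (-(s.1.2.2 ⬝ᵥ LatticeProblems.dualv s.1.1 (LatticeProblems.prj s.1.2.1 s.2))) • s.2)
    (smul ((sub (const 0) (dot (snd (snd (fst ident))) (dualv (fst (fst ident))
      (prj (fst (snd (fst ident))) (snd ident))))).congr fun _ _ _ => zero_sub _) (snd ident))
      ((mapPrj hV hF).pair (hV.pair hy)) hF)

end

end Cmp

/-! ## Euclid's algorithm on vectors -/

section
variable {n : ℕ}

/-- One round of Euclid's algorithm, keeping the vector `x • X + y • Y`. -/
def euStep (s : (ℚ × Vec n) × (ℚ × Vec n)) : (ℚ × Vec n) × (ℚ × Vec n) :=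
  ((s.2.1, s.2.2 + ((⌊s.1.1 / s.2.1⌋ : ℤ) : ℚ) • s.1.2),
    (s.1.1 - ((⌊s.1.1 / s.2.1⌋ : ℤ) : ℚ) * s.2.1, s.1.2))

/-- Euclid's algorithm, for a positive second coefficient. -/
def euclid (s : (ℚ × Vec n) × (ℚ × Vec n)) : (ℚ × Vec n) × (ℚ × Vec n) :=
  untilF (fun s => 0 < s.2.1) euStep (euStep s)

/-- The invariant of Euclid's algorithm. -/
structure EuInv (η g : ℚ) (c κ : Vec n) (Λ : Submodule ℤ (Vec n))
    (s : (ℚ × Vec n) × (ℚ × Vec n)) : Prop where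
  x_pos : 0 < s.1.1
  x_le : s.1.1 ≤ g
  y_nonneg : 0 ≤ s.2.1
  y_lt : s.2.1 < s.1.1
  x_int : ∃ z : ℤ, s.1.1 = η * z
  y_int : ∃ z : ℤ, s.2.1 = η * z
  comb : s.1.1 • s.1.2 + s.2.1 • s.2.2 = κ
  latt_eq : latt [s.1.2, s.2.2] = Λ
  expr : ∃ σ l m : ℚ, (σ = 1 ∨ σ = -1) ∧ s.1.2 = (σ * s.2.1 / g) • c + l • κ ∧
    s.2.2 = (-σ * s.1.1 / g) • c + m • κ ∧ 0 ≤ l ∧ 0 ≤ m ∧ m ≤ 1 / η ∧ s.1.1 * l + s.2.1 * m = 1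

theorem latt_pair (x y : Vec n) (k : ℤ) : latt [y + (k : ℚ) • x, x] = latt [x, y] := by
  apply le_antisymm
  · refine latt_le.2 fun z hz => ?_
    have hx : x ∈ latt [x, y] := mem_latt (by simp)
    have hy : y ∈ latt [x, y] := mem_latt (by simp)
    simp only [List.mem_cons, List.not_mem_nil, or_false] at hz
    rcases hz with rfl | rfl
    · exact add_mem hy (intCast_smul_mem k hx)
    · exact hx
  · refine latt_le.2 fun z hz => ?_
    have hx : x ∈ latt [y + (k : ℚ) • x, x] := mem_latt (by simp)
    have hy : y + (k : ℚ) • x ∈ latt [y + (k : ℚ) • x, x] := mem_latt (by simp)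
    simp only [List.mem_cons, List.not_mem_nil, or_false] at hz
    rcases hz with rfl | rfl
    · exact hx
    · simpa using sub_mem hy (intCast_smul_mem k hx)

theorem unit_le {η x : ℚ} (hη : 0 < η) (hx : 0 < x) (h : ∃ z : ℤ, x = η * z) : η ≤ x := by
  obtain ⟨z, rfl⟩ := h
  have : 0 < z := by
    by_contra! h
    have : (z : ℚ) ≤ 0 := by exact_mod_cast h
    nlinarith
  have : (1 : ℚ) ≤ z := by exact_mod_cast this
  nlinarith

theorem mod_bounds {x y : ℚ} (hy : 0 < y) :
    0 ≤ x - ((⌊x / y⌋ : ℤ) : ℚ) * y ∧ x - ((⌊x / y⌋ : ℤ) : ℚ) * y < y := by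
  have h1 := Int.floor_le (x / y)
  have h2 := Int.lt_floor_add_one (x / y)
  rw [le_div_iff₀ hy] at h1
  rw [div_lt_iff₀ hy] at h2
  constructor <;> linarith

/-- The first round is performed unconditionally: it moves `g` to the front and replaces `a`, which
may have any sign, by its remainder modulo `g`. Only then do the inequalities `0 ≤ y < x ≤ g` of the
invariant hold. -/
theorem EuInv.init {η a g : ℚ} {c e : Vec n} (hη : 0 < η) (hg : 0 < g)
    (ha' : ∃ z : ℤ, a = η * z) (hg' : ∃ z : ℤ, g = η * z) :
    EuInv η g c (a • c + g • e) (latt [c, e]) (euStep ((a, c), (g, e))) := by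
  have hm := mod_bounds (x := a) hg
  obtain ⟨z, hz⟩ := ha'
  obtain ⟨w, hw⟩ := hg'
  refine ⟨hg, le_rfl, hm.1, hm.2, ⟨w, hw⟩, ?_, ?_, latt_pair _ _ _, ?_⟩
  · refine ⟨z - ⌊a / g⌋ * w, ?_⟩
    simp only [euStep]
    rw [hz, hw]; push_cast; ring
  · simp only [euStep]
    ext j
    simp only [Pi.add_apply, Pi.smul_apply, smul_eq_mul]
    ring
  · refine ⟨-1, 1 / g, 0, Or.inr rfl, ?_, ?_, by positivity, le_rfl, by positivity, ?_⟩
    · simp only [euStep]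
      ext j
      simp only [Pi.add_apply, Pi.smul_apply, smul_eq_mul]
      field_simp
      ring
    · simp only [euStep]
      ext j
      simp only [Pi.add_apply, Pi.smul_apply, smul_eq_mul]
      field_simp
      ring
    · simp only [euStep]
      field_simp
      ring

/-- Modulo the fixed combination `κ`, the two vectors are multiples of `c` by `± y / g` and `± x /
g`, and a round exchanges these roles. The multiples `l` and `m` of `κ` evolve like Bézout
coefficients, with nonnegative values tied down by `x * l + y * m = 1`. -/
theorem EuInv.step {η g : ℚ} {c κ : Vec n} {Λ : Submodule ℤ (Vec n)} (hη : 0 < η)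
    {s : (ℚ × Vec n) × (ℚ × Vec n)} (h : EuInv η g c κ Λ s) (hy : 0 < s.2.1) :
    EuInv η g c κ Λ (euStep s) := by
  obtain ⟨⟨x, X⟩, ⟨y, Y⟩⟩ := s
  obtain ⟨x_pos, x_le, y_nonneg, y_lt, ⟨z, hz⟩, ⟨w, hw⟩, comb, hl, σ, l, m, hσ, hX, hY, l0, m0,
    m1, hlm⟩ := h
  dsimp only at *
  have hm := mod_bounds (x := x) hy
  have hq : (0 : ℚ) ≤ ((⌊x / y⌋ : ℤ) : ℚ) := by
    exact_mod_cast Int.floor_nonneg.2 (by positivity)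
  refine ⟨hy, y_lt.le.trans x_le, hm.1, hm.2, ⟨w, hw⟩, ⟨z - ⌊x / y⌋ * w, ?_⟩, ?_,
    (latt_pair _ _ _).trans hl, -σ, m + ((⌊x / y⌋ : ℤ) : ℚ) * l, l, ?_, ?_, ?_, ?_, l0, ?_, ?_⟩
  · simp only [euStep]
    push_cast; rw [mul_sub, ← hz, mul_left_comm, ← hw]
  · simp only [euStep]
    rw [← comb]
    ext j
    simp only [Pi.add_apply, Pi.smul_apply, smul_eq_mul]
    ring
  · rcases hσ with rfl | rfl <;> simp
  · simp only [euStep]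
    rw [hX, hY]
    ext j
    simp only [Pi.add_apply, Pi.smul_apply, smul_eq_mul]
    ring
  · simp only [euStep]
    rw [hX]
    ext j
    simp only [Pi.add_apply, Pi.smul_apply, smul_eq_mul]
    ring
  · positivity
  -- The new `m` is the old `l`; the relation `x * l + y * m = 1` and `η ≤ x` give `η * l ≤ 1`.
  · rw [le_div_iff₀ hη]
    have h1 := unit_le hη x_pos ⟨z, hz⟩
    nlinarith
  · simp only [euStep]
    linear_combination hlm

/-- The product of the two coefficients is at least halved in each round, since a remainder is less
than half of the dividend when the divisor is smaller. It starts below `g ^ 2` and is at least `η ^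
2` while the loop runs, both coefficients being multiples of `η`. -/
theorem euclid_stop {η g : ℚ} {c κ : Vec n} {Λ : Submodule ℤ (Vec n)} (hη : 0 < η)
    {s : (ℚ × Vec n) × (ℚ × Vec n)} (h : EuInv η g c κ Λ s) {k : ℕ} (hk : g ≤ η * 2 ^ k) :
    ∃ j ≤ 2 * k + 1, ¬ 0 < (euStep^[j] s).2.1 := by
  refine exists_stop (c := fun s : (ℚ × Vec n) × (ℚ × Vec n) => 0 < s.2.1) (I := EuInv η g c κ Λ)
    (fun a ha hy => ha.step hη hy) (fun s => s.1.1 * s.2.1) (m := η * η) ?_ ?_ h ?_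
  · rintro ⟨⟨x, X⟩, ⟨y, Y⟩⟩ h hy
    have x_pos := h.x_pos
    have y_lt := h.y_lt
    simp only [euStep] at *
    have hm := mod_bounds (x := x) hy
    have hq : (1 : ℚ) ≤ ((⌊x / y⌋ : ℤ) : ℚ) := by
      exact_mod_cast Int.le_floor.2 (by push_cast; rw [le_div_iff₀ hy]; linarith)
    have h1 : x - ((⌊x / y⌋ : ℤ) : ℚ) * y ≤ x - y := by nlinarith
    nlinarith [hm.2]
  · intro s h hy
    exact mul_le_mul (unit_le hη h.x_pos h.x_int) (unit_le hη hy h.y_int) hη.le h.x_pos.le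
  · have h1 := h.x_le
    have h2 := h.y_lt
    have h3 := h.x_pos
    have h4 := h.y_nonneg
    calc s.1.1 * s.2.1 < s.1.1 * s.1.1 := by gcongr
      _ ≤ (η * 2 ^ k) * (η * 2 ^ k) := by gcongr <;> linarith
      _ ≤ (η * 2 ^ k) * (η * 2 ^ k) * 2 := by
          have : 0 ≤ (η * 2 ^ k) * (η * 2 ^ k) := by positivity
          linarith
      _ = _ := by ring

theorem exists_pow_ge {η g : ℚ} (hη : 0 < η) : ∃ k : ℕ, g ≤ η * 2 ^ k := by
  obtain ⟨k, hk⟩ := pow_unbounded_of_one_lt (g / η) (by norm_num : (1 : ℚ) < 2)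
  refine ⟨k, ?_⟩
  rw [div_lt_iff₀ hη] at hk
  linarith

/-- What Euclid's algorithm computes. -/
theorem euclid_spec {η a g : ℚ} {c e : Vec n} (hη : 0 < η) (hg : 0 < g)
    (ha' : ∃ z : ℤ, a = η * z) (hg' : ∃ z : ℤ, g = η * z) :
    let r := euclid ((a, c), (g, e))
    r.2.1 = 0 ∧ EuInv η g c (a • c + g • e) (latt [c, e]) r := by
  intro r
  have h0 := EuInv.init (c := c) (e := e) hη hg ha' hg'
  obtain ⟨k, hk⟩ := exists_pow_ge (g := g) hη
  obtain ⟨j, -, hlt, hj, heq⟩ := exists_untilF (c := fun s : (ℚ × Vec n) × (ℚ × Vec n) => 0 < s.2.1)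
    (euclid_stop hη h0 hk)
  have hI : EuInv η g c (a • c + g • e) (latt [c, e]) r := by
    change EuInv _ _ _ _ _ (euclid _)
    rw [euclid, heq]
    exact iterate_inv (c := fun s : (ℚ × Vec n) × (ℚ × Vec n) => 0 < s.2.1)
      (fun a ha hy => ha.step hη hy) h0 hlt
  refine ⟨le_antisymm ?_ hI.y_nonneg, hI⟩
  have : ¬ 0 < (euclid ((a, c), (g, e))).2.1 := by rw [euclid, heq]; exact hj
  exact not_lt.1 this

theorem divBy_latt {D : ℕ} {C : List (Vec n)} (h : ∀ c ∈ C, ∀ j, DivBy D (c j)) {x : Vec n}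
    (hx : x ∈ latt C) (j : Fin n) : DivBy D (x j) := by
  induction hx using Submodule.span_induction with
  | mem x hx => exact h x hx j
  | zero => exact DivBy.zero D
  | add x y _ _ hx hy => exact hx.add hy
  | smul a x _ hx =>
    rw [← Int.cast_smul_eq_zsmul ℚ, Pi.smul_apply, smul_eq_mul]
    exact hx.int_mul a

theorem divBy_iff_unit {D : ℕ} (hD : 0 < D) {q : ℚ} :
    DivBy D q ↔ ∃ z : ℤ, q = (1 / (D : ℚ)) * z := by
  have : (0 : ℚ) < D := by exact_mod_cast hD
  refine exists_congr fun z => ⟨fun h => ?_, fun h => ?_⟩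
  · rw [← h]; field_simp
  · rw [h]; field_simp

/-- The bound is the same in every round: it is read off from `expr`, where the multiple of `c` has
factor at most one and the multiple of `κ` at most `1 / η`. -/
theorem EuInv.bounds {η g : ℚ} {c κ : Vec n} {Λ : Submodule ℤ (Vec n)} (hη : 0 < η)
    {s : (ℚ × Vec n) × (ℚ × Vec n)} (h : EuInv η g c κ Λ s) (j : Fin n) :
    |s.1.2 j| ≤ |c j| + |κ j| / η ∧ |s.2.2 j| ≤ |c j| + |κ j| / η := by
  obtain ⟨⟨x, X⟩, ⟨y, Y⟩⟩ := s
  obtain ⟨x_pos, x_le, y_nonneg, y_lt, hx, hy, comb, hl, σ, l, m, hσ, hX, hY, l0, m0,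
    m1, hlm⟩ := h
  dsimp only at *
  have hg : 0 < g := x_pos.trans_le x_le
  have hσ' : |σ| = 1 := by rcases hσ with rfl | rfl <;> simp
  have hl1 : l ≤ 1 / η := by
    rw [le_div_iff₀ hη]
    have := unit_le hη x_pos hx
    nlinarith
  have key : ∀ t u : ℚ, 0 ≤ t → t ≤ g → 0 ≤ u → u ≤ 1 / η → ∀ τ : ℚ, |τ| = 1 →
      |((τ * t / g) • c + u • κ) j| ≤ |c j| + |κ j| / η := by
    intro t u ht htg hu hu1 τ hτ
    rw [Pi.add_apply, Pi.smul_apply, Pi.smul_apply, smul_eq_mul, smul_eq_mul]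
    refine (abs_add_le _ _).trans (add_le_add ?_ ?_)
    · rw [abs_mul, abs_div, abs_mul, hτ, one_mul, abs_of_nonneg ht, abs_of_pos hg]
      exact mul_le_of_le_one_left (abs_nonneg _) ((div_le_one hg).2 htg)
    · rw [abs_mul, abs_of_nonneg hu, div_eq_inv_mul, ← one_div]
      exact mul_le_mul_of_nonneg_right hu1 (abs_nonneg _)
  refine ⟨?_, ?_⟩
  · rw [hX]; exact key y l y_nonneg (by linarith) l0 hl1 σ hσ'
  · rw [hY]; exact key x m x_pos.le x_le m0 m1 (-σ) (by rw [abs_neg, hσ'])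

end

/-- Euclid's algorithm is efficient. -/
theorem Cmp.op_euclid : Cmp (α := fun i => (ℚ × Vec i.n) × (ℚ × Vec i.n))
    (fun _ s => 0 < s.2.1) (fun _ s => euclid s) := by
  let St : Ctx → Type := fun i => (ℚ × Vec i.n) × (ℚ × Vec i.n)
  have hstep : Cmp (α := St) (fun _ _ => True) (fun _ s => euStep s) := by
    have hq : Cmp (α := St) (fun _ _ => True) (fun _ s => ((⌊s.1.1 / s.2.1⌋ : ℤ) : ℚ)) :=
      floor (div (fst (fst ident)) (fst (snd ident)))
    exact ((fst (snd ident)).pair (vadd (snd (snd ident)) (smul hq (snd (fst ident))))).pair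
      ((sub (fst (fst ident)) (mul hq (fst (snd ident)))).pair (snd (fst ident)))
  -- the loop, with the input kept for reference
  have hloop : Cmp (α := fun i => St i × St i)
      (fun _ s => 0 < s.1.2.1 ∧ s.2 = euStep s.1)
      (fun i s => untilF (fun x : St i × St i => 0 < x.2.2.1) (fun x => (x.1, euStep x.2)) s) := by
    have hit : ∀ i (a : St i) k (s : St i),
        (fun x : St i × St i => (x.1, euStep x.2))^[k] (a, s) = (a, euStep^[k] s) := by
      intro i a k
      induction k with
      | zero => simp
      | succ k ih => intro s; rw [Function.iterate_succ_apply, ih, Function.iterate_succ_apply]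
    -- The unit `η` is the reciprocal of the product of both denominators; its bit length bounds the
    -- number of rounds and all coordinates.
    have hunit : ∀ (a : ℚ) (g : ℚ), 0 < (1 / ((cden a * cden g : ℕ) : ℚ)) ∧
        (∃ z : ℤ, a = (1 / ((cden a * cden g : ℕ) : ℚ)) * z) ∧
        (∃ z : ℤ, g = (1 / ((cden a * cden g : ℕ) : ℚ)) * z) := by
      intro a g
      have hD : 0 < cden a * cden g := Nat.mul_pos (cden_pos a) (cden_pos g)
      have : (0 : ℚ) < ((cden a * cden g : ℕ) : ℚ) := by exact_mod_cast hD
      exact ⟨by positivity, (divBy_iff_unit hD).1 ((divBy_cden a).mono (Dvd.intro _ rfl)),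
        (divBy_iff_unit hD).1 ((divBy_cden g).mono (Dvd.intro_left _ rfl))⟩
    refine Cmp.loop (I := fun _ _ => True) (fst (snd (snd ident)))
      ((fst ident).pair ((hstep.app (snd ident)).mono fun _ _ _ => trivial)) (fun _ _ _ => trivial)
      (fun _ _ _ _ => trivial) (fun s => 2 * (2 * s) + 1)
      (fun s => 1 + s + (1 + (1 + (2 * s + s + 3) + (2 + s * (1 + (2 * s + (4 * s + 2) + 3))))
        + (1 + (2 * s + s + 3) + (2 + s * (1 + (2 * s + (4 * s + 2) + 3))))))
      (((PB.const 2).mul ((PB.const 2).mul PB.id)).add (PB.const 1)) ?_ ?_ ?_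
    · have h1 : PB fun s => 1 + (2 * s + s + 3) + (2 + s * (1 + (2 * s + (4 * s + 2) + 3))) :=
        ((PB.const 1).add ((((PB.const 2).mul PB.id).add PB.id).add (PB.const 3))).add
          ((PB.const 2).add (PB.id.mul ((PB.const 1).add ((((PB.const 2).mul PB.id).add
            (((PB.const 4).mul PB.id).add (PB.const 2))).add (PB.const 3)))))
      exact ((PB.const 1).add PB.id).add (((PB.const 1).add h1).add h1)
    · rintro i ⟨⟨⟨a, c⟩, ⟨g, e⟩⟩, s⟩ ⟨hg, hs⟩
      dsimp only at hg hs
      obtain ⟨hη, ha', hg'⟩ := hunit a g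
      have h0 := EuInv.init (c := c) (e := e) hη hg ha' hg'
      rw [← hs] at h0
      have hsz : sz a + sz g ≤ sz (((a, c), (g, e)), s) := by simp only [sz_prod]; omega
      obtain ⟨j, hj, hj'⟩ := euclid_stop (k := 2 * sz (((a, c), (g, e)), s)) hη h0 (by
        have h1 : ((cden a * cden g : ℕ) : ℚ) ≤ 2 ^ (sz a + sz g) := by
          rw [pow_add]
          exact_mod_cast Nat.mul_le_mul (cden_le a) (cden_le g)
        have h2 : (0 : ℚ) < ((cden a * cden g : ℕ) : ℚ) := by
          exact_mod_cast Nat.mul_pos (cden_pos a) (cden_pos g)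
        have h3 := (le_abs_self g).trans (abs_lt_two_pow_sz g).le
        rw [one_div, ← div_eq_inv_mul, le_div_iff₀ h2]
        calc g * ((cden a * cden g : ℕ) : ℚ) ≤ 2 ^ sz g * 2 ^ (sz a + sz g) := by gcongr
          _ = 2 ^ (sz g + (sz a + sz g)) := (pow_add _ _ _).symm
          _ ≤ _ := pow_le_pow_right₀ (by norm_num) (by omega))
      exact ⟨j, hj, by rw [hit]; exact hj'⟩
    · rintro i ⟨⟨⟨a, c⟩, ⟨g, e⟩⟩, s⟩ ⟨hg, hs⟩ k hk
      dsimp only at hg hs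
      obtain ⟨hη, ha', hg'⟩ := hunit a g
      have h0 := EuInv.init (c := c) (e := e) hη hg ha' hg'
      rw [← hs] at h0
      have hI : EuInv _ g c (a • c + g • e) (latt [c, e]) (euStep^[k] s) := iterate_inv
        (c := fun s : (ℚ × Vec i.n) × (ℚ × Vec i.n) => 0 < s.2.1)
        (fun a ha hy => ha.step hη hy) h0 (fun j hj => by
          have := hk j hj
          rw [hit] at this
          exact this)
      rw [hit, sz_prod]
      set t := euStep^[k] s
      set S := sz (((a, c), (g, e)), s) with hS
      simp only [sz_prod] at hS
      have hn := dim_le_sz c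
      set D := cden a * cden g with hD
      have hD0 : 0 < D := Nat.mul_pos (cden_pos a) (cden_pos g)
      have hDS : D ≤ 2 ^ S := by
        calc D ≤ 2 ^ sz a * 2 ^ sz g := Nat.mul_le_mul (cden_le a) (cden_le g)
          _ = 2 ^ (sz a + sz g) := (pow_add _ _ _).symm
          _ ≤ _ := Nat.pow_le_pow_right (by norm_num) (by omega)
      have hgS : g ≤ 2 ^ S := (le_abs_self g).trans ((abs_lt_two_pow_sz g).le.trans
        (pow_le_pow_right₀ (by norm_num) (by omega)))
      have hx := sz_rat_le (q := t.1.1) (m := S) hD0 hDS ((divBy_iff_unit hD0).2 hI.x_int)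
        (by rw [abs_of_pos hI.x_pos]; exact hI.x_le.trans hgS)
      have hy := sz_rat_le (q := t.2.1) (m := S) hD0 hDS ((divBy_iff_unit hD0).2 hI.y_int)
        (by rw [abs_of_nonneg hI.y_nonneg]; exact hI.y_lt.le.trans (hI.x_le.trans hgS))
      have hE : cden c * cden e ≤ 2 ^ S := by
        calc cden c * cden e ≤ 2 ^ sz c * 2 ^ sz e := Nat.mul_le_mul (cden_le c) (cden_le e)
          _ = 2 ^ (sz c + sz e) := (pow_add _ _ _).symm
          _ ≤ _ := Nat.pow_le_pow_right (by norm_num) (by omega)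
      have hE0 : 0 < cden c * cden e := Nat.mul_pos (cden_pos c) (cden_pos e)
      have hce : ∀ v ∈ [c, e], ∀ j, DivBy (cden c * cden e) (v j) := by
        intro v hv j
        simp only [List.mem_cons, List.not_mem_nil, or_false] at hv
        rcases hv with rfl | rfl
        · exact (divBy_cden_vec v j).mono (Dvd.intro _ rfl)
        · exact (divBy_cden_vec v j).mono (Dvd.intro_left _ rfl)
      have hκ : ∀ j, |c j| + |(a • c + g • e) j| / (1 / (D : ℚ)) ≤ 2 ^ (4 * S + 2) := by
        intro j
        have hp : ∀ {u : ℕ}, u ≤ S → (2 : ℚ) ^ u ≤ 2 ^ S := fun h =>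
          pow_le_pow_right₀ (by norm_num) h
        have hc : |c j| ≤ 2 ^ S := (abs_coord_le c j).trans (hp (by omega))
        have he : |e j| ≤ 2 ^ S := (abs_coord_le e j).trans (hp (by omega))
        have ha : |a| ≤ 2 ^ S := (abs_lt_two_pow_sz a).le.trans (hp (by omega))
        have hg1 : |g| ≤ 2 ^ S := (abs_lt_two_pow_sz g).le.trans (hp (by omega))
        have hD1 : (D : ℚ) ≤ 2 ^ S := by exact_mod_cast hDS
        rw [Pi.add_apply, Pi.smul_apply, Pi.smul_apply, smul_eq_mul, smul_eq_mul, div_div_eq_mul_div,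
          div_one]
        calc |c j| + |a * c j + g * e j| * D
            ≤ 2 ^ S + (2 ^ S * 2 ^ S + 2 ^ S * 2 ^ S) * 2 ^ S := by
              gcongr
              refine (abs_add_le _ _).trans ?_
              rw [abs_mul, abs_mul]
              gcongr
          _ = 2 ^ S * 1 + 2 * (2 ^ S) ^ 3 := by ring
          _ ≤ (2 ^ S) * (2 ^ S) ^ 2 + 2 * (2 ^ S) ^ 3 := by
              have : (1 : ℚ) ≤ 2 ^ S := one_le_pow₀ (by norm_num)
              gcongr
              exact one_le_pow₀ this
          _ = 3 * (2 ^ S) ^ 3 * 1 := by ring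
          _ ≤ 4 * (2 ^ S) ^ 3 * 2 ^ S := by
              have : (1 : ℚ) ≤ 2 ^ S := one_le_pow₀ (by norm_num)
              gcongr
              norm_num
          _ = _ := by ring
      have hX := sz_vec_le_of (x := t.1.2) hE0 hE
        (fun j => divBy_latt hce (hI.latt_eq ▸ mem_latt (by simp)) j)
        (fun j => (hI.bounds hη j).1.trans (hκ j))
      have hY := sz_vec_le_of (x := t.2.2) hE0 hE
        (fun j => divBy_latt hce (hI.latt_eq ▸ mem_latt (by simp)) j)
        (fun j => (hI.bounds hη j).2.trans (hκ j))
      have hnS : i.n * (1 + (2 * S + (4 * S + 2) + 3)) ≤ S * (1 + (2 * S + (4 * S + 2) + 3)) :=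
        Nat.mul_le_mul_right _ (by omega)
      have e1 : sz (((a, c), (g, e)) : St i) = 1 + (1 + sz a + sz c) + (1 + sz g + sz e) := rfl
      have e2 : sz t = 1 + (1 + sz t.1.1 + sz t.1.2) + (1 + sz t.2.1 + sz t.2.2) := rfl
      dsimp only
      rw [e1, e2]
      omega
  have h2 := snd (hloop.comp (S := fun _ s => 0 < s.2.1)
    (ident.pair ((hstep.app ident))) (fun i a ha => ⟨ha, rfl⟩))
  refine h2.congr fun i a ha => ?_
  have hit : ∀ i (a : St i) k (s : St i),
      (fun x : St i × St i => (x.1, euStep x.2))^[k] (a, s) = (a, euStep^[k] s) := by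
    intro i a k
    induction k with
    | zero => simp
    | succ k ih => intro s; rw [Function.iterate_succ_apply, ih, Function.iterate_succ_apply]
  classical
  -- Termination is not needed to compare the two loops: without it `untilF` returns the initial
  -- state on both sides.
  by_cases hex : ∃ k, ¬ 0 < (euStep^[k] (euStep a)).2.1
  · obtain ⟨k, -, hlt, hk, heq⟩ := exists_untilF (N := hex.choose)
      (c := fun s : St i => 0 < s.2.1) ⟨_, le_rfl, hex.choose_spec⟩
    rw [euclid, heq, untilF_eq (k := k)]
    · rw [hit]
    · intro j hj; rw [hit]; exact hlt j hj
    · rw [hit]; exact hk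
  · rw [euclid, untilF, untilF, dif_neg hex, dif_neg]
    rintro ⟨k, hk⟩
    rw [hit] at hk
    exact hex ⟨k, hk⟩

/-! ## Inserting a lattice vector into a basis -/

section
variable {n : ℕ}

/-- The squared distance from `x` to `W` is at most `K`. -/
def Near (K : ℚ) (W : Submodule ℚ (Vec n)) (x : Vec n) : Prop :=
  ∃ y ∈ W, (x - y) ⬝ᵥ (x - y) ≤ K

theorem Near.mono {K : ℚ} {W W' : Submodule ℚ (Vec n)} {x : Vec n} (h : Near K W x) (hW : W ≤ W') :
    Near K W' x := by
  obtain ⟨y, hy, hK⟩ := h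
  exact ⟨y, hW hy, hK⟩

theorem Near.smul {K ρ : ℚ} {W : Submodule ℚ (Vec n)} {x : Vec n} (h : Near K W x) (hρ : |ρ| ≤ 1) :
    Near K W (ρ • x) := by
  obtain ⟨y, hy, hK⟩ := h
  refine ⟨ρ • y, W.smul_mem ρ hy, ?_⟩
  rw [← smul_sub, smul_dotProduct, dotProduct_smul, smul_eq_mul, smul_eq_mul, ← mul_assoc]
  have h1 : ρ * ρ ≤ 1 := by
    rw [← sq, ← sq_abs]; exact pow_le_one₀ (abs_nonneg _) hρ
  have := dot_self_nonneg (x - y)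
  nlinarith

theorem Near.add_mem {K : ℚ} {W : Submodule ℚ (Vec n)} {x w : Vec n} (h : Near K W x) (hw : w ∈ W) :
    Near K W (x + w) := by
  obtain ⟨y, hy, hK⟩ := h
  refine ⟨y + w, W.add_mem hy hw, ?_⟩
  have : x + w - (y + w) = x - y := by abel
  rwa [this]

theorem Near.prj_le {K : ℚ} {C : List (Vec n)} {x : Vec n} (h : Near K (sp C) x) :
    prj C x ⬝ᵥ prj C x ≤ K := by
  obtain ⟨y, hy, hK⟩ := h
  exact (prj_norm_le hy).trans hK

theorem near_of_prj_le {K : ℚ} {C : List (Vec n)} {x : Vec n} (h : prj C x ⬝ᵥ prj C x ≤ K) :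
    Near K (sp C) x :=
  ⟨x - prj C x, sub_prj_mem C x, by simpa using h⟩

/-- The Gram–Schmidt norms of the list, relative to `W`, are bounded. -/
def GoodL (K : ℚ) : Submodule ℚ (Vec n) → List (Vec n) → Prop
  | _, [] => True
  | W, c :: l => Near K W c ∧ GoodL K (W ⊔ sp [c]) l

theorem goodL_append {K : ℚ} {W : Submodule ℚ (Vec n)} {l m : List (Vec n)} :
    GoodL K W (l ++ m) ↔ GoodL K W l ∧ GoodL K (W ⊔ sp l) m := by
  induction l generalizing W with
  | nil => simp [GoodL]
  | cons c l ih => rw [List.cons_append, GoodL, GoodL, ih, sp_cons c l, and_assoc, sup_assoc]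

theorem goodL_gso {K : ℚ} {C : List (Vec n)} (h : GoodL K ⊥ C) : ∀ u ∈ gso C, u ⬝ᵥ u ≤ K := by
  induction C using List.reverseRecOn with
  | nil => simp
  | append_singleton C c ih =>
    rw [goodL_append] at h
    intro u hu
    rw [gso_append_singleton, List.mem_append, List.mem_singleton] at hu
    rcases hu with hu | rfl
    · exact ih h.1 u hu
    · have := h.2.1
      rw [bot_sup_eq] at this
      exact this.prj_le

theorem goodL_of_norm {K : ℚ} {W : Submodule ℚ (Vec n)} {C : List (Vec n)}
    (h : ∀ c ∈ C, c ⬝ᵥ c ≤ K) : GoodL K W C := by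
  induction C generalizing W with
  | nil => trivial
  | cons c C ih =>
    exact ⟨⟨0, W.zero_mem, by simpa using h c (by simp)⟩, ih fun x hx => h x (by simp [hx])⟩

theorem sp_singleton_neg (c : Vec n) : sp [-c] = sp [c] := by
  ext x
  rw [mem_sp_singleton, mem_sp_singleton]
  constructor <;> rintro ⟨k, rfl⟩ <;> exact ⟨-k, by simp⟩

theorem latt_singleton_neg (c : Vec n) : latt [-c] = latt [c] := by
  ext x
  rw [mem_latt_singleton, mem_latt_singleton]
  constructor <;> rintro ⟨k, rfl⟩ <;> exact ⟨-k, by simp⟩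

/-- The coefficient and the vector, with a nonnegative coefficient. -/
def signed (p : Vec n × ℚ) : ℚ × Vec n := if 0 < -p.2 then (-p.2, (-1 : ℚ) • p.1) else (p.2, p.1)

theorem signed_spec (p : Vec n × ℚ) : 0 ≤ (signed p).1 ∧ (signed p).1 = |p.2| ∧
    (signed p).1 • (signed p).2 = p.2 • p.1 ∧ ((signed p).2 = p.1 ∨ (signed p).2 = -p.1) ∧
    (p.2 = 0 → signed p = (0, p.1)) := by
  unfold signed
  split_ifs with h
  · refine ⟨h.le, (abs_of_neg (by linarith)).symm, by simp, by simp, fun h' => ?_⟩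
    rw [h'] at h; simp at h
  · have : 0 ≤ p.2 := by linarith
    exact ⟨this, (abs_of_nonneg this).symm, rfl, Or.inl rfl, fun h' => by rw [h']⟩

/-- Process one more basis vector in `ins`. -/
def insStep (acc : (ℚ × Vec n) × List (Vec n)) (p : Vec n × ℚ) : (ℚ × Vec n) × List (Vec n) :=
  if 0 < acc.1.1 then ((euclid (signed p, acc.1)).1, (euclid (signed p, acc.1)).2.2 :: acc.2)
  else if 0 < (signed p).1 then (signed p, acc.2)
  else (acc.1, (signed p).2 :: acc.2)

/-- Given basis vectors `c` with coefficients `a`, find `((g, e), F)` such that the combination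
`∑ a • c` equals `g • e`, and `e :: F` generates the same lattice. -/
def ins (l : List (Vec n × ℚ)) (z : Vec n) : (ℚ × Vec n) × List (Vec n) :=
  l.reverse.foldl insStep ((0, z), [])

theorem ins_cons (p : Vec n × ℚ) (l : List (Vec n × ℚ)) (z : Vec n) :
    ins (p :: l) z = insStep (ins l z) p := by
  simp [ins]

/-- The properties of `ins`, for coefficients which are integer multiples of `η`. -/
structure InsSpec (η : ℚ) (l : List (Vec n × ℚ)) (z : Vec n)
    (r : (ℚ × Vec n) × List (Vec n)) : Prop where
  nonneg : 0 ≤ r.1.1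
  int : ∃ k : ℤ, r.1.1 = η * k
  comb : r.1.1 • r.1.2 = (l.map fun p => p.2 • p.1).sum
  zero : r.1.1 = 0 → r.1.2 = z ∧ r.2 = l.map Prod.fst ∧ ∀ p ∈ l, p.2 = 0
  pos : 0 < r.1.1 → latt (r.1.2 :: r.2) = latt (l.map Prod.fst) ∧ r.2.length + 1 = l.length
  good : ∀ K W, GoodL K W (l.map Prod.fst) → 0 < r.1.1 → GoodL K (W ⊔ sp [r.1.2]) r.2
  bound : ∀ M A : ℚ, 0 ≤ M → 0 ≤ A → (∀ p ∈ l, (∀ j, |p.1 j| ≤ M) ∧ |p.2| ≤ A) →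
    r.1.1 ≤ A ∧ ∀ f ∈ r.2, ∀ j, |f j| ≤ M + l.length * (A * M) / η

theorem abs_comb_le {l : List (Vec n × ℚ)} {M A : ℚ} (hA : 0 ≤ A)
    (h : ∀ p ∈ l, (∀ j, |p.1 j| ≤ M) ∧ |p.2| ≤ A) (j : Fin n) :
    |(l.map fun p => p.2 • p.1).sum j| ≤ l.length * (A * M) := by
  induction l with
  | nil => simp
  | cons p l ih =>
    rw [List.map_cons, List.sum_cons, Pi.add_apply, Pi.smul_apply, smul_eq_mul]
    have h1 := ih fun q hq => h q (by simp [hq])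
    have h2 := h p (by simp)
    have h3 : |p.2 * p.1 j| ≤ A * M := by
      rw [abs_mul]; exact mul_le_mul h2.2 (h2.1 j) (abs_nonneg _) hA
    refine (abs_add_le _ _).trans ?_
    push_cast [List.length_cons]
    linarith

/-- The list is processed from its end, so when `p` is reached the later vectors are already
combined into `g • e`. Euclid's algorithm applied to `p` and `e` gives the new combined vector `X`
and a second vector `Y`, which goes to the front of the list. Leading terms with coefficient zero
are simply kept; the given vector `z` is only a placeholder until a nonzero coefficient occurs. -/
theorem ins_spec {η : ℚ} (hη : 0 < η) (l : List (Vec n × ℚ)) (z : Vec n)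
    (hl : ∀ p ∈ l, ∃ k : ℤ, p.2 = η * k) : InsSpec η l z (ins l z) := by
  induction l with
  | nil =>
    refine ⟨le_rfl, ⟨0, by simp [ins]⟩, by simp [ins], fun _ => ⟨rfl, rfl, by simp⟩, fun h => ?_,
      fun _ _ _ _ => trivial, fun M A hM hA _ => ⟨hA, by simp [ins]⟩⟩
    exact absurd h (lt_irrefl _)
  | cons p l ih =>
    obtain ⟨nonneg, int, comb, zero, pos, good, bound⟩ := ih fun q hq => hl q (by simp [hq])
    rw [ins_cons]
    generalize ins l z = acc at *
    obtain ⟨⟨g, e⟩, F⟩ := acc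
    obtain ⟨s1, s2, s3, s4, s5⟩ := signed_spec p
    obtain ⟨k, hk⟩ := hl p (by simp)
    have sk : ∃ k : ℤ, (signed p).1 = η * k := by
      refine ⟨|k|, ?_⟩
      rw [s2, hk, abs_mul, abs_of_pos hη]; push_cast; rfl
    have ssp : sp [(signed p).2] = sp [p.1] := by
      rcases s4 with h | h <;> rw [h]
      exact sp_singleton_neg _
    have slatt : latt [(signed p).2] = latt [p.1] := by
      rcases s4 with h | h <;> rw [h]
      exact latt_singleton_neg _
    have sabs : ∀ j, |(signed p).2 j| = |p.1 j| := by
      intro j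
      rcases s4 with h | h <;> rw [h]
      rw [Pi.neg_apply, abs_neg]
    have snear : ∀ {K W}, Near K W p.1 → Near K W (signed p).2 := by
      intro K W hN
      rcases s4 with h | h <;> rw [h]
      · exact hN
      · have := hN.smul (ρ := -1) (by simp)
        simpa using this
    dsimp only at *
    unfold insStep
    dsimp only
    split_ifs with hg ha
    · obtain ⟨r0, rI⟩ := euclid_spec (c := (signed p).2) (e := e) hη hg sk int
      have hcomb : (signed p).1 • (signed p).2 + g • e
          = ((p :: l).map fun p => p.2 • p.1).sum := by
        rw [s3, comb]; simp
      rw [hcomb] at rI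
      have hr : euclid (((signed p).1, (signed p).2), (g, e)) = euclid (signed p, (g, e)) := rfl
      rw [hr] at r0 rI
      generalize euclid (signed p, (g, e)) = r at *
      obtain ⟨⟨x, X⟩, ⟨y, Y⟩⟩ := r
      have hbd := rI.bounds hη
      obtain ⟨x_pos, x_le, -, -, x_int, -, rcomb, rlatt, σ, a, b, hσ, hX, hY, -, -, -, -⟩ := rI
      dsimp only at *
      subst r0
      rw [zero_smul, add_zero] at rcomb
      have rsp : sp [X, Y] = sp [(signed p).2, e] := sp_eq_of_latt_eq rlatt
      refine ⟨x_pos.le, x_int, rcomb, fun h => absurd h x_pos.ne', fun _ => ⟨?_, ?_⟩, ?_, ?_⟩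
      · have h1 := (pos hg).1
        rw [List.map_cons, latt_cons p.1, ← h1, ← slatt, latt_cons e, ← sup_assoc,
          ← latt_append [(signed p).2] [e]]
        simp only [List.cons_append, List.nil_append]
        rw [← rlatt, ← latt_append [X, Y] F]
        rfl
      · have := (pos hg).2
        simp only [List.length_cons]; omega
      · intro K W hG _
        rw [List.map_cons, GoodL] at hG
        refine ⟨?_, ?_⟩
        -- `Y` equals `ρ • c` plus a multiple of `κ = x • X`, with `|ρ| ≤ 1`. Modulo the span of `X`
        -- it is therefore no farther from `W` than `c` was, which is why Gram–Schmidt norms do not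
        -- grow.
        · rw [hY]
          have hρ : |-σ * x / g| ≤ 1 := by
            have hσ' : |-σ| = 1 := by rcases hσ with rfl | rfl <;> simp
            rw [abs_div, abs_mul, hσ', one_mul, abs_of_pos x_pos, abs_of_pos hg, div_le_one hg]
            exact x_le
          refine ((snear hG.1).smul hρ).mono le_sup_left |>.add_mem ?_
          rw [← rcomb]
          exact Submodule.smul_mem _ _ (Submodule.smul_mem _ _ (Submodule.mem_sup_right
            (mem_sp (by simp))))
        -- For the later vectors nothing changes, because `X, Y` and `c, e` span the same plane.
        · have h1 := good K _ hG.2 hg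
          rw [← ssp, sup_assoc, ← sp_append, List.singleton_append, ← rsp] at h1
          rwa [sup_assoc, ← sp_append, List.singleton_append]
      · intro M A hM hA hb
        obtain ⟨b1, b2⟩ := bound M A hM hA fun q hq => hb q (by simp [hq])
        refine ⟨x_le.trans b1, fun f hf j => ?_⟩
        rcases List.mem_cons.1 hf with rfl | hf
        · refine (hbd j).2.trans (add_le_add ?_ ?_)
          · rw [sabs]; exact (hb p (by simp)).1 j
          · exact div_le_div_of_nonneg_right (abs_comb_le hA hb j) hη.le
        · refine (b2 f hf j).trans ?_
          have : (0 : ℚ) ≤ A * M := mul_nonneg hA hM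
          push_cast [List.length_cons]
          gcongr
          linarith
    · have hg0 : g = 0 := le_antisymm (not_lt.1 hg) nonneg
      obtain ⟨z1, z2, z3⟩ := zero hg0
      refine ⟨s1, sk, ?_, fun h => absurd h ha.ne', fun _ => ⟨?_, ?_⟩, ?_, ?_⟩
      · rw [s3, List.map_cons, List.sum_cons, ← comb, hg0, zero_smul, add_zero]
      · dsimp only
        rw [latt_cons, slatt, z2, List.map_cons, latt_cons p.1 (l.map Prod.fst)]
      · rw [z2]; simp
      · intro K W hG _
        dsimp only
        rw [ssp, z2]
        exact hG.2
      · intro M A hM hA hb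
        refine ⟨by rw [s2]; exact (hb p (by simp)).2, fun f hf j => ?_⟩
        rw [z2] at hf
        obtain ⟨q, hq, rfl⟩ := List.mem_map.1 hf
        have : (0 : ℚ) ≤ A * M := mul_nonneg hA hM
        have h2 : 0 ≤ ((p :: l).length : ℚ) * (A * M) / η := by positivity
        have h3 := (hb q (by simp [hq])).1 j
        linarith
    · have hg0 : g = 0 := le_antisymm (not_lt.1 hg) nonneg
      obtain ⟨z1, z2, z3⟩ := zero hg0
      have hp0 : p.2 = 0 := by
        have : (signed p).1 = 0 := le_antisymm (not_lt.1 ha) s1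
        rwa [s2, abs_eq_zero] at this
      have hs := s5 hp0
      refine ⟨nonneg, int, ?_, fun _ => ⟨z1, ?_, ?_⟩, fun h => absurd h hg, fun _ _ _ h => absurd h hg,
        ?_⟩
      · rw [List.map_cons, List.sum_cons, ← comb, hp0, zero_smul, zero_add]
      · rw [hs, z2]; rfl
      · intro q hq
        rcases List.mem_cons.1 hq with rfl | hq
        exacts [hp0, z3 q hq]
      · intro M A hM hA hb
        refine ⟨by rw [hg0]; exact hA, fun f hf j => ?_⟩
        have : (0 : ℚ) ≤ A * M := mul_nonneg hA hM
        have h2 : 0 ≤ ((p :: l).length : ℚ) * (A * M) / η := by positivity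
        rw [hs, z2] at hf
        rcases List.mem_cons.1 hf with rfl | hf
        · have h3 := (hb p (by simp)).1 j
          dsimp only
          linarith
        · obtain ⟨q, hq, rfl⟩ := List.mem_map.1 hf
          have h3 := (hb q (by simp [hq])).1 j
          linarith

/-- Bound for the size of the result of `ins`. -/
def insB (s : ℕ) : ℕ :=
  1 + (1 + (2 * s + s + 3) + (2 + s * (1 + (2 * s + (4 * s + 1) + 3)))) +
    (2 + s * (1 + (2 + s * (1 + (2 * s + (4 * s + 1) + 3)))))

theorem pb_insB : PB insB := by
  have h1 : PB fun s => 2 + s * (1 + (2 * s + (4 * s + 1) + 3)) :=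
    (PB.const 2).add (PB.id.mul ((PB.const 1).add ((((PB.const 2).mul PB.id).add
      (((PB.const 4).mul PB.id).add (PB.const 1))).add (PB.const 3))))
  exact ((PB.const 1).add (((PB.const 1).add ((((PB.const 2).mul PB.id).add PB.id).add
    (PB.const 3))).add h1)).add ((PB.const 2).add (PB.id.mul ((PB.const 1).add h1)))

theorem sz_ins_le (l : List (Vec n × ℚ)) (z : Vec n) : sz (ins l z) ≤ insB (sz l + sz z) := by
  set s := sz l + sz z with hs
  set D := cden l
  have hD0 : 0 < D := cden_pos l
  have hDQ : (0 : ℚ) < D := by exact_mod_cast hD0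
  have hDs : D ≤ 2 ^ s := (cden_le l).trans (Nat.pow_le_pow_right (by norm_num) (by omega))
  have hn : n ≤ s := (dim_le_sz z).trans (by omega)
  have hη : (0 : ℚ) < 1 / D := by positivity
  have hdp : ∀ p ∈ l, DivBy D p.2 ∧ ∀ j, DivBy D (p.1 j) := by
    intro p hp
    have h1 := cden_dvd_of_mem hp
    rw [cden_prod] at h1
    exact ⟨(divBy_cden p.2).mono ((Dvd.intro_left _ rfl).trans h1),
      fun j => (divBy_cden_vec p.1 j).mono ((Dvd.intro _ rfl).trans h1)⟩
  have h := ins_spec hη l z fun p hp => (divBy_iff_unit hD0).1 (hdp p hp).1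
  generalize ins l z = r at h
  obtain ⟨⟨g, e⟩, F⟩ := r
  obtain ⟨nonneg, int, comb, zero, pos, good, bound⟩ := h
  dsimp only at *
  have hpw : ∀ {u : ℕ}, u ≤ s → (2 : ℚ) ^ u ≤ 2 ^ s := fun h => pow_le_pow_right₀ (by norm_num) h
  have hbd : ∀ p ∈ l, (∀ j, |p.1 j| ≤ 2 ^ s) ∧ |p.2| ≤ 2 ^ s := by
    intro p hp
    have h1 := sz_le_of_mem hp
    rw [sz_prod] at h1
    exact ⟨fun j => (abs_coord_le p.1 j).trans (hpw (by omega)),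
      (abs_lt_two_pow_sz p.2).le.trans (hpw (by omega))⟩
  obtain ⟨b1, b2⟩ := bound (2 ^ s) (2 ^ s) (by positivity) (by positivity) hbd
  have hlen : (l.length : ℚ) ≤ 2 ^ s := (nat_cast_le_two_pow _).trans
    (hpw ((length_le_sz l).trans (by omega)))
  have hDQ' : (D : ℚ) ≤ 2 ^ s := by exact_mod_cast hDs
  have hone : (1 : ℚ) ≤ 2 ^ s := one_le_pow₀ (by norm_num)
  have hmag : (l.length : ℚ) * (2 ^ s * 2 ^ s) * D ≤ 2 ^ (4 * s) := by
    calc (l.length : ℚ) * (2 ^ s * 2 ^ s) * D ≤ 2 ^ s * (2 ^ s * 2 ^ s) * 2 ^ s := by gcongr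
      _ = _ := by ring
  have hmag' : (2 : ℚ) ^ s + (l.length : ℚ) * (2 ^ s * 2 ^ s) / (1 / (D : ℚ)) ≤ 2 ^ (4 * s + 1) := by
    rw [div_div_eq_mul_div, div_one, pow_succ]
    have : (2 : ℚ) ^ s ≤ 2 ^ (4 * s) := pow_le_pow_right₀ (by norm_num) (by omega)
    linarith
  have hL : ∀ c ∈ l.map Prod.fst, ∀ j, DivBy D (c j) := by
    intro c hc j
    obtain ⟨p, hp, rfl⟩ := List.mem_map.1 hc
    exact (hdp p hp).2 j
  have hg := sz_rat_le (q := g) (m := s) hD0 hDs ((divBy_iff_unit hD0).2 int)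
    (by rw [abs_of_nonneg nonneg]; exact b1)
  have hFlen : F.length ≤ s := by
    have := length_le_sz l
    rcases nonneg.eq_or_lt' with h0 | h0
    · rw [(zero h0).2.1]; simp; omega
    · have := (pos h0).2; omega
  have hFd : ∀ f ∈ F, ∀ j, DivBy D (f j) := by
    intro f hf j
    rcases nonneg.eq_or_lt' with h0 | h0
    · rw [(zero h0).2.1] at hf; exact hL f hf j
    · refine divBy_latt hL ?_ j
      rw [← (pos h0).1]
      exact mem_latt (by simp [hf])
  have hvec : n * (1 + (2 * s + (4 * s + 1) + 3)) ≤ s * (1 + (2 * s + (4 * s + 1) + 3)) :=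
    Nat.mul_le_mul_right _ hn
  have hF := sz_list_le F _ fun f hf => (sz_vec_le_of hD0 hDs (hFd f hf)
    fun j => (b2 f hf j).trans hmag').trans (Nat.add_le_add_left hvec _)
  have hF' : F.length * (1 + (2 + s * (1 + (2 * s + (4 * s + 1) + 3))))
      ≤ s * (1 + (2 + s * (1 + (2 * s + (4 * s + 1) + 3)))) := Nat.mul_le_mul_right _ hFlen
  have he : sz e ≤ 2 + s * (1 + (2 * s + (4 * s + 1) + 3)) := by
    rcases nonneg.eq_or_lt' with h0 | h0
    · rw [(zero h0).1]
      have h1 := Nat.le_mul_of_pos_right s (show 0 < 1 + (2 * s + (4 * s + 1) + 3) by omega)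
      omega
    · refine (sz_vec_le_of hD0 hDs (fun j => divBy_latt hL ?_ j) fun j => ?_).trans
        (Nat.add_le_add_left hvec _)
      · rw [← (pos h0).1]; exact mem_latt (by simp)
      -- `InsSpec.bound` does not cover `e`; its coordinates are bounded through `g • e`, which is
      -- the given combination, and `g ≥ 1 / D`.
      · have h1 := abs_comb_le (by positivity : (0 : ℚ) ≤ 2 ^ s) hbd j
        rw [← comb, Pi.smul_apply, smul_eq_mul, abs_mul, abs_of_pos h0] at h1
        have h2 := unit_le hη h0 int
        have h3 : 1 ≤ g * D := by
          rw [div_le_iff₀ hDQ] at h2; exact h2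
        calc |e j| ≤ |e j| * (g * D) := le_mul_of_one_le_right (abs_nonneg _) h3
          _ = g * |e j| * D := by ring
          _ ≤ (l.length : ℚ) * (2 ^ s * 2 ^ s) * D := by gcongr
          _ ≤ 2 ^ (4 * s) := hmag
          _ ≤ _ := pow_le_pow_right₀ (by norm_num) (by omega)
  rw [insB, sz_prod, sz_prod]
  dsimp only
  omega

end

theorem Cmp.ins {α : Ctx → Type} [∀ i, Enc (α i)] {S : ∀ i, α i → Prop}
    {l : ∀ i, α i → List (Vec i.n × ℚ)} {z : ∀ i, α i → Vec i.n} (hl : Cmp S l) (hz : Cmp S z) :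
    Cmp S (fun i a => ins (l i a) (z i a)) := by
  obtain ⟨b, hb, hs⟩ := hl.sz_le
  obtain ⟨b', hb', hs'⟩ := hz.sz_le
  refine foldl (ε := fun _ => ℚ) (β := fun i => (ℚ × Vec i.n) × List (Vec i.n))
    (γ := fun i => Vec i.n × ℚ) (Q := fun _ _ => True) (F := fun i s => insStep s.2.1 s.2.2) ?_
    (const 0) (((const 0).pair hz).pair nil) (reverse hl) (fun _ _ _ _ _ _ _ => trivial)
    (fun s => insB (b s + b' s)) (pb_insB.comp (hb.add hb')) ?_
  · let σ : Ctx → Type := fun i => ℚ × (((ℚ × Vec i.n) × List (Vec i.n)) × (Vec i.n × ℚ))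
    have hp : ∀ {S : ∀ i, σ i → Prop}, Cmp (α := σ) S (fun _ s => s.2.2) := snd (snd ident)
    have hacc : ∀ {S : ∀ i, σ i → Prop}, Cmp (α := σ) S (fun _ s => s.2.1) := fst (snd ident)
    have hneg : ∀ {S : ∀ i, σ i → Prop}, Cmp (α := σ) S (fun _ s => -s.2.2.2) :=
      (sub (const 0) (snd hp)).congr fun _ _ _ => zero_sub _
    have hsg : ∀ {S : ∀ i, σ i → Prop}, Cmp (α := σ) S (fun _ s => signed s.2.2) :=
      ite' hneg (hneg.pair (smul (const (-1)) (fst hp))) ((snd hp).pair (fst hp))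
    have heu : Cmp (α := σ) (fun _ s => True ∧ 0 < s.2.1.1.1)
        (fun _ s => euclid (signed s.2.2, s.2.1.1)) :=
      op_euclid.comp (hsg.pair (fst hacc)) fun i a h => h.2
    exact ite (fst (fst hacc)) ((fst heu).pair (cons (snd (snd heu)) (snd hacc)))
      (ite' (fst hsg) (hsg.pair (snd hacc)) ((fst hacc).pair (cons (snd hsg) (snd hacc))))
  · intro i a ha l₁ l₂ h
    have h1 := sz_ins_le l₁.reverse (z i a)
    rw [LatticeProblems.ins, List.reverse_reverse, sz_reverse] at h1
    refine h1.trans (pb_insB.1 ?_)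
    have h2 := sz_append l₁ l₂
    have h3 : 2 ≤ sz l₂ := by rw [sz_list]; omega
    have h4 := hs i a ha
    have h5 := hs' i a ha
    rw [← h, sz_reverse] at h2
    omega

/-! ## Completing a list of vectors to a basis of the whole space -/

section
variable {n : ℕ}

theorem gso_append (C B : List (Vec n)) : ∃ E, gso (C ++ B) = gso C ++ E := by
  induction B using List.reverseRecOn with
  | nil => exact ⟨[], by simp⟩
  | append_singleton B b ih =>
    obtain ⟨E, hE⟩ := ih
    exact ⟨E ++ [prj (C ++ B) b], by
      rw [← List.append_assoc, gso_append_singleton, hE, List.append_assoc]⟩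

/-- The nonzero Gram–Schmidt vectors of `B` relative to `C`. -/
def compl (C B : List (Vec n)) : List (Vec n) :=
  ((gso (C ++ B)).drop C.length).filter fun x => 0 < x ⬝ᵥ x

theorem sp_filter_pos (l : List (Vec n)) : sp (l.filter fun x => 0 < x ⬝ᵥ x) = sp l := by
  apply le_antisymm
  · exact sp_le.2 fun x hx => mem_sp (List.mem_filter.1 hx).1
  · refine sp_le.2 fun x hx => ?_
    by_cases h : x = 0
    · rw [h]; exact zero_mem _
    · exact mem_sp (List.mem_filter.2 ⟨hx, by simpa using dot_self_pos h⟩)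

theorem compl_spec (C B : List (Vec n)) :
    sp (C ++ compl C B) = sp (C ++ B) ∧ (∀ p ∈ compl C B, p ≠ 0 ∧ ∀ x ∈ sp C, p ⬝ᵥ x = 0) ∧
      (compl C B).Pairwise fun a b => a ⬝ᵥ b = 0 := by
  obtain ⟨E, hE⟩ := gso_append C B
  have hd : (gso (C ++ B)).drop C.length = E := by
    rw [hE, ← gso_length C, List.drop_left]
  obtain ⟨h1, h2⟩ := gso_spec (C ++ B)
  obtain ⟨h3, -⟩ := gso_spec C
  rw [hE] at h1 h2
  rw [List.pairwise_append] at h2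
  rw [compl, hd]
  refine ⟨?_, fun p hp => ?_, h2.2.1.filter _⟩
  · rw [sp_append, sp_filter_pos, ← h3, ← sp_append, h1]
  · obtain ⟨hp, h0⟩ := List.mem_filter.1 hp
    refine ⟨fun h => by simp [h] at h0, fun x hx => ?_⟩
    rw [← h3] at hx
    exact dot_eq_zero_of_sp (fun y hy => by rw [dotProduct_comm]; exact h2.2.2 y hy p hp) hx

theorem Indep.append_orthogonal {C : List (Vec n)} (hC : Indep C) :
    ∀ {U : List (Vec n)}, (∀ p ∈ U, p ≠ 0 ∧ ∀ x ∈ sp C, p ⬝ᵥ x = 0) →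
    (U.Pairwise fun a b => a ⬝ᵥ b = 0) → Indep (C ++ U) := by
  intro U
  induction U using List.reverseRecOn with
  | nil => intro _ _; simpa using hC
  | append_singleton U u ih =>
    intro h1 h2
    rw [List.pairwise_append] at h2
    rw [← List.append_assoc]
    obtain ⟨hu, hu'⟩ := h1 u (by simp)
    refine (ih (fun p hp => h1 p (by simp [hp])) h2.1).append_singleton fun hm => hu ?_
    refine dotProduct_self_eq_zero.1 (dot_eq_zero_of_sp (fun y hy => ?_) hm)
    rcases List.mem_append.1 hy with hy | hy
    · exact hu' y (mem_sp hy)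
    · rw [dotProduct_comm]; exact h2.2.2 y hy u (by simp)

theorem indep_compl {C : List (Vec n)} (hC : Indep C) (B : List (Vec n)) :
    Indep (C ++ compl C B) :=
  hC.append_orthogonal (compl_spec C B).2.1 (compl_spec C B).2.2

theorem sp_append_eq_top {B : List (Vec n)} (hB : sp B = ⊤) (C : List (Vec n)) :
    sp (C ++ B) = ⊤ := by rw [sp_append, hB, sup_top_eq]

theorem length_compl {C B : List (Vec n)} (hC : Indep C) (hB : sp B = ⊤) :
    C.length + (compl C B).length = n := by
  have h := (indep_compl hC B).finrank_eq
  rw [(compl_spec C B).1, sp_append_eq_top hB, finrank_top, Module.finrank_fin_fun,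
    List.length_append] at h
  exact h.symm

/-- Long orthogonal vectors completing `C` to a basis of the whole space. -/
def pad (C B : List (Vec n)) : List (Vec n) :=
  (compl C B).map fun p => (1 + 2 * (C.headI ⬝ᵥ C.headI) / (p ⬝ᵥ p)) • p

theorem pad_factor_pos {x p : Vec n} : 0 < 1 + 2 * (x ⬝ᵥ x) / (p ⬝ᵥ p) := by
  have h1 := dot_self_nonneg x
  have h2 := dot_self_nonneg p
  positivity

theorem sp_map_smul (l : List (Vec n)) (f : Vec n → ℚ) (hf : ∀ x ∈ l, f x ≠ 0) :
    sp (l.map fun x => f x • x) = sp l := by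
  apply le_antisymm
  · refine sp_le.2 fun x hx => ?_
    obtain ⟨y, hy, rfl⟩ := List.mem_map.1 hx
    exact (sp l).smul_mem _ (mem_sp hy)
  · refine sp_le.2 fun x hx => ?_
    have h := (sp (l.map fun x => f x • x)).smul_mem (f x)⁻¹
      (mem_sp (List.mem_map_of_mem (f := fun x => f x • x) hx))
    rwa [inv_smul_smul₀ (hf x hx)] at h

theorem sp_append_pad (C B : List (Vec n)) : sp (C ++ pad C B) = sp (C ++ compl C B) := by
  rw [sp_append, sp_append, pad, sp_map_smul _ _ fun x _ => pad_factor_pos.ne']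

theorem indep_pad {C : List (Vec n)} (hC : Indep C) (B : List (Vec n)) : Indep (C ++ pad C B) :=
  indep_of_sp_eq (indep_compl hC B) (sp_append_pad C B).symm (by simp [pad])

theorem length_append_pad {C B : List (Vec n)} (hC : Indep C) (hB : sp B = ⊤) :
    (C ++ pad C B).length = n := by
  rw [List.length_append, pad, List.length_map, length_compl hC hB]

/-- With `X` and `Q` the squared lengths of the head of `C` and of `p`, the rational factor `1 + 2 *
X / Q` avoids a square root: its square times `Q` is at least `Q + 4 * X`, hence more than `2 * X`.
-/
theorem pad_spec (C B : List (Vec n)) :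
    (∀ p ∈ pad C B, (∀ x ∈ sp C, p ⬝ᵥ x = 0) ∧ 2 * (C.headI ⬝ᵥ C.headI) < p ⬝ᵥ p) ∧
      (pad C B).Pairwise fun a b => a ⬝ᵥ b = 0 := by
  obtain ⟨-, h2, h3⟩ := compl_spec C B
  refine ⟨fun p hp => ?_, ?_⟩
  · obtain ⟨q, hq, rfl⟩ := List.mem_map.1 hp
    obtain ⟨h4, h5⟩ := h2 q hq
    refine ⟨fun x hx => by rw [smul_dotProduct, h5 x hx, smul_zero], ?_⟩
    rw [smul_dotProduct, dotProduct_smul, smul_eq_mul, smul_eq_mul]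
    have hQ := dot_self_pos h4
    have hX := dot_self_nonneg C.headI
    generalize C.headI ⬝ᵥ C.headI = X at *
    generalize q ⬝ᵥ q = Q at *
    have : (1 + 2 * X / Q) * ((1 + 2 * X / Q) * Q) = Q + 4 * X + 4 * X * (X / Q) := by
      field_simp; ring
    rw [this]
    have : 0 ≤ X * (X / Q) := by positivity
    linarith
  · rw [pad, List.pairwise_map]
    refine h3.imp fun h => ?_
    rw [smul_dotProduct, dotProduct_smul, h, smul_zero, smul_zero]

/-- A lattice vector which is shorter than the orthogonal completing vectors lies in the lattice of
the original vectors. -/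
theorem mem_latt_of_short {C U : List (Vec n)} {m : ℚ}
    (h1 : ∀ p ∈ U, (∀ x ∈ sp C, p ⬝ᵥ x = 0) ∧ m < p ⬝ᵥ p) :
    (U.Pairwise fun a b => a ⬝ᵥ b = 0) → ∀ {v : Vec n}, v ∈ latt (C ++ U) → v ⬝ᵥ v ≤ m →
    v ∈ latt C := by
  induction U using List.reverseRecOn with
  | nil => intro _ v hv _; simpa using hv
  | append_singleton U u ih =>
    intro h2 v hv hm
    rw [List.pairwise_append] at h2
    rw [← List.append_assoc, latt_append, Submodule.mem_sup] at hv
    obtain ⟨w, hw, z, hz, rfl⟩ := hv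
    obtain ⟨k, rfl⟩ := mem_latt_singleton.1 hz
    have hu : u ⬝ᵥ w = 0 := dot_eq_zero_of_sp (C := C ++ U) (fun y hy => by
      rcases List.mem_append.1 hy with hy | hy
      · exact (h1 u (by simp)).1 y (mem_sp hy)
      · rw [dotProduct_comm]; exact h2.2.2 y hy u (by simp)) (latt_le_sp _ hw)
    have hk : k = 0 := by
      by_contra hk
      have hpy : (w + (k : ℚ) • u) ⬝ᵥ (w + (k : ℚ) • u) = w ⬝ᵥ w + (k : ℚ) ^ 2 * (u ⬝ᵥ u) := by
        rw [pythagoras (by rw [dotProduct_smul, dotProduct_comm, hu, smul_zero]), smul_dotProduct,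
          dotProduct_smul, smul_eq_mul, smul_eq_mul]
        ring
      have h3 := (h1 u (by simp)).2
      have h4 := dot_self_nonneg w
      have h5 := dot_self_nonneg u
      have h6 : (1 : ℚ) ≤ (k : ℚ) ^ 2 := by
        have : 1 ≤ k ^ 2 := by have := sq_nonneg k; have := pow_ne_zero 2 hk; omega
        exact_mod_cast this
      nlinarith
    rw [hk, Int.cast_zero, zero_smul, add_zero] at hm ⊢
    exact ih (fun p hp => h1 p (by simp [hp])) h2.1 hw hm

/-! ## Points of Euclidean space -/

/-- `ratPoint` as an additive map. -/
def ratHom (n : ℕ) : Vec n →ₗ[ℤ] EuclideanSpace ℝ (Fin n) where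
  toFun := ratPoint
  map_add' x y := by ext j; simp [ratPoint]
  map_smul' k x := by ext j; simp [ratPoint]

theorem norm_ratPoint_sq (x : Vec n) : ‖ratPoint x‖ ^ 2 = ((x ⬝ᵥ x : ℚ) : ℝ) := by
  rw [EuclideanSpace.real_norm_sq_eq]
  simp [ratPoint, dotProduct, sq]

theorem ratPoint_sub (x y : Vec n) : ratPoint x - ratPoint y = ratPoint (x - y) := by
  ext j; simp [ratPoint]

theorem norm_ratPoint_le_iff (x : Vec n) {r : ℝ} (hr : 0 ≤ r) :
    ‖ratPoint x‖ ≤ r ↔ ((x ⬝ᵥ x : ℚ) : ℝ) ≤ r ^ 2 := by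
  rw [← norm_ratPoint_sq, sq_le_sq₀ (norm_nonneg _) hr]

theorem ratPoint_eq_zero {x : Vec n} : ratPoint x = 0 ↔ x = 0 := by
  rw [← norm_eq_zero, ← sq_eq_zero_iff, norm_ratPoint_sq, Rat.cast_eq_zero,
    dotProduct_self_eq_zero]

/-- Linearly independent rational vectors are independent over the reals. -/
theorem linearIndependent_ratPoint {v : Fin n → Vec n} (h : LinearIndependent ℚ v) :
    LinearIndependent ℝ fun i => ratPoint (v i) := by
  have h1 : IsUnit (Matrix.of v) := Matrix.linearIndependent_rows_iff_isUnit.1 h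
  have h2 : IsUnit ((Rat.castHom ℝ).mapMatrix (Matrix.of v)) := h1.map _
  have h3 := Matrix.linearIndependent_rows_iff_isUnit.2 h2
  exact h3.map' (WithLp.linearEquiv 2 ℝ (Fin n → ℝ)).symm.toLinearMap (LinearEquiv.ker _)

/-- A list of `n` independent vectors as a basis. -/
def basisOf (Q : List (Vec n)) (hn : 1 ≤ n) (hl : Q.length = n) (hQ : Indep Q) :
    LatticeBasis n where
  one_le := hn
  vec i := Q.get (i.cast hl.symm)
  linearIndependent := linearIndependent_ratPoint
    ((indep_iff.1 hQ).comp (Fin.cast hl.symm) (Fin.cast_injective _))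

theorem enc_vecs {k : ℕ} (b : Fin k → Vec n) : Val.ofVecs b = enc (List.ofFn b) := by
  show Val.ofList _ = Val.ofList _
  rw [List.map_ofFn]; rfl

theorem enc_basisOf {Q : List (Vec n)} {hn : 1 ≤ n} {hl : Q.length = n} {hQ : Indep Q} :
    (SVP fun _ => Real.sqrt 2).encode (basisOf Q hn hl hQ) = enc Q := by
  show Val.ofVecs _ = _
  rw [enc_vecs]
  congr 1
  apply List.ext_getElem
  · simp [hl]
  · intro i _ _; simp [basisOf]

theorem mem_lattice {B : LatticeBasis n} {x : Vec n} :
    ratPoint x ∈ B.lattice ↔ x ∈ latt (List.ofFn B.vec) := by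
  have h1 : B.lattice = (latt (List.ofFn B.vec)).map (ratHom n) := by
    rw [latt, Submodule.map_span, LatticeBasis.lattice]
    congr 1
    ext y; simp [ratHom, List.mem_ofFn]
  have hinj : Function.Injective (ratHom n) := by
    rw [← LinearMap.ker_eq_bot, LinearMap.ker_eq_bot']
    exact fun x hx => ratPoint_eq_zero.1 hx
  rw [h1]
  exact ⟨fun ⟨y, hy, h⟩ => hinj h ▸ hy, fun h => ⟨x, h, rfl⟩⟩

/-- All points of the real lattice are rational, so distances need only be compared with rational
vectors. -/
theorem exists_of_mem_lattice {B : LatticeBasis n} {y : EuclideanSpace ℝ (Fin n)}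
    (hy : y ∈ B.lattice) : ∃ x ∈ latt (List.ofFn B.vec), ratPoint x = y := by
  have h1 : B.lattice = (latt (List.ofFn B.vec)).map (ratHom n) := by
    rw [latt, Submodule.map_span, LatticeBasis.lattice]
    congr 1
    ext y; simp [ratHom, List.mem_ofFn]
  rw [h1] at hy
  exact hy

theorem ofFn_basisOf {Q : List (Vec n)} {hn : 1 ≤ n} {hl : Q.length = n} {hQ : Indep Q} :
    List.ofFn (basisOf Q hn hl hQ).vec = Q := by
  apply List.ext_getElem
  · simp [hl]
  · intro i _ _; simp [basisOf]

end

/-! ## Short vectors -/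

/-- The vector answered by the oracle. -/
def ask (i : Ctx) (Q : List (Vec i.n)) : Vec i.n :=
  open Classical in if h : ∃ x : Vec i.n, i.O (enc Q) = enc x then h.choose else 0

/-- Comparing with every nonzero lattice vector instead of `lambda₁`, and squaring, turns the factor
`√2` into the rational number `2`. -/
theorem ask_spec {i : Ctx} {Q : List (Vec i.n)} (hl : Q.length = i.n) (hQ : Indep Q)
    (h0 : Q ≠ []) : i.O (enc Q) = enc (ask i Q) ∧ ask i Q ∈ latt Q ∧ ask i Q ≠ 0 ∧
      ∀ y ∈ latt Q, y ≠ 0 → ask i Q ⬝ᵥ ask i Q ≤ 2 * (y ⬝ᵥ y) := by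
  have hn : 1 ≤ i.n := hl ▸ List.length_pos_iff.2 h0
  obtain ⟨x, hx, hmem, hpos, hle⟩ := i.solved i.n (basisOf Q hn hl hQ)
  rw [enc_basisOf] at hx
  have hex : ∃ x : Vec i.n, i.O (enc Q) = enc x := ⟨x, hx⟩
  have ha : i.O (enc Q) = enc (ask i Q) := by
    rw [ask, dif_pos hex]; exact hex.choose_spec
  -- The encoding of vectors is injective, so the vector chosen in `ask` is the one for which the
  -- oracle's guarantee is known.
  have hax : ask i Q = x := by
    have h1 : enc (ask i Q) = enc x := ha.symm.trans hx
    have h2 : ∀ y z : List ℚ, Val.ofList (y.map Val.rat) = Val.ofList (z.map Val.rat) → y = z := by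
      intro y
      induction y with
      | nil => intro z h; cases z with
        | nil => rfl
        | cons b z => simp [Val.ofList] at h
      | cons a y ih => intro z h; cases z with
        | nil => simp [Val.ofList] at h
        | cons b z =>
          simp only [List.map_cons, Val.ofList, Val.pair.injEq, Val.rat.injEq] at h
          rw [h.1, ih z h.2]
    rw [enc_vec, enc_vec] at h1
    exact List.ofFn_injective (h2 _ _ h1)
  rw [mem_lattice, ofFn_basisOf] at hmem
  rw [hax]
  refine ⟨hx, hmem, fun h => by simp [h, ratPoint_eq_zero.2] at hpos, fun y hy hy0 => ?_⟩
  have hlam : lambda₁ (basisOf Q hn hl hQ).lattice ≤ ‖ratPoint y‖ := by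
    refine csInf_le ⟨0, ?_⟩ ⟨ratPoint y, ?_, fun h => hy0 (ratPoint_eq_zero.1 h), rfl⟩
    · rintro r ⟨z, -, -, rfl⟩; exact norm_nonneg _
    · rw [mem_lattice, ofFn_basisOf]; exact hy
  have h3 : ‖ratPoint x‖ ≤ Real.sqrt 2 * ‖ratPoint y‖ :=
    hle.trans (mul_le_mul_of_nonneg_left hlam (Real.sqrt_nonneg _))
  rw [norm_ratPoint_le_iff _ (by positivity), mul_pow, Real.sq_sqrt (by norm_num),
    norm_ratPoint_sq] at h3
  exact_mod_cast h3

/-- A short nonzero vector of the lattice generated by `C`; the list `B` spans the space. -/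
def svp (i : Ctx) (B C : List (Vec i.n)) : Vec i.n := ask i (C ++ pad C B)

/-- The answer is at most `√2` times as long as the head of `C`, while every padding vector is
longer than that; so by `mem_latt_of_short` the answer involves no padding vector. -/
theorem svp_spec {i : Ctx} {B C : List (Vec i.n)} (hB : sp B = ⊤) (hC : Indep C) (h0 : C ≠ []) :
    svp i B C ∈ latt C ∧ svp i B C ≠ 0 ∧
      ∀ y ∈ latt C, y ≠ 0 → svp i B C ⬝ᵥ svp i B C ≤ 2 * (y ⬝ᵥ y) := by
  obtain ⟨-, h1, h2, h3⟩ := ask_spec (length_append_pad hC hB) (indep_pad hC B) (by simp [h0])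
  have hle : ∀ {y}, y ∈ latt C → y ∈ latt (C ++ pad C B) := fun {y} hy => by
    rw [latt_append]; exact Submodule.mem_sup_left hy
  have hh : C.headI ∈ C := by
    cases C with
    | nil => exact absurd rfl h0
    | cons c C => simp
  refine ⟨mem_latt_of_short (pad_spec C B).1 (pad_spec C B).2 h1 ?_, h2, fun y hy hy0 =>
    h3 y (hle hy) hy0⟩
  exact h3 _ (hle (mem_latt hh)) (hC.ne_zero hh)

/-- Reading the answer is cheap: as a lattice vector it has the common denominator of the query, and
it is at most `√2` times as long as a basis vector. -/
theorem Cmp.op_ask : Cmp (α := fun i => List (Vec i.n))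
    (fun i Q => Q.length = i.n ∧ Indep Q ∧ Q ≠ []) (fun i Q => ask i Q) := by
  have hsz : ∀ (i : Ctx) (Q : List (Vec i.n)), Q.length = i.n → Indep Q → Q ≠ [] →
      sz (ask i Q) ≤ 2 + sz Q * (1 + (2 * sz Q + (3 * sz Q + 1) + 3)) := by
    intro i Q hl hQ h0
    obtain ⟨-, h1, -, h3⟩ := ask_spec hl hQ h0
    obtain ⟨q, hq⟩ := List.exists_mem_of_ne_nil Q h0
    have hle := h3 q (mem_latt hq) (hQ.ne_zero hq)
    have hqs := sz_le_of_mem hq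
    have hn : i.n ≤ sz Q := (dim_le_sz q).trans hqs
    refine (sz_vec_le_of (m := 3 * sz Q + 1) (cden_pos Q) (cden_le Q) (fun j => divBy_latt (fun c hc j =>
      (divBy_cden_vec c j).mono (cden_dvd_of_mem hc)) h1 j) fun j => ?_).trans
      (Nat.add_le_add_left (Nat.mul_le_mul_right _ hn) _)
    refine abs_le_of_sq_le_sq ?_ (by positivity)
    refine (sq_coord_le _ j).trans (hle.trans ?_)
    have h4 : ∀ j, |q j| ≤ 2 ^ sz Q := fun j =>
      (abs_coord_le q j).trans (pow_le_pow_right₀ (by norm_num) hqs)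
    have h5 := (le_abs_self _).trans (abs_dot_le h4 h4)
    have h6 : (i.n : ℚ) ≤ 2 ^ sz Q :=
      (nat_cast_le_two_pow _).trans (pow_le_pow_right₀ (by norm_num) hn)
    calc 2 * (q ⬝ᵥ q) ≤ 2 * (2 ^ sz Q * (2 ^ sz Q * 2 ^ sz Q)) := by
          refine mul_le_mul_of_nonneg_left (h5.trans ?_) (by norm_num)
          gcongr
      _ = 2 ^ (3 * sz Q + 1) := by ring
      _ ≤ 2 ^ ((3 * sz Q + 1) * 2) := pow_le_pow_right₀ (by norm_num) (by omega)
      _ = (2 ^ (3 * sz Q + 1)) ^ 2 := by rw [pow_mul]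
  refine ⟨.query, fun s => 1 + s + (2 + s * (1 + (2 * s + (3 * s + 1) + 3))),
    ((PB.const 1).add PB.id).add ((PB.const 2).add (PB.id.mul ((PB.const 1).add
      ((((PB.const 2).mul PB.id).add (((PB.const 3).mul PB.id).add (PB.const 1))).add
        (PB.const 3))))), ?_⟩
  rintro i Q ⟨hl, hQ, h0⟩
  have hr := Run.query (O := i.O) (enc Q)
  have ha := (ask_spec hl hQ h0).1
  rw [ha] at hr
  refine ⟨_, _, hr, Nat.add_le_add_left (hsz i Q hl hQ h0) _, ?_⟩
  intro q hq
  rw [List.mem_singleton.1 hq]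
  exact ⟨basisOf Q (hl ▸ List.length_pos_iff.2 h0) hl hQ, enc_basisOf.symm⟩

/-! ### Computing short vectors with one oracle query -/

namespace Cmp
variable {α : Ctx → Type} [∀ i, Enc (α i)] {S : ∀ i, α i → Prop}

theorem compl {C B : ∀ i, α i → List (Vec i.n)} (hC : Cmp S C) (hB : Cmp S B) :
    Cmp S (fun i a => compl (C i a) (B i a)) :=
  filter (ε := fun _ => ℚ) (F := fun _ s => s.2 ⬝ᵥ s.2) (dot (snd ident) (snd ident)) (const 0)
    (drop hC (gso (append hC hB)))

theorem pad {C B : ∀ i, α i → List (Vec i.n)} (hC : Cmp S C) (hB : Cmp S B)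
    (h0 : ∀ i a, S i a → C i a ≠ []) : Cmp S (fun i a => pad (C i a) (B i a)) :=
  map' (ε := fun i => Vec i.n)
    (F := fun _ s => (1 + 2 * (s.1 ⬝ᵥ s.1) / (s.2 ⬝ᵥ s.2)) • s.2)
    (smul (add (const 1) (div (mul (const 2) (dot (fst ident) (fst ident)))
      (dot (snd ident) (snd ident)))) (snd ident)) (headI hC h0) (compl hC hB)

theorem svp {C B : ∀ i, α i → List (Vec i.n)} (hB : Cmp S B) (hC : Cmp S C)
    (h : ∀ i a, S i a → sp (B i a) = ⊤ ∧ Indep (C i a) ∧ C i a ≠ []) :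
    Cmp S (fun i a => svp i (B i a) (C i a)) :=
  op_ask.comp (append hC (pad hC hB fun i a ha => (h i a ha).2.2)) fun i a ha =>
    ⟨length_append_pad (h i a ha).2.1 (h i a ha).1, indep_pad (h i a ha).2.1 _,
      by simp [(h i a ha).2.2]⟩

end Cmp

/-! ## A common unit of the coordinates -/

section
variable {n : ℕ}

/-- The coordinates of all vectors of a list. -/
def entries (C : List (Vec n)) : List ℚ := C.foldl (fun acc x => acc ++ List.ofFn x) []

theorem entries_append_singleton (C : List (Vec n)) (c : Vec n) :
    entries (C ++ [c]) = entries C ++ List.ofFn c := by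
  simp [entries]

theorem mem_entries {C : List (Vec n)} {c : Vec n} (hc : c ∈ C) (j : Fin n) : c j ∈ entries C := by
  induction C using List.reverseRecOn with
  | nil => simp at hc
  | append_singleton C x ih =>
    rw [entries_append_singleton, List.mem_append]
    rcases List.mem_append.1 hc with hc | hc
    · exact Or.inl (ih hc)
    · rw [List.mem_singleton.1 hc]; exact Or.inr (by simp)

theorem sz_entries_le (C : List (Vec n)) : sz (entries C) ≤ sz C := by
  induction C using List.reverseRecOn with
  | nil => exact le_rfl
  | append_singleton C x ih =>
    rw [entries_append_singleton]
    have h1 := sz_append (entries C) (List.ofFn x)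
    have h2 := sz_append C [x]
    rw [sz_cons, sz_nil] at h2
    rw [← sz_vec] at h1
    omega

/-- One step of Euclid's algorithm for several numbers; the vectors serve as bookkeeping. -/
def gcdStep (p c : Vec n) (g q : ℚ) : ℚ := (euclid ((q, p), (g, c))).1.1

/-- A positive number of which `1` and all the given numbers are integer multiples. -/
def unit (p c : Vec n) (l : List ℚ) : ℚ := l.foldl (gcdStep p c) 1

/-- Euclid's algorithm on `(q, p)` and `(g, c)` ends with `d • X = q • p + g • c`, where `X` is an
integer combination of `p` and `c`. Since `p` and `c` are orthogonal, the two coefficients separate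
and show that `q` and `g` are integer multiples of `d`. -/
theorem gcdStep_spec {η g q : ℚ} {p c : Vec n} (hp : p ≠ 0) (hc : c ≠ 0) (hpc : p ⬝ᵥ c = 0)
    (hη : 0 < η) (hg : 0 < g) (hg' : ∃ z : ℤ, g = η * z) (hq : ∃ z : ℤ, q = η * z) :
    0 < gcdStep p c g q ∧ gcdStep p c g q ≤ g ∧ (∃ z : ℤ, gcdStep p c g q = η * z) ∧
      g ∈ AddSubgroup.zmultiples (gcdStep p c g q) ∧
      q ∈ AddSubgroup.zmultiples (gcdStep p c g q) := by
  obtain ⟨h0, h⟩ := euclid_spec (c := p) (e := c) hη hg hq hg'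
  rw [gcdStep]
  generalize euclid ((q, p), (g, c)) = r at *
  refine ⟨h.x_pos, h.x_le, h.x_int, ?_⟩
  have hX : r.1.2 ∈ latt [p, c] := h.latt_eq ▸ mem_latt (by simp)
  rw [latt_cons, Submodule.mem_sup] at hX
  obtain ⟨y, hy, z, hz, hyz⟩ := hX
  obtain ⟨k, rfl⟩ := mem_latt_singleton.1 hy
  obtain ⟨m, rfl⟩ := mem_latt_singleton.1 hz
  have hcomb := h.comb
  rw [h0, zero_smul, add_zero, ← hyz] at hcomb
  -- The products with `p` and with `c` isolate one coefficient each.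
  have h1 := congrArg (· ⬝ᵥ p) hcomb
  have h2 := congrArg (· ⬝ᵥ c) hcomb
  have hP := dot_self_pos hp
  have hC := dot_self_pos hc
  simp only [add_dotProduct, smul_dotProduct, smul_eq_mul, hpc, dotProduct_comm c p, mul_zero,
    add_zero, zero_add] at h1 h2
  constructor <;> rw [AddSubgroup.mem_zmultiples_iff]
  · refine ⟨m, ?_⟩
    rw [zsmul_eq_mul]
    exact mul_right_cancel₀ hC.ne' (by linarith)
  · refine ⟨k, ?_⟩
    rw [zsmul_eq_mul]
    exact mul_right_cancel₀ hP.ne' (by linarith)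

theorem unit_append_singleton (p c : Vec n) (l : List ℚ) (q : ℚ) :
    unit p c (l ++ [q]) = gcdStep p c (unit p c l) q := by
  simp [unit]

/-- No elementary operation returns a denominator, so a common unit is found as a greatest common
divisor. Starting from `1` keeps it positive and at most one, and divisibility of its denominator
into `D` bounds its size. -/
theorem unit_spec {p c : Vec n} (hp : p ≠ 0) (hc : c ≠ 0) (hpc : p ⬝ᵥ c = 0) {D : ℕ} (hD : 0 < D)
    {l : List ℚ} (hl : ∀ q ∈ l, DivBy D q) :
    0 < unit p c l ∧ unit p c l ≤ 1 ∧ DivBy D (unit p c l) ∧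
      ∀ q ∈ l, q ∈ AddSubgroup.zmultiples (unit p c l) := by
  induction l using List.reverseRecOn with
  | nil => exact ⟨one_pos, le_rfl, ⟨D, by simp [unit]⟩, by simp⟩
  | append_singleton l q ih =>
    obtain ⟨h1, h2, h3, h4⟩ := ih fun q hq => hl q (by simp [hq])
    rw [unit_append_singleton]
    have hη : (0 : ℚ) < 1 / D := by positivity
    obtain ⟨g1, g2, g3, g4, g5⟩ := gcdStep_spec hp hc hpc hη h1 ((divBy_iff_unit hD).1 h3)
      ((divBy_iff_unit hD).1 (hl q (by simp)))
    refine ⟨g1, g2.trans h2, (divBy_iff_unit hD).2 g3, fun x hx => ?_⟩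
    rcases List.mem_append.1 hx with hx | hx
    · exact (AddSubgroup.zmultiples_le_of_mem g4) (h4 x hx)
    · rw [List.mem_singleton.1 hx]; exact g5

theorem latt_coord_mem {C : List (Vec n)} {g : ℚ}
    (h : ∀ c ∈ C, ∀ j, c j ∈ AddSubgroup.zmultiples g) {x : Vec n} (hx : x ∈ latt C) (j : Fin n) :
    x j ∈ AddSubgroup.zmultiples g := by
  induction hx using Submodule.span_induction with
  | mem x hx => exact h x hx j
  | zero => exact zero_mem _
  | add x y _ _ hx hy => exact add_mem hx hy
  | smul k x _ hx => exact zsmul_mem hx k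

theorem dot_mem_zmultiples {g : ℚ} {x y : Vec n} (hx : ∀ j, x j ∈ AddSubgroup.zmultiples g)
    (hy : ∀ j, y j ∈ AddSubgroup.zmultiples g) : x ⬝ᵥ y ∈ AddSubgroup.zmultiples (g ^ 2) := by
  refine sum_mem fun j _ => ?_
  obtain ⟨a, ha⟩ := AddSubgroup.mem_zmultiples_iff.1 (hx j)
  obtain ⟨b, hb⟩ := AddSubgroup.mem_zmultiples_iff.1 (hy j)
  rw [AddSubgroup.mem_zmultiples_iff]
  refine ⟨a * b, ?_⟩
  rw [← ha, ← hb]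
  simp only [zsmul_eq_mul]
  push_cast
  ring

/-- Two multiples of `h` cannot differ by a positive amount less than `h`. This turns the
approximate inequalities from the binary search into exact ones. -/
theorem le_of_le_add {h a b ε : ℚ} (hε : ε < h) (ha : a ∈ AddSubgroup.zmultiples h)
    (hb : b ∈ AddSubgroup.zmultiples h) (hab : a ≤ b + ε) : a ≤ b := by
  obtain ⟨k, hk⟩ := AddSubgroup.mem_zmultiples_iff.1 (sub_mem ha hb)
  rw [zsmul_eq_mul] at hk
  by_contra hlt
  have h0 : 0 < (k : ℚ) * h := by linarith
  have hk1 : (k : ℚ) * h < 1 * h := by linarith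
  rcases lt_trichotomy h 0 with hh | hh | hh
  · have : (1 : ℚ) < k := by nlinarith
    nlinarith
  · simp [hh] at h0
  · have h1 : (0 : ℚ) < k := by by_contra h'; nlinarith
    have h2 : (k : ℚ) < 1 := lt_of_mul_lt_mul_right hk1 hh.le
    have h3 : 0 < k := by exact_mod_cast h1
    have h4 : k < 1 := by exact_mod_cast h2
    omega

end

/-! ## The embedding technique -/

/-- A short vector of the lattice spanned by `C` and the target `t` moved out by `σ • p`. -/
def moved (i : Ctx) (B C : List (Vec i.n)) (t p : Vec i.n) (σ : ℚ) : Vec i.n :=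
  svp i B (C ++ [t + σ • p])

section
variable {i : Ctx} {B C : List (Vec i.n)} {t p : Vec i.n} {σ : ℚ}

theorem indep_moved (hC : Indep C) (ht : t ∈ sp C) (hp : p ≠ 0) (hpC : ∀ x ∈ sp C, p ⬝ᵥ x = 0)
    (hσ : 0 < σ) : Indep (C ++ [t + σ • p]) := by
  refine hC.append_singleton fun h => hp ?_
  have h1 : σ • p ∈ sp C := by simpa using sub_mem h ht
  have h2 := hpC _ h1
  rw [dotProduct_smul, smul_eq_mul] at h2
  exact dotProduct_self_eq_zero.1 ((mul_eq_zero.1 h2).resolve_left hσ.ne')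

theorem moved_norm {x : Vec i.n} {k : ℚ} (hx : x ∈ sp C) (ht : t ∈ sp C)
    (hpC : ∀ x ∈ sp C, p ⬝ᵥ x = 0) :
    (x + k • (t + σ • p)) ⬝ᵥ (x + k • (t + σ • p))
      = (x + k • t) ⬝ᵥ (x + k • t) + k ^ 2 * (σ ^ 2 * (p ⬝ᵥ p)) := by
  have h0 : p ⬝ᵥ (x + k • t) = 0 := hpC _ (add_mem hx ((sp C).smul_mem k ht))
  have h1 : x + k • (t + σ • p) = (x + k • t) + (k * σ) • p := by
    rw [smul_add, smul_smul, add_assoc]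
  rw [h1, pythagoras (by rw [dotProduct_smul, dotProduct_comm, h0, smul_zero]), smul_dotProduct,
    dotProduct_smul, smul_eq_mul, smul_eq_mul]
  ring

/-- The short vector is compared with `y - (t + σ • p)`, which is nonzero because of its component
along `p`. Since `p` is orthogonal to `C` and `t`, Pythagoras splits all squared lengths, and the
product with `p` recovers the coefficient `k`. -/
theorem moved_spec (hB : sp B = ⊤) (hC : Indep C) (ht : t ∈ sp C) (hp : p ≠ 0)
    (hpC : ∀ x ∈ sp C, p ⬝ᵥ x = 0) (hσ : 0 < σ) :
    ∃ x ∈ latt C, ∃ k : ℤ, moved i B C t p σ = x + (k : ℚ) • (t + σ • p) ∧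
      moved i B C t p σ ≠ 0 ∧ moved i B C t p σ ⬝ᵥ p = k * (σ * (p ⬝ᵥ p)) ∧
      moved i B C t p σ ⬝ᵥ moved i B C t p σ
        = (x + (k : ℚ) • t) ⬝ᵥ (x + (k : ℚ) • t) + k ^ 2 * (σ ^ 2 * (p ⬝ᵥ p)) ∧
      ∀ y ∈ latt C, moved i B C t p σ ⬝ᵥ moved i B C t p σ
        ≤ 2 * ((y - t) ⬝ᵥ (y - t) + σ ^ 2 * (p ⬝ᵥ p)) := by
  obtain ⟨h1, h2, h3⟩ := svp_spec hB (indep_moved hC ht hp hpC hσ) (by simp)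
  rw [← moved] at h1 h2 h3
  rw [latt_append, Submodule.mem_sup] at h1
  obtain ⟨x, hx, z, hz, hxz⟩ := h1
  obtain ⟨k, rfl⟩ := mem_latt_singleton.1 hz
  refine ⟨x, hx, k, hxz.symm, h2, ?_, ?_, fun y hy => ?_⟩
  · have e1 := hpC x (latt_le_sp C hx)
    have e2 := hpC t ht
    rw [dotProduct_comm] at e1 e2
    rw [← hxz, add_dotProduct, smul_dotProduct, add_dotProduct, smul_dotProduct, e1, e2]
    simp
  · rw [← hxz, moved_norm (latt_le_sp C hx) ht hpC]
  · have hn := moved_norm (k := -1) (σ := σ) (latt_le_sp C hy) ht hpC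
    have hy2 : y + (-1 : ℚ) • t = y - t := by rw [neg_one_smul, sub_eq_add_neg]
    rw [hy2] at hn
    have hm : y + (-1 : ℚ) • (t + σ • p) ∈ latt (C ++ [t + σ • p]) := by
      have := intCast_smul_mem (-1) (mem_latt (C := C ++ [t + σ • p]) (x := t + σ • p) (by simp))
      rw [Int.cast_neg, Int.cast_one] at this
      refine add_mem ?_ this
      rw [latt_append]; exact Submodule.mem_sup_left hy
    have hP := dot_self_pos hp
    have hpos : 0 < (y + (-1 : ℚ) • (t + σ • p)) ⬝ᵥ (y + (-1 : ℚ) • (t + σ • p)) := by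
      rw [hn]
      have := dot_self_nonneg (y - t)
      positivity
    have h4 := h3 _ hm fun h => by rw [h] at hpos; simp at hpos
    rw [hn] at h4
    linarith

end

/-- Parameters of the binary search. -/
abbrev EmbEnv (n : ℕ) : Type := List (Vec n) × (List (Vec n) × (Vec n × (Vec n × ℚ)))

/-- States of the binary search. -/
abbrev EmbState (i : Ctx) : Type := EmbEnv i.n × (ℚ × ℚ)

/-- One step of the binary search for the distance. -/
def embStep (i : Ctx) (s : EmbEnv i.n × (ℚ × ℚ)) : EmbEnv i.n × (ℚ × ℚ) :=
  let σ := (s.2.1 + s.2.2) / 2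
  let v := moved i s.1.1 s.1.2.1 s.1.2.2.1 s.1.2.2.2.1 σ
  if 0 < 4 * (σ * σ * (s.1.2.2.2.1 ⬝ᵥ s.1.2.2.2.1)) - v ⬝ᵥ v then (s.1, (s.2.1, σ))
  else (s.1, (σ, s.2.2))

/-- The search continues while the interval is longer than the tolerance. -/
def embTest {n : ℕ} (s : EmbEnv n × (ℚ × ℚ)) : ℚ := s.2.2 - s.2.1 - s.1.2.2.2.2

/-- Whatever the oracle answers, the endpoints after `k` rounds are neighbouring multiples of `h / 2
^ k`. This controls both the length of the interval and the bit length of its endpoints. -/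
theorem embStep_iterate (i : Ctx) (e : EmbEnv i.n) (h : ℚ) (k : ℕ) :
    ∃ a : ℕ, a + 1 ≤ 2 ^ k ∧
      (embStep i)^[k] (e, (0, h)) = (e, (h * a / 2 ^ k, h * (a + 1 : ℕ) / 2 ^ k)) := by
  induction k with
  | zero => exact ⟨0, by simp, by simp⟩
  | succ k ih =>
    obtain ⟨a, ha, hk⟩ := ih
    rw [Function.iterate_succ_apply', hk, embStep]
    dsimp only
    have hmid : (h * a / 2 ^ k + h * (a + 1 : ℕ) / 2 ^ k) / 2
        = h * (2 * a + 1 : ℕ) / 2 ^ (k + 1) := by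
      push_cast; field_simp; ring
    have hlo : h * a / 2 ^ k = h * (2 * a : ℕ) / 2 ^ (k + 1) := by
      push_cast; field_simp; ring
    have hhi : h * (a + 1 : ℕ) / 2 ^ k = h * (2 * a + 1 + 1 : ℕ) / 2 ^ (k + 1) := by
      push_cast; field_simp; ring
    rw [hmid]
    split_ifs
    · exact ⟨2 * a, by rw [pow_succ]; omega, by rw [hlo]⟩
    · exact ⟨2 * a + 1, by rw [pow_succ]; omega, by rw [hhi]⟩

/-- The requirements on the parameters of the binary search. -/
structure EmbOk (n : ℕ) (e : EmbEnv n) : Prop where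
  top : sp e.1 = ⊤
  indep : Indep e.2.1
  mem : e.2.2.1 ∈ sp e.2.1
  ne : e.2.2.2.1 ≠ 0
  orth : ∀ x ∈ sp e.2.1, e.2.2.2.1 ⬝ᵥ x = 0
  pos : 0 < e.2.2.2.2

/-- The positive tolerance is at least `2 ^ (-sz e)` and `h` is at most `2 ^ sz h`, so linearly many
halvings suffice. -/
theorem embTest_stop {i : Ctx} {e : EmbEnv i.n} {h : ℚ} (hθ : 0 < e.2.2.2.2)
    {k : ℕ} (hk : sz h + sz e ≤ k) : ¬ 0 < embTest ((embStep i)^[k] (e, (0, h))) := by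
  obtain ⟨a, ha, hs⟩ := embStep_iterate i e h k
  rw [hs, embTest]
  dsimp only
  have h1 : h * (a + 1 : ℕ) / 2 ^ k - h * a / 2 ^ k = h / 2 ^ k := by
    push_cast; ring
  rw [h1, not_lt, sub_nonpos]
  have hsz : sz e.2.2.2.2 ≤ sz e := by
    simp only [sz_prod]
    omega
  set θ := e.2.2.2.2
  have h2 := (divBy_cden θ).one_le_mul_abs hθ.ne' (cden_pos θ)
  rw [abs_of_pos hθ] at h2
  have h3 : (cden θ : ℚ) ≤ 2 ^ sz e := by
    exact_mod_cast (cden_le θ).trans (Nat.pow_le_pow_right (by norm_num) hsz)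
  have h4 := (le_abs_self h).trans (abs_lt_two_pow_sz h).le
  rw [div_le_iff₀ (by positivity)]
  calc h ≤ 2 ^ sz h * 1 := by linarith
    _ ≤ 2 ^ sz h * (2 ^ sz e * θ) := by
        refine mul_le_mul_of_nonneg_left (h2.trans ?_) (by positivity)
        exact mul_le_mul_of_nonneg_right h3 hθ.le
    _ = θ * 2 ^ (sz h + sz e) := by ring
    _ ≤ θ * 2 ^ k := mul_le_mul_of_nonneg_left (pow_le_pow_right₀ (by norm_num) hk) hθ.le

/-- The final state of the binary search. -/
def search (i : Ctx) (e : EmbEnv i.n) (h : ℚ) : EmbEnv i.n × (ℚ × ℚ) :=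
  untilF (fun s => 0 < embTest s) (embStep i) (e, (0, h))

/-- The outcome of the test need not be monotone in the height, since the oracle may answer
arbitrarily within its factor. It is enough that `hi` always passes the test and that a failure at
`lo` proves that no lattice vector is closer than the height `lo`. -/
theorem search_spec {i : Ctx} {e : EmbEnv i.n} {h : ℚ} (he : EmbOk i.n e) (hh : 0 < h)
    (hh2 : e.2.2.1 ⬝ᵥ e.2.2.1 < h ^ 2 * (e.2.2.2.1 ⬝ᵥ e.2.2.2.1)) :
    ∃ lo hi, search i e h = (e, (lo, hi)) ∧ 0 ≤ lo ∧ lo < hi ∧ hi ≤ h ∧ hi - lo ≤ e.2.2.2.2 ∧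
      (∀ x ∈ latt e.2.1, lo ^ 2 * (e.2.2.2.1 ⬝ᵥ e.2.2.2.1) ≤ (x - e.2.2.1) ⬝ᵥ (x - e.2.2.1)) ∧
      moved i e.1 e.2.1 e.2.2.1 e.2.2.2.1 hi ⬝ᵥ moved i e.1 e.2.1 e.2.2.1 e.2.2.2.1 hi
        < 4 * (hi ^ 2 * (e.2.2.2.1 ⬝ᵥ e.2.2.2.1)) := by
  obtain ⟨k, -, hlt, hhalt, hs⟩ := exists_untilF (c := fun s => 0 < embTest s) (f := embStep i)
    (a := (e, (0, h))) ⟨_, le_rfl, embTest_stop he.pos le_rfl⟩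
  let I : EmbEnv i.n × (ℚ × ℚ) → Prop := fun s => s.1 = e ∧ 0 ≤ s.2.1 ∧ s.2.1 < s.2.2 ∧
    (∀ x ∈ latt e.2.1, s.2.1 ^ 2 * (e.2.2.2.1 ⬝ᵥ e.2.2.2.1)
      ≤ (x - e.2.2.1) ⬝ᵥ (x - e.2.2.1)) ∧
    moved i e.1 e.2.1 e.2.2.1 e.2.2.2.1 s.2.2 ⬝ᵥ moved i e.1 e.2.1 e.2.2.1 e.2.2.2.1 s.2.2
      < 4 * (s.2.2 ^ 2 * (e.2.2.2.1 ⬝ᵥ e.2.2.2.1))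
  -- If some lattice vector is closer than the height, the factor `2` of the oracle applied to a sum
  -- of two terms, one less than and one equal to the squared height, stays below four times the
  -- squared height.
  have key : ∀ {σ}, 0 < σ → (∃ x ∈ latt e.2.1, (x - e.2.2.1) ⬝ᵥ (x - e.2.2.1)
      < σ ^ 2 * (e.2.2.2.1 ⬝ᵥ e.2.2.2.1)) →
      moved i e.1 e.2.1 e.2.2.1 e.2.2.2.1 σ ⬝ᵥ moved i e.1 e.2.1 e.2.2.1 e.2.2.2.1 σ
      < 4 * (σ ^ 2 * (e.2.2.2.1 ⬝ᵥ e.2.2.2.1)) := by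
    rintro σ hσ ⟨x, hx, hlt⟩
    obtain ⟨-, -, -, -, -, -, -, h5⟩ := moved_spec he.top he.indep he.mem he.ne he.orth hσ
    have := h5 x hx
    linarith
  have hI : ∀ s, I s → 0 < embTest s → I (embStep i s) := by
    rintro ⟨e', lo, hi⟩ ⟨h1, h2, h3, h4, h5⟩ -
    dsimp only at h1 h2 h3 h4 h5
    subst h1
    rw [embStep]
    dsimp only
    split_ifs with hc
    all_goals rw [← sq, sub_pos] at hc
    · exact ⟨rfl, h2, by dsimp only; linarith, h4, hc⟩
    · refine ⟨rfl, by dsimp only; linarith, by dsimp only; linarith, fun x hx => ?_, h5⟩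
      by_contra hx'
      exact hc (key (by linarith) ⟨x, hx, not_le.1 hx'⟩)
  have h0 : I (e, (0, h)) := by
    refine ⟨rfl, le_rfl, hh, fun x _ => ?_, key hh ⟨0, zero_mem _, by simpa using hh2⟩⟩
    have := dot_self_nonneg (x - e.2.2.1)
    simpa using this
  have hfin := iterate_inv (c := fun s => 0 < embTest s) hI h0 hlt
  obtain ⟨a, ha, hk⟩ := embStep_iterate i e h k
  rw [hk] at hfin hhalt hs
  obtain ⟨-, h2, h3, h4, h5⟩ := hfin
  refine ⟨_, _, hs, h2, h3, ?_, ?_, h4, h5⟩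
  · rw [div_le_iff₀ (by positivity)]
    refine mul_le_mul_of_nonneg_left ?_ hh.le
    exact_mod_cast ha
  · rw [embTest, not_lt] at hhalt
    dsimp only at hhalt
    linarith

/-- The vector orthogonal to `C` used for the embedding. -/
def outer {n : ℕ} (B C : List (Vec n)) : Vec n := (compl C B).headI

/-- An upper bound for the distance, in units of `outer B C`. -/
def outerBound {n : ℕ} (B C : List (Vec n)) (t : Vec n) : ℚ :=
  1 + (t ⬝ᵥ t) / (outer B C ⬝ᵥ outer B C)

/-- The unit of the coordinates of `C` and `t`. -/
def outerUnit {n : ℕ} (B C : List (Vec n)) (t : Vec n) : ℚ :=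
  unit (outer B C) C.headI (entries (C ++ [t]))

/-- The parameters of the binary search. -/
def embEnv {n : ℕ} (B C : List (Vec n)) (t : Vec n) : EmbEnv n :=
  (B, (C, (t, (outer B C, outerUnit B C t * outerUnit B C t /
    (8 * (outer B C ⬝ᵥ outer B C) * outerBound B C t)))))

/-- The height of the embedding. -/
def height (i : Ctx) (B C : List (Vec i.n)) (t : Vec i.n) : ℚ :=
  (search i (embEnv B C t) (outerBound B C t)).2.2

/-- Either a short lattice vector (flag `0`) or a close lattice vector (flag `1`). -/
def embed (i : Ctx) (B C : List (Vec i.n)) (t : Vec i.n) : ℚ × Vec i.n :=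
  let σ := height i B C t
  let p := outer B C
  let v := moved i B C t p σ
  let k := (v ⬝ᵥ p) / (σ * (p ⬝ᵥ p))
  if 0 < k * k then (1, t + σ • p - k • v) else (0, v)

theorem headI_mem {n : ℕ} {C : List (Vec n)} (h : C ≠ []) : C.headI ∈ C := by
  cases C with
  | nil => exact absurd rfl h
  | cons c C => simp

theorem outer_spec {n : ℕ} {B C : List (Vec n)} (hB : sp B = ⊤) (hC : Indep C)
    (hl : C.length < n) : outer B C ≠ 0 ∧ ∀ x ∈ sp C, outer B C ⬝ᵥ x = 0 := by
  have h := length_compl hC hB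
  exact (compl_spec C B).2.1 _ (headI_mem fun h0 => by rw [h0, List.length_nil] at h; omega)

theorem outerBound_pos {n : ℕ} (B C : List (Vec n)) (t : Vec n) : 0 < outerBound B C t := by
  have h1 := dot_self_nonneg t
  have h2 := dot_self_nonneg (outer B C)
  rw [outerBound]; positivity

theorem outerUnit_spec {n : ℕ} {B C : List (Vec n)} (hB : sp B = ⊤) (hC : Indep C)
    (hl : C.length < n) (h0 : C ≠ []) (t : Vec n) : 0 < outerUnit B C t ∧
      ∀ c ∈ C ++ [t], ∀ j, c j ∈ AddSubgroup.zmultiples (outerUnit B C t) := by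
  obtain ⟨h1, h2⟩ := outer_spec hB hC hl
  have hm := headI_mem h0
  obtain ⟨h3, -, -, h4⟩ := unit_spec h1 (hC.ne_zero hm) (h2 _ (mem_sp hm))
    (cden_pos (entries (C ++ [t]))) (l := entries (C ++ [t]))
    fun q hq => (divBy_cden q).mono (cden_dvd_of_mem hq)
  exact ⟨h3, fun c hc j => h4 _ (mem_entries hc j)⟩

theorem embEnv_ok {i : Ctx} {B C : List (Vec i.n)} {t : Vec i.n} (hB : sp B = ⊤) (hC : Indep C)
    (hl : C.length < i.n) (h0 : C ≠ []) (ht : t ∈ sp C) : EmbOk i.n (embEnv B C t) := by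
  obtain ⟨h1, h2⟩ := outer_spec hB hC hl
  refine ⟨hB, hC, ht, h1, h2, ?_⟩
  have h3 := (outerUnit_spec hB hC hl h0 t).1
  have h4 := outerBound_pos B C t
  have h5 := dot_self_pos h1
  rw [embEnv]; positivity

/-- The upper endpoint passes the test and the lower one is below the distance. The tolerance in
`embEnv` is chosen so that their squared heights differ by at most a quarter of the squared unit. -/
theorem height_spec {i : Ctx} {B C : List (Vec i.n)} {t : Vec i.n} (hB : sp B = ⊤) (hC : Indep C)
    (hl : C.length < i.n) (h0 : C ≠ []) (ht : t ∈ sp C) :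
    let p := outer B C
    let σ := height i B C t
    0 < σ ∧ moved i B C t p σ ⬝ᵥ moved i B C t p σ < 4 * (σ ^ 2 * (p ⬝ᵥ p)) ∧
      ∀ x ∈ latt C, σ ^ 2 * (p ⬝ᵥ p) ≤ (x - t) ⬝ᵥ (x - t) + outerUnit B C t ^ 2 / 4 := by
  intro p σ
  have hok := embEnv_ok hB hC hl h0 ht
  have hb := outerBound_pos B C t
  have hu := (outerUnit_spec hB hC hl h0 t).1
  have hP : 0 < p ⬝ᵥ p := dot_self_pos (outer_spec hB hC hl).1
  have hT := dot_self_nonneg t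
  -- The initial upper endpoint `1 + T / P`, with `T` and `P` the squared lengths of `t` and `p`,
  -- exceeds the distance to the lattice vector zero, again without a square root.
  obtain ⟨lo, hi, h1, h2, h3, h4, h5, h6, h7⟩ := search_spec hok hb (by
    show t ⬝ᵥ t < outerBound B C t ^ 2 * (p ⬝ᵥ p)
    rw [outerBound]
    have : (1 + (t ⬝ᵥ t) / (p ⬝ᵥ p)) ^ 2 * (p ⬝ᵥ p)
        = p ⬝ᵥ p + 2 * (t ⬝ᵥ t) + (t ⬝ᵥ t) * ((t ⬝ᵥ t) / (p ⬝ᵥ p)) := by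
      field_simp; ring
    rw [this]
    have : 0 ≤ (t ⬝ᵥ t) * ((t ⬝ᵥ t) / (p ⬝ᵥ p)) := by positivity
    linarith)
  have hσ : σ = hi := by show (search i _ _).2.2 = hi; rw [h1]
  rw [hσ]
  refine ⟨h2.trans_lt h3, h7, fun x hx => ?_⟩
  have h8 : lo ^ 2 * (p ⬝ᵥ p) ≤ (x - t) ⬝ᵥ (x - t) := h6 x hx
  have h9 : hi - lo ≤ outerUnit B C t * outerUnit B C t / (8 * (p ⬝ᵥ p) * outerBound B C t) := h5
  rw [le_div_iff₀ (by positivity)] at h9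
  -- The difference of squares is `(hi - lo) * (hi + lo)`, and both endpoints are at most
  -- `outerBound B C t`.
  have h10 : (hi - lo) * ((hi + lo) * (p ⬝ᵥ p))
      ≤ (hi - lo) * (2 * outerBound B C t * (p ⬝ᵥ p)) := by
    refine mul_le_mul_of_nonneg_left ?_ (by linarith)
    exact mul_le_mul_of_nonneg_right (by linarith) hP.le
  nlinarith

/-- Let `S` be the squared height. The short vector has squared length less than `4 * S`, hence
coefficient `k` in `{-1, 0, 1}`, and at most `2 * (δ + S)` for every `δ`, where `S ≤ δ` up to a
quarter of the squared unit. The case `k = 0` gives a short vector and `k = ±1` a close one. -/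
theorem embed_spec {i : Ctx} {B C : List (Vec i.n)} {t : Vec i.n} (hB : sp B = ⊤) (hC : Indep C)
    (hl : C.length < i.n) (h0 : C ≠ []) (ht : t ∈ sp C) :
    (embed i B C t).2 ∈ latt C ∧
    (((embed i B C t).1 = 0 ∧ (embed i B C t).2 ≠ 0 ∧ ∀ x ∈ latt C,
        (embed i B C t).2 ⬝ᵥ (embed i B C t).2 ≤ 4 * ((x - t) ⬝ᵥ (x - t))) ∨
      ((embed i B C t).1 = 1 ∧ ∀ x ∈ latt C,
        ((embed i B C t).2 - t) ⬝ᵥ ((embed i B C t).2 - t) ≤ 3 * ((x - t) ⬝ᵥ (x - t)))) := by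
  obtain ⟨hσ, hgood, hclose⟩ := height_spec hB hC hl h0 ht
  obtain ⟨hp, hpC⟩ := outer_spec hB hC hl
  obtain ⟨hu, hent⟩ := outerUnit_spec hB hC hl h0 t
  have hP := dot_self_pos hp
  rw [embed]
  generalize height i B C t = σ at *
  generalize outer B C = p at *
  generalize outerUnit B C t = g at *
  obtain ⟨x, hx, k, hv, hv0, hvp, hvv, hle⟩ := moved_spec hB hC ht hp hpC hσ
  generalize moved i B C t p σ = v at *
  have hS : 0 < σ ^ 2 * (p ⬝ᵥ p) := by positivity
  have hkk : (v ⬝ᵥ p) / (σ * (p ⬝ᵥ p)) = k := by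
    rw [hvp]; field_simp
  rw [hkk]
  have hnn := dot_self_nonneg (x + (k : ℚ) • t)
  -- The component along `p` alone contributes `k ^ 2 * S` to a squared length less than `4 * S`.
  have hk2 : (k : ℚ) ^ 2 < 4 := by
    by_contra h
    nlinarith
  have hk3 : k ^ 2 < 4 := by exact_mod_cast hk2
  have hk4 : -2 < k ∧ k < 2 := ⟨by nlinarith, by nlinarith⟩
  have hu2 : 0 < g ^ 2 := by positivity
  have hCg : ∀ {y}, y ∈ latt C → ∀ j, y j ∈ AddSubgroup.zmultiples g := fun {y} hy =>
    latt_coord_mem (fun c hc => hent c (by simp [hc])) hy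
  have htg : ∀ j, t j ∈ AddSubgroup.zmultiples g := hent t (by simp)
  have hyt : ∀ {y}, y ∈ latt C → (y - t) ⬝ᵥ (y - t) ∈ AddSubgroup.zmultiples (g ^ 2) :=
    fun {y} hy => dot_mem_zmultiples (fun j => sub_mem (hCg hy j) (htg j))
      (fun j => sub_mem (hCg hy j) (htg j))
  have hmul : ∀ (m : ℕ) {a : ℚ}, a ∈ AddSubgroup.zmultiples (g ^ 2) →
      (m : ℚ) * a ∈ AddSubgroup.zmultiples (g ^ 2) := fun m a ha => by
    rw [← nsmul_eq_mul]; exact nsmul_mem ha m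
  split_ifs with hk0
  · have hk1 : (k : ℚ) = 1 ∨ (k : ℚ) = -1 := by
      have : k ≠ 0 := fun h => by simp [h] at hk0
      have : k = 1 ∨ k = -1 := by omega
      rcases this with rfl | rfl <;> simp
    -- As `k * k = 1`, subtracting `k • v` removes `t + σ • p` whatever the sign of `k`.
    have hw : t + σ • p - (k : ℚ) • v = -((k : ℚ) • x) := by
      rw [hv]
      rcases hk1 with h | h <;> rw [h] <;> module
    have hmem : -((k : ℚ) • x) ∈ latt C := neg_mem (intCast_smul_mem k hx)
    have hk22 : (k : ℚ) ^ 2 = 1 := by rcases hk1 with h | h <;> rw [h] <;> norm_num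
    have hdist : (-((k : ℚ) • x) - t) ⬝ᵥ (-((k : ℚ) • x) - t)
        = (x + (k : ℚ) • t) ⬝ᵥ (x + (k : ℚ) • t) := by
      have : -((k : ℚ) • x) - t = (-(k : ℚ)) • (x + (k : ℚ) • t) := by
        rw [smul_add, smul_smul, neg_mul, ← sq, hk22]; module
      rw [this, smul_dotProduct, dotProduct_smul, smul_eq_mul, smul_eq_mul, ← mul_assoc,
        neg_mul_neg, ← sq, hk22, one_mul]
    refine ⟨hw ▸ hmem, Or.inr ⟨rfl, fun y hy => ?_⟩⟩
    rw [hw]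
    -- The squared distance plus `S` is at most `2 * (δ + S)`, so it is at most `2 * δ + S ≤ 3 * δ +
    -- g ^ 2 / 4`; the error is absorbed because both sides are multiples of `g ^ 2`.
    refine le_of_le_add (ε := g ^ 2 / 4) (by linarith) (hyt hmem) (hmul 3 (hyt hy)) ?_
    rw [hdist]
    have h1 := hle y hy
    have h2 := hclose y hy
    rw [hvv, hk22] at h1
    linarith
  · have hk1 : (k : ℚ) = 0 := by
      by_contra h
      exact hk0 (mul_self_pos.2 h)
    have hvx : v = x := by rw [hv, hk1]; simp
    refine ⟨hvx ▸ hx, Or.inl ⟨rfl, hv0, fun y hy => ?_⟩⟩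
    -- Here the squared length is at most `2 * δ + 2 * S`, so the error of `S` enters twice.
    refine le_of_le_add (ε := g ^ 2 / 2) (by linarith)
      (dot_mem_zmultiples (hCg (hvx ▸ hx)) (hCg (hvx ▸ hx))) (hmul 4 (hyt hy)) ?_
    have h1 := hle y hy
    have h2 := hclose y hy
    push_cast
    linarith

/-! ### Polynomial cost of the embedding technique -/

namespace Cmp
variable {α : Ctx → Type} [∀ i, Enc (α i)] {S : ∀ i, α i → Prop}

theorem ofFn {x : ∀ i, α i → Vec i.n} (hx : Cmp S x) : Cmp S (fun i a => List.ofFn (x i a)) :=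
  hx.congr_enc fun _ _ _ => enc_vec _

theorem entries {C : ∀ i, α i → List (Vec i.n)} (hC : Cmp S C) :
    Cmp S (fun i a => entries (C i a)) := by
  obtain ⟨b, hb, hs⟩ := hC.sz_le
  exact foldl (ε := fun _ => ℚ) (β := fun _ => List ℚ) (γ := fun i => Vec i.n)
    (F := fun i s => s.2.1 ++ List.ofFn s.2.2) (Q := fun _ _ => True)
    (append (fst (snd ident)) (ofFn (snd (snd ident)))) (const 0) nil hC
    (fun _ _ _ _ _ _ _ => trivial) b hb fun i a ha l₁ l₂ h => by
      refine (sz_entries_le l₁).trans (le_trans ?_ (hs i a ha))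
      have h2 := sz_append l₁ l₂
      have h3 : 2 ≤ sz l₂ := by rw [sz_list]; omega
      rw [h]; omega

theorem unit {p c : ∀ i, α i → Vec i.n} {l : ∀ i, α i → List ℚ} (hp : Cmp S p) (hc : Cmp S c)
    (hl : Cmp S l) (h : ∀ i a, S i a → p i a ≠ 0 ∧ c i a ≠ 0 ∧ p i a ⬝ᵥ c i a = 0) :
    Cmp S (fun i a => unit (p i a) (c i a) (l i a)) := by
  obtain ⟨b, hb, hs⟩ := hl.sz_le
  have hspec : ∀ i a, S i a → ∀ l₁ l₂, l i a = l₁ ++ l₂ →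
      0 < LatticeProblems.unit (p i a) (c i a) l₁ ∧
        sz (LatticeProblems.unit (p i a) (c i a) l₁) ≤ 2 * b (sz a) + 1 + 3 := by
    intro i a ha l₁ l₂ hl₁
    obtain ⟨h1, h2, h3⟩ := h i a ha
    obtain ⟨u1, u2, u3, -⟩ := unit_spec h1 h2 h3 (cden_pos (l i a)) (l := l₁) fun q hq =>
      (divBy_cden q).mono (cden_dvd_of_mem (by rw [hl₁]; simp [hq]))
    refine ⟨u1, sz_rat_le (cden_pos _) ((cden_le (l i a)).trans
      (Nat.pow_le_pow_right (by norm_num) (hs i a ha))) u3 ?_⟩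
    rw [abs_of_pos u1, pow_one]
    linarith
  have hF : Cmp (α := fun i => (Vec i.n × Vec i.n) × (ℚ × ℚ)) (fun _ s => 0 < s.2.1)
      (fun _ s => gcdStep s.1.1 s.1.2 s.2.1 s.2.2) :=
    fst (fst (op_euclid.comp (((snd (snd ident)).pair (fst (fst ident))).pair
      ((fst (snd ident)).pair (snd (fst ident)))) fun i a h => h))
  have hQ : ∀ i a, S i a → ∀ (l₁ : List ℚ) x l₂, l i a = l₁ ++ x :: l₂ →
      0 < l₁.foldl (fun g q => gcdStep (p i a) (c i a) g q) 1 :=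
    fun i a ha l₁ x l₂ hh => (hspec i a ha l₁ _ hh).1
  have hsz : ∀ i a, S i a → ∀ (l₁ l₂ : List ℚ), l i a = l₁ ++ l₂ →
      sz (l₁.foldl (fun g q => gcdStep (p i a) (c i a) g q) 1) ≤ 2 * b (sz a) + 1 + 3 :=
    fun i a ha l₁ l₂ hh => (hspec i a ha l₁ _ hh).2
  have := foldl hF (hp.pair hc) (const 1) hl hQ (fun s => 2 * b s + 1 + 3)
    ((((PB.const 2).mul hb).add (PB.const 1)).add (PB.const 3)) hsz
  exact this

theorem moved {B C : ∀ i, α i → List (Vec i.n)} {t p : ∀ i, α i → Vec i.n} {σ : ∀ i, α i → ℚ}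
    (hB : Cmp S B) (hC : Cmp S C) (ht : Cmp S t) (hp : Cmp S p) (hσ : Cmp S σ)
    (h : ∀ i a, S i a → sp (B i a) = ⊤ ∧ Indep (C i a) ∧ t i a ∈ sp (C i a) ∧ p i a ≠ 0 ∧
      (∀ x ∈ sp (C i a), p i a ⬝ᵥ x = 0) ∧ 0 < σ i a) :
    Cmp S (fun i a => moved i (B i a) (C i a) (t i a) (p i a) (σ i a)) :=
  svp hB (append hC (cons (vadd ht (smul hσ hp)) nil)) fun i a ha => by
    obtain ⟨h1, h2, h3, h4, h5, h6⟩ := h i a ha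
    exact ⟨h1, indep_moved h2 h3 h4 h5 h6, by simp⟩

theorem search {e : ∀ i, α i → EmbEnv i.n} {h : ∀ i, α i → ℚ} (he : Cmp S e) (hh : Cmp S h)
    (hok : ∀ i a, S i a → EmbOk i.n (e i a) ∧ 0 < h i a) :
    Cmp S (fun i a => search i (e i a) (h i a)) := by
  let I : ∀ i, EmbState i → Prop := fun i s => EmbOk i.n s.1 ∧ 0 ≤ s.2.1 ∧ s.2.1 < s.2.2
  have hmid : ∀ {S : ∀ i, EmbState i → Prop}, Cmp (α := EmbState) S (fun _ s => (s.2.1 + s.2.2) / 2) :=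
    div (add (fst (snd ident)) (snd (snd ident))) (const 2)
  have hp : ∀ {S : ∀ i, EmbState i → Prop}, Cmp (α := EmbState) S (fun _ s => s.1.2.2.2.1) :=
    fst (snd (snd (snd (fst ident))))
  have hmv : Cmp (α := EmbState) (fun i s => I i s ∧ 0 < embTest s)
      (fun i s => LatticeProblems.moved i s.1.1 s.1.2.1 s.1.2.2.1 s.1.2.2.2.1
        ((s.2.1 + s.2.2) / 2)) :=
    moved (fst (fst ident)) (fst (snd (fst ident))) (fst (snd (snd (fst ident)))) hp hmid
      fun i s ⟨⟨hs, h1, h2⟩, _⟩ =>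
        ⟨hs.top, hs.indep, hs.mem, hs.ne, hs.orth, by linarith⟩
  have hstep : Cmp (α := EmbState) (fun i s => I i s ∧ 0 < embTest s) (fun i s => embStep i s) :=
    ite' (sub (mul (const 4) (mul (mul hmid hmid) (dot hp hp))) (dot hmv hmv))
      ((fst ident).pair ((fst (snd ident)).pair hmid))
      ((fst ident).pair (hmid.pair (snd (snd ident))))
  refine (Cmp.loop (α := EmbState) (c := fun _ s => embTest s) (f := embStep) (I := I)
    (S := fun i s => EmbOk i.n s.1 ∧ s.2.1 = 0 ∧ 0 < s.2.2)
    (sub (sub (snd (snd ident)) (fst (snd ident))) (snd (snd (snd (snd (fst ident)))))) hstep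
    (fun i s hs => ⟨hs.1, hs.2.1.ge, by rw [hs.2.1]; exact hs.2.2⟩) ?_ (fun s => s)
    (fun s => 1 + s + (1 + (2 * (2 * s) + s + 3) + (2 * (2 * s) + s + 3))) PB.id
    (((PB.const 1).add PB.id).add (((PB.const 1).add ((((PB.const 2).mul ((PB.const 2).mul
      PB.id)).add PB.id).add (PB.const 3))).add ((((PB.const 2).mul ((PB.const 2).mul
      PB.id)).add PB.id).add (PB.const 3)))) ?_ ?_).comp (he.pair ((const 0).pair hh))
      fun i a ha => ⟨(hok i a ha).1, rfl, (hok i a ha).2⟩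
  · rintro i ⟨e, lo, hi⟩ ⟨h1, h2, h3⟩ -
    dsimp only at h1 h2 h3
    rw [embStep]
    dsimp only
    split_ifs
    · exact ⟨h1, h2, by dsimp only; linarith⟩
    · exact ⟨h1, by dsimp only; linarith, by dsimp only; linarith⟩
  · rintro i ⟨e, lo, hi⟩ ⟨h1, h2, h3⟩
    dsimp only at h1 h2 h3
    subst h2
    exact ⟨_, le_rfl, embTest_stop h1.pos (by simp only [sz_prod]; omega)⟩
  · rintro i ⟨e, lo, hi⟩ ⟨h1, h2, h3⟩ k hk
    dsimp only at h1 h2 h3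
    subst h2
    -- The test fails by round `sz hi + sz e` at the latest, which bounds the power of two in the
    -- denominators of the endpoints.
    have hkN : k ≤ sz hi + sz e := by
      by_contra hlt
      exact embTest_stop h1.pos le_rfl (hk _ (not_le.1 hlt))
    obtain ⟨a, ha, hs⟩ := embStep_iterate i e hi k
    rw [hs]
    have hsz : sz (e, ((0 : ℚ), hi)) = 1 + sz e + (1 + sz (0 : ℚ) + sz hi) := rfl
    set s := sz (e, ((0 : ℚ), hi)) with hs_def
    have hbd : ∀ m : ℕ, m ≤ 2 ^ k → sz (hi * m / 2 ^ k) ≤ 2 * (2 * s) + s + 3 := by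
      intro m hm
      refine sz_rat_le (D := cden hi * 2 ^ k) (Nat.mul_pos (cden_pos _) (by positivity)) ?_ ?_ ?_
      · rw [two_mul s, pow_add]
        exact Nat.mul_le_mul ((cden_le hi).trans (Nat.pow_le_pow_right (by norm_num) (by omega)))
          (Nat.pow_le_pow_right (by norm_num) (by omega))
      · obtain ⟨z, hz⟩ := divBy_cden hi
        refine ⟨z * m, ?_⟩
        push_cast
        rw [← hz]
        field_simp
      · rw [abs_of_nonneg (by positivity), div_le_iff₀ (by positivity)]
        have h4 := (le_abs_self hi).trans (abs_lt_two_pow_sz hi).le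
        have h5 : (2 : ℚ) ^ sz hi ≤ 2 ^ s := pow_le_pow_right₀ (by norm_num) (by omega)
        have h6 : (m : ℚ) ≤ 2 ^ k := by exact_mod_cast hm
        exact mul_le_mul (h4.trans h5) h6 (by positivity) (by positivity)
    have b1 := hbd a (by omega)
    have b2 := hbd (a + 1) ha
    simp only [sz_prod] at hs_def ⊢
    omega

section
variable {B C : ∀ i, α i → List (Vec i.n)} {t : ∀ i, α i → Vec i.n}

theorem outer (hB : Cmp S B) (hC : Cmp S C)
    (h : ∀ i a, S i a → sp (B i a) = ⊤ ∧ Indep (C i a) ∧ (C i a).length < i.n) :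
    Cmp S (fun i a => outer (B i a) (C i a)) :=
  headI (compl hC hB) fun i a ha h0 => by
    have := length_compl (h i a ha).2.1 (h i a ha).1
    have := (h i a ha).2.2
    rw [h0, List.length_nil] at *
    omega

theorem outerBound (hB : Cmp S B) (hC : Cmp S C) (ht : Cmp S t)
    (h : ∀ i a, S i a → sp (B i a) = ⊤ ∧ Indep (C i a) ∧ (C i a).length < i.n) :
    Cmp S (fun i a => outerBound (B i a) (C i a) (t i a)) :=
  add (const 1) (div (dot ht ht) (dot (outer hB hC h) (outer hB hC h)))

theorem outerUnit (hB : Cmp S B) (hC : Cmp S C) (ht : Cmp S t)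
    (h : ∀ i a, S i a → sp (B i a) = ⊤ ∧ Indep (C i a) ∧ (C i a).length < i.n)
    (h0 : ∀ i a, S i a → C i a ≠ []) :
    Cmp S (fun i a => outerUnit (B i a) (C i a) (t i a)) :=
  unit (outer hB hC h) (headI hC h0) (entries (append hC (cons ht nil))) fun i a ha => by
    obtain ⟨h1, h2, h3⟩ := h i a ha
    obtain ⟨h4, h5⟩ := outer_spec h1 h2 h3
    have h6 := headI_mem (h0 i a ha)
    exact ⟨h4, h2.ne_zero h6, h5 _ (mem_sp h6)⟩

theorem height (hB : Cmp S B) (hC : Cmp S C) (ht : Cmp S t)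
    (h : ∀ i a, S i a → sp (B i a) = ⊤ ∧ Indep (C i a) ∧ (C i a).length < i.n)
    (h0 : ∀ i a, S i a → C i a ≠ []) (h1 : ∀ i a, S i a → t i a ∈ sp (C i a)) :
    Cmp S (fun i a => height i (B i a) (C i a) (t i a)) := by
  have hp := outer hB hC h
  have hb := outerBound hB hC ht h
  have hu := outerUnit hB hC ht h h0
  exact snd (snd (search (hB.pair (hC.pair (ht.pair (hp.pair
    (div (mul hu hu) (mul (mul (const 8) (dot hp hp)) hb)))))) hb fun i a ha =>
      ⟨embEnv_ok (h i a ha).1 (h i a ha).2.1 (h i a ha).2.2 (h0 i a ha) (h1 i a ha),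
        outerBound_pos _ _ _⟩))

theorem embed (hB : Cmp S B) (hC : Cmp S C) (ht : Cmp S t)
    (h : ∀ i a, S i a → sp (B i a) = ⊤ ∧ Indep (C i a) ∧ (C i a).length < i.n)
    (h0 : ∀ i a, S i a → C i a ≠ []) (h1 : ∀ i a, S i a → t i a ∈ sp (C i a)) :
    Cmp S (fun i a => embed i (B i a) (C i a) (t i a)) := by
  have hp := outer hB hC h
  have hσ := height hB hC ht h h0 h1
  have hv := moved hB hC ht hp hσ fun i a ha => by
    obtain ⟨h2, h3, h4⟩ := h i a ha
    obtain ⟨h5, h6⟩ := outer_spec h2 h3 h4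
    exact ⟨h2, h3, h1 i a ha, h5, h6, (height_spec h2 h3 h4 (h0 i a ha) (h1 i a ha)).1⟩
  have hk := div (dot hv hp) (mul hσ (dot hp hp))
  exact ite' (mul hk hk) ((const 1).pair (vsub (vadd ht (smul hσ hp)) (smul hk hv)))
    ((const 0).pair hv)

end

end Cmp

/-! ## Size reduction of a list of vectors -/

section
variable {n : ℕ}

theorem gso_sum_le {K : ℚ} {C : List (Vec n)} (h : ∀ u ∈ gso C, u ⬝ᵥ u ≤ K) :
    ((gso C).map fun u => u ⬝ᵥ u).sum ≤ C.length * K := by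
  have := List.sum_le_card_nsmul ((gso C).map fun u => u ⬝ᵥ u) K (by simpa using h)
  rwa [List.length_map, gso_length, nsmul_eq_mul] at this

theorem prj_np (C : List (Vec n)) (x : Vec n) : prj C (np C x) = prj C x := by
  have h := prj_eq_zero.2 (latt_le_sp C (sub_np_mem C x))
  rw [prj_sub, sub_eq_zero] at h
  exact h.symm

theorem Near.np {K : ℚ} {C : List (Vec n)} {x : Vec n} (h : Near K (sp C) x) :
    Near K (sp C) (np C x) :=
  near_of_prj_le (by rw [prj_np]; exact h.prj_le)

theorem np_norm_le_of {K : ℚ} (hK : 0 ≤ K) {C : List (Vec n)} {x : Vec n} (hC : GoodL K ⊥ C)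
    (h : Near K (sp C) x) : np C x ⬝ᵥ np C x ≤ (1 + C.length) * K := by
  have h1 := np_norm_le C x
  have h2 := h.prj_le
  have h3 := gso_sum_le (goodL_gso hC)
  have : 0 ≤ C.length * K := by positivity
  linarith

theorem latt_append_np (C : List (Vec n)) (x : Vec n) : latt (C ++ [np C x]) = latt (C ++ [x]) := by
  have h := sub_np_mem C x
  apply le_antisymm
  · refine latt_le.2 fun y hy => ?_
    rcases List.mem_append.1 hy with hy | hy
    · exact mem_latt (by simp [hy])
    · rw [List.mem_singleton.1 hy, latt_append]
      have h2 := sub_mem (Submodule.mem_sup_right (mem_latt (List.mem_singleton_self x)))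
        (Submodule.mem_sup_left h : _ ∈ latt C ⊔ latt [x])
      rwa [sub_sub_cancel] at h2
  · refine latt_le.2 fun y hy => ?_
    rcases List.mem_append.1 hy with hy | hy
    · exact mem_latt (by simp [hy])
    · rw [List.mem_singleton.1 hy, latt_append]
      have h2 := add_mem (Submodule.mem_sup_left h : _ ∈ latt C ⊔ latt [np C x])
        (Submodule.mem_sup_right (mem_latt (List.mem_singleton_self (np C x))))
      rwa [sub_add_cancel] at h2

/-- Reduce the vectors of `F` in turn modulo `V` and the preceding ones. -/
def reduce (V F : List (Vec n)) : List (Vec n) :=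
  F.foldl (fun acc f => acc ++ [np (V ++ acc) f]) []

theorem reduce_append_singleton (V F : List (Vec n)) (f : Vec n) :
    reduce V (F ++ [f]) = reduce V F ++ [np (V ++ reduce V F) f] := by
  simp [reduce]

theorem length_reduce (V F : List (Vec n)) : (reduce V F).length = F.length := by
  induction F using List.reverseRecOn with
  | nil => rfl
  | append_singleton F f ih => rw [reduce_append_singleton]; simp [ih]

theorem latt_reduce (V F : List (Vec n)) : latt (V ++ reduce V F) = latt (V ++ F) := by
  induction F using List.reverseRecOn with
  | nil => rfl
  | append_singleton F f ih =>
    rw [reduce_append_singleton, ← List.append_assoc, latt_append_np, ← List.append_assoc,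
      latt_append, ih, ← latt_append]

/-- Subtracting combinations of preceding vectors does not affect Gram–Schmidt norms, while the
reduced vectors become as short as these norms allow. Repeated insertions thus keep lengths below
one fixed bound. -/
theorem reduce_good {K : ℚ} (hK : 0 ≤ K) {V F : List (Vec n)} (h : GoodL K ⊥ (V ++ F)) :
    GoodL K ⊥ (V ++ reduce V F) ∧
      ∀ c ∈ reduce V F, c ⬝ᵥ c ≤ (1 + (V ++ F).length) * K := by
  induction F using List.reverseRecOn with
  | nil => exact ⟨h, by simp [reduce]⟩
  | append_singleton F f ih =>
    rw [← List.append_assoc, goodL_append] at h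
    obtain ⟨h1, h2⟩ := ih h.1
    have hsp := sp_eq_of_latt_eq (latt_reduce V F)
    have hf : Near K (sp (V ++ reduce V F)) f := by
      have := h.2.1
      rwa [bot_sup_eq, ← hsp] at this
    rw [reduce_append_singleton, ← List.append_assoc]
    refine ⟨goodL_append.2 ⟨h1, ?_, trivial⟩, fun c hc => ?_⟩
    · rw [bot_sup_eq]; exact hf.np
    · rcases List.mem_append.1 hc with hc | hc
      · refine (h2 c hc).trans (mul_le_mul_of_nonneg_right ?_ hK)
        simp
      · rw [List.mem_singleton.1 hc]
        refine (np_norm_le_of hK h1 hf).trans (mul_le_mul_of_nonneg_right ?_ hK)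
        simp [length_reduce]

/-- The size of a list of short vectors with a common denominator. -/
theorem sz_short_le {C : List (Vec n)} {D s m : ℕ} (hD : 0 < D) (hDs : D ≤ 2 ^ s) (hn : n ≤ s)
    (hl : C.length ≤ s) (hd : ∀ c ∈ C, ∀ j, DivBy D (c j)) (hm : ∀ c ∈ C, c ⬝ᵥ c ≤ 2 ^ m) :
    sz C ≤ 2 + s * (1 + (2 + s * (1 + (2 * s + m + 3)))) := by
  refine (sz_list_le C (2 + s * (1 + (2 * s + m + 3))) fun c hc => ?_).trans
    (Nat.add_le_add_left (Nat.mul_le_mul_right _ hl) _)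
  refine (sz_vec_le_of hD hDs (hd c hc) fun j => ?_).trans
    (Nat.add_le_add_left (Nat.mul_le_mul_right _ hn) _)
  refine abs_le_of_sq_le_sq ((sq_coord_le c j).trans ((hm c hc).trans ?_)) (by positivity)
  rw [← pow_mul]
  exact pow_le_pow_right₀ (by norm_num) (by omega)

theorem pb_short {m : ℕ → ℕ} (hm : PB m) :
    PB fun s => 2 + s * (1 + (2 + s * (1 + (2 * s + m s + 3)))) :=
  (PB.const 2).add (PB.id.mul ((PB.const 1).add ((PB.const 2).add (PB.id.mul ((PB.const 1).add
    ((((PB.const 2).mul PB.id).add hm).add (PB.const 3)))))))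

theorem dot_self_le_pow (x : Vec n) : x ⬝ᵥ x ≤ 2 ^ (3 * sz x) := by
  have h := (le_abs_self _).trans (abs_dot_le (abs_coord_le x) (abs_coord_le x))
  have h1 : (n : ℚ) ≤ 2 ^ sz x :=
    (nat_cast_le_two_pow n).trans (pow_le_pow_right₀ (by norm_num) (dim_le_sz x))
  calc x ⬝ᵥ x ≤ n * (2 ^ sz x * 2 ^ sz x) := h
    _ ≤ 2 ^ sz x * (2 ^ sz x * 2 ^ sz x) := by gcongr
    _ = 2 ^ (3 * sz x) := by ring

theorem sz_reduce_le (V F : List (Vec n)) :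
    let s := sz V + sz F
    sz (reduce V F) ≤ 2 + s * (1 + (2 + s * (1 + (2 * s + (4 * s) + 3)))) := by
  intro s
  rcases F.eq_nil_or_concat with rfl | ⟨F', f', hF'⟩
  · rw [reduce, List.foldl_nil, sz_nil]; omega
  have hf' : f' ∈ F := by rw [hF']; simp
  have hn : n ≤ s := (dim_le_sz f').trans ((sz_le_of_mem hf').trans (by omega))
  have hA := sz_append V F
  have hmem : ∀ c ∈ V ++ F, sz c ≤ s := fun c hc => (sz_le_of_mem hc).trans (by omega)
  have hlen : F.length ≤ s := (length_le_sz F).trans (by omega)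
  have hlen' : (V ++ F).length + 1 ≤ s := by
    have := length_le_sz (V ++ F)
    omega
  have hK : (0 : ℚ) ≤ 2 ^ (3 * s) := by positivity
  obtain ⟨-, h2⟩ := reduce_good hK (V := V) (F := F) (goodL_of_norm fun c hc =>
    (dot_self_le_pow c).trans (pow_le_pow_right₀ (by norm_num) (by have := hmem c hc; omega)))
  refine sz_short_le (cden_pos (V ++ F)) ((cden_le _).trans
    (Nat.pow_le_pow_right (by norm_num) (by omega))) hn (by rw [length_reduce]; exact hlen)
    (fun c hc j => divBy_latt (C := V ++ F) (fun x hx j => (divBy_cden_vec x j).mono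
      (cden_dvd_of_mem hx)) (by rw [← latt_reduce]; exact mem_latt (by simp [hc])) j) fun c hc => ?_
  refine (h2 c hc).trans ?_
  have h3 : (1 + (V ++ F).length : ℚ) ≤ 2 ^ s := by
    refine le_trans ?_ (nat_cast_le_two_pow s)
    have : 1 + (V ++ F).length ≤ s := by omega
    exact_mod_cast this
  calc (1 + (V ++ F).length : ℚ) * 2 ^ (3 * s) ≤ 2 ^ s * 2 ^ (3 * s) := by gcongr
    _ = 2 ^ (4 * s) := by ring

end

theorem Cmp.reduce {α : Ctx → Type} [∀ i, Enc (α i)] {S : ∀ i, α i → Prop}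
    {V F : ∀ i, α i → List (Vec i.n)} (hV : Cmp S V) (hF : Cmp S F) :
    Cmp S (fun i a => reduce (V i a) (F i a)) := by
  obtain ⟨b, hb, hs⟩ := hV.sz_le
  obtain ⟨b', hb', hs'⟩ := hF.sz_le
  have hpb := (pb_short ((PB.const 4).mul PB.id)).comp (hb.add hb')
  refine foldl (ε := fun i => List (Vec i.n)) (β := fun i => List (Vec i.n))
    (γ := fun i => Vec i.n) (Q := fun _ _ => True)
    (F := fun _ s => s.2.1 ++ [LatticeProblems.np (s.1 ++ s.2.1) s.2.2])
    (append (fst (snd ident)) (cons (np (append (fst ident) (fst (snd ident)))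
      (snd (snd ident))) nil)) hV nil hF (fun _ _ _ _ _ _ _ => trivial) _ hpb ?_
  intro i a ha l₁ l₂ h
  refine (sz_reduce_le (V i a) l₁).trans ((pb_short ((PB.const 4).mul PB.id)).1 ?_)
  have h2 := sz_append l₁ l₂
  have h3 : 2 ≤ sz l₂ := by rw [sz_list]; omega
  have h4 := hs i a ha
  have h5 := hs' i a ha
  rw [h] at h5
  omega

/-! ## Closest vector solvers -/

/-- Instances: a list spanning the space, a basis of a lattice, and a target. -/
abbrev Inst (i : Ctx) : Type := List (Vec i.n) × (List (Vec i.n) × Vec i.n)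

/-- The instances whose dimension and rank are in a given relation. -/
structure Dom (R : ℕ → ℕ → Prop) (i : Ctx) (a : Inst i) : Prop where
  top : sp a.1 = ⊤
  indep : Indep a.2.1
  mem : a.2.2 ∈ sp a.2.1
  rank : R i.n a.2.1.length

/-- An efficient algorithm finding lattice vectors whose distance from the target is within the
square root of the rank from the optimum. -/
structure Solver (R : ℕ → ℕ → Prop) (A : ∀ i, Inst i → Vec i.n) : Prop where
  cmp : Cmp (Dom R) A
  mem : ∀ i a, Dom R i a → A i a ∈ latt a.2.1
  close : ∀ i a, Dom R i a → ∀ x ∈ latt a.2.1,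
    (A i a - a.2.2) ⬝ᵥ (A i a - a.2.2) ≤ a.2.1.length * ((x - a.2.2) ⬝ᵥ (x - a.2.2))

theorem exists_stop_nat {σ : Type} {c I : σ → Prop} {f : σ → σ} (hI : ∀ a, I a → c a → I (f a))
    (μ : σ → ℕ) (hμ : ∀ a, I a → c a → μ (f a) < μ a) {a : σ} (ha : I a) :
    ∃ k ≤ μ a, ¬ c (f^[k] a) := by
  generalize hN : μ a = N
  induction N using Nat.strong_induction_on generalizing a with
  | _ N ih =>
    by_cases hc : c a
    · obtain ⟨k, hk, hk'⟩ := ih (μ (f a)) (hN ▸ hμ a ha hc) (hI a ha hc) rfl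
      have := hμ a ha hc
      exact ⟨k + 1, by omega, by rwa [Function.iterate_succ_apply]⟩
    · exact ⟨0, by omega, hc⟩

/-! ## Lattices of less than full rank -/

/-- Spanning list and target; inserted vectors, remaining vectors, and a close vector if already
found. -/
abbrev LState (i : Ctx) : Type := (List (Vec i.n) × Vec i.n) × (List (Vec i.n) × (List (Vec i.n) × Vec i.n))

/-- The result of the embedding after projecting to the complement of the inserted vectors. -/
def levelEmbed (i : Ctx) (s : LState i) : ℚ × Vec i.n :=
  embed i s.1.1 (s.2.2.1.map (prj s.2.1)) (prj s.2.1 s.1.2)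

/-- Insertion of a short projected vector into the remaining vectors. -/
def levelIns (i : Ctx) (s : LState i) : (ℚ × Vec i.n) × List (Vec i.n) :=
  ins (coefs s.2.1 s.2.2.1 (levelEmbed i s).2) s.1.2

/-- The inserted vectors after one more insertion. -/
def levelNew (i : Ctx) (s : LState i) : List (Vec i.n) :=
  s.2.1 ++ [np s.2.1 (levelIns i s).1.2]

/-- Insert a short vector or find a close vector. -/
def levelStep (i : Ctx) (s : LState i) : LState i :=
  if 0 < (levelEmbed i s).1 then (s.1, (s.2.1, ([], lift s.2.1 s.2.2.1 (levelEmbed i s).2)))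
  else (s.1, (levelNew i s, (reduce (levelNew i s) (levelIns i s).2, s.2.2.2)))

/-- Whether at least three vectors remain. -/
def levelTest {i : Ctx} (s : LState i) : ℚ := if s.2.2.1.tail.tail = [] then 0 else 1

theorem levelTest_pos {i : Ctx} {s : LState i} : 0 < levelTest s ↔ 3 ≤ s.2.2.1.length := by
  rw [levelTest]
  rcases s.2.2.1 with _ | ⟨a, _ | ⟨b, _ | ⟨c, l⟩⟩⟩ <;> simp

/-- More vectors have to be inserted. -/
structure Live {i : Ctx} (C₀ : List (Vec i.n)) (K : ℚ) (s : LState i) : Prop where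
  ne : s.2.2.1 ≠ []
  latt_eq : latt (s.2.1 ++ s.2.2.1) = latt C₀
  length_eq : (s.2.1 ++ s.2.2.1).length = C₀.length
  zero : s.2.2.2 = 0
  good : GoodL K ⊥ (s.2.1 ++ s.2.2.1)
  norm : ∀ c ∈ s.2.1 ++ s.2.2.1, c ⬝ᵥ c ≤ (1 + C₀.length) * K

/-- A vector close to the target modulo the inserted vectors has been found. -/
structure Found {i : Ctx} (C₀ : List (Vec i.n)) (t : Vec i.n) (s : LState i) : Prop where
  nil : s.2.2.1 = []
  le : latt s.2.1 ≤ latt C₀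
  mem : s.2.2.2 ∈ latt C₀
  close : ∀ x ∈ latt C₀, prj s.2.1 (s.2.2.2 - t) ⬝ᵥ prj s.2.1 (s.2.2.2 - t)
    ≤ (C₀.length - s.2.1.length) * ((x - t) ⬝ᵥ (x - t))

/-- The loop invariant. -/
structure LInv {i : Ctx} (B C₀ : List (Vec i.n)) (t : Vec i.n) (K : ℚ) (s : LState i) : Prop where
  env : s.1 = (B, t)
  short : ∀ u ∈ gso s.2.1, ∀ x ∈ latt C₀, u ⬝ᵥ u ≤ 4 * ((x - t) ⬝ᵥ (x - t))
  cases : Live C₀ K s ∨ Found C₀ t s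

section
variable {i : Ctx} {B C₀ : List (Vec i.n)} {t : Vec i.n} {K : ℚ} {s : LState i}

theorem Live.indep (hC : Indep C₀) (h : Live C₀ K s) : Indep (s.2.1 ++ s.2.2.1) :=
  indep_of_sp_eq hC (sp_eq_of_latt_eq h.latt_eq).symm h.length_eq.symm

theorem Live.embed_spec (hB : sp B = ⊤) (hC : Indep C₀) (ht : t ∈ sp C₀) (hn : C₀.length < i.n)
    (henv : s.1 = (B, t)) (h : Live C₀ K s) :
    sp s.1.1 = ⊤ ∧ Indep (s.2.2.1.map (prj s.2.1)) ∧ (s.2.2.1.map (prj s.2.1)).length < i.n ∧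
      s.2.2.1.map (prj s.2.1) ≠ [] ∧ prj s.2.1 s.1.2 ∈ sp (s.2.2.1.map (prj s.2.1)) := by
  have hl := h.length_eq
  rw [List.length_append] at hl
  refine ⟨by rw [henv]; exact hB, (h.indep hC).map_prj, by rw [List.length_map]; omega,
    by simpa using h.ne, prj_mem_sp_map ?_⟩
  rw [henv, sp_eq_of_latt_eq h.latt_eq]
  exact ht

/-- Projection does not increase distances, so guarantees relative to the projected lattice carry
over to the original one. -/
theorem Live.dist_le (h : Live C₀ K s) {x : Vec i.n} (hx : x ∈ latt C₀) (t : Vec i.n) :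
    prj s.2.1 x ∈ latt (s.2.2.1.map (prj s.2.1)) ∧
      (prj s.2.1 x - prj s.2.1 t) ⬝ᵥ (prj s.2.1 x - prj s.2.1 t) ≤ (x - t) ⬝ᵥ (x - t) := by
  rw [← h.latt_eq] at hx
  exact ⟨prj_mem_latt_map hx, by rw [← prj_sub]; exact prj_norm_le_self _ _⟩

/-- A short projected vector is lifted and inserted, which adds one Gram–Schmidt vector of squared
length at most `4 * δ` and removes one remaining vector. A close projected vector ends the loop,
with the empty list of remaining vectors as the signal. -/
theorem lInv_step (hB : sp B = ⊤) (hC : Indep C₀) (ht : t ∈ sp C₀) (hn : C₀.length < i.n)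
    (hK : 4 * (t ⬝ᵥ t) ≤ K) (hs : LInv B C₀ t K s) (hc : 0 < levelTest s) :
    LInv B C₀ t K (levelStep i s) ∧ (levelStep i s).2.2.1.length < s.2.2.1.length := by
  obtain ⟨henv, hshort, hcases⟩ := hs
  rw [levelTest_pos] at hc
  have hlive : Live C₀ K s := hcases.resolve_right fun h => by
    rw [h.nil, List.length_nil] at hc; omega
  obtain ⟨e1, e2, e3, e4, e5⟩ := hlive.embed_spec hB hC ht hn henv
  obtain ⟨hmem, hopt⟩ := embed_spec e1 e2 e3 e4 e5
  rw [← levelEmbed] at hmem hopt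
  have hi := hlive.indep hC
  have hst : s.1.2 = t := by rw [henv]
  rw [levelStep]
  rcases hopt with ⟨hflag, hv0, hle⟩ | ⟨hflag, hle⟩
  · rw [hflag, if_neg (lt_irrefl _)]
    have hK0 : 0 ≤ K := le_trans (by have := dot_self_nonneg t; positivity) hK
    have hint := coefs_int e2 hmem
    have hspec := ins_spec one_pos (coefs s.2.1 s.2.2.1 (levelEmbed i s).2) s.1.2
      (fun p hp => by simpa using hint p hp)
    rw [← levelIns] at hspec
    have hcomb := hspec.comb
    rw [← lift_eq] at hcomb
    have hpl := prj_lift e2 (latt_le_sp _ hmem)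
    rw [← hcomb, prj_smul] at hpl
    -- The lift is `g • e` with an integer `g`, nonzero because the projected vector is; hence `g ≥
    -- 1` and the projection of `e` is no longer than the vector found.
    have hg0 : 0 < (levelIns i s).1.1 := hspec.nonneg.lt_of_ne' fun h => hv0 (by
      rw [h, zero_smul] at hpl; exact hpl.symm)
    have hg1 : 1 ≤ (levelIns i s).1.1 := unit_le one_pos hg0 hspec.int
    obtain ⟨hlatt, hlen⟩ := hspec.pos hg0
    have hfst : (coefs s.2.1 s.2.2.1 (levelEmbed i s).2).map Prod.fst = s.2.2.1 := by
      rw [coefs, List.map_map]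
      exact List.map_id _
    rw [hfst] at hlatt
    rw [coefs, List.length_map] at hlen
    have hnorm : prj s.2.1 (levelIns i s).1.2 ⬝ᵥ prj s.2.1 (levelIns i s).1.2
        ≤ (levelEmbed i s).2 ⬝ᵥ (levelEmbed i s).2 := by
      rw [← hpl, smul_dotProduct, dotProduct_smul, smul_eq_mul, smul_eq_mul, ← mul_assoc]
      exact le_mul_of_one_le_left (dot_self_nonneg _) (one_le_mul_of_one_le_of_one_le hg1 hg1)
    -- The bound `4 * δ` is used here for the lattice vector zero, where it gives `4 * (t ⬝ᵥ t) ≤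
    -- K`.
    have hnear : Near K (sp s.2.1) (levelIns i s).1.2 := by
      refine near_of_prj_le (hnorm.trans ((hle 0 (zero_mem _)).trans (le_trans ?_ hK)))
      rw [zero_sub, neg_dotProduct, dotProduct_neg, neg_neg, hst]
      have := prj_norm_le_self s.2.1 t
      linarith
    have hgoodV := (goodL_append.1 hlive.good).1
    have hgC := (goodL_append.1 hlive.good).2
    rw [bot_sup_eq, ← hfst] at hgC
    have hgF := hspec.good K _ hgC hg0
    have hspV : sp (levelNew i s) = sp s.2.1 ⊔ sp [(levelIns i s).1.2] := by
      rw [levelNew, sp_eq_of_latt_eq (latt_append_np _ _), sp_append]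
    have hgnew : GoodL K ⊥ (levelNew i s ++ (levelIns i s).2) := by
      refine goodL_append.2 ⟨goodL_append.2 ⟨hgoodV, ?_, trivial⟩, ?_⟩
      · rw [bot_sup_eq]; exact hnear.np
      · rw [bot_sup_eq, hspV]; exact hgF
    have hlattnew : latt (levelNew i s ++ (levelIns i s).2) = latt C₀ := by
      rw [latt_append, levelNew, latt_append_np, ← latt_append, List.append_assoc, latt_append,
        List.singleton_append, hlatt, ← latt_append, hlive.latt_eq]
    have hlen0 := hlive.length_eq
    rw [List.length_append] at hlen0
    have hlennew : (levelNew i s ++ (levelIns i s).2).length = C₀.length := by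
      simp only [levelNew, List.length_append, List.length_singleton]
      omega
    obtain ⟨r1, r2⟩ := reduce_good hK0 hgnew
    refine ⟨⟨henv, fun u hu x hx => ?_, Or.inl ⟨fun h => ?_, ?_, ?_, hlive.zero, r1, fun c hc => ?_⟩⟩,
      ?_⟩
    · dsimp only at hu
      rw [levelNew, gso_append_singleton, List.mem_append, List.mem_singleton] at hu
      rcases hu with hu | rfl
      · exact hshort u hu x hx
      · rw [prj_np]
        obtain ⟨d1, d2⟩ := hlive.dist_le hx t
        have d3 := hle _ d1
        rw [hst] at d3
        linarith
    · dsimp only at h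
      have := congrArg List.length h
      rw [length_reduce, List.length_nil] at this
      omega
    · exact (latt_reduce _ _).trans hlattnew
    · dsimp only
      rw [List.length_append, length_reduce, ← List.length_append, hlennew]
    · rcases List.mem_append.1 hc with hc | hc
      · dsimp only at hc
        rw [levelNew, List.mem_append, List.mem_singleton] at hc
        rcases hc with hc | rfl
        · exact hlive.norm c (by simp [hc])
        · refine (np_norm_le_of hK0 hgoodV hnear).trans (mul_le_mul_of_nonneg_right ?_ hK0)
          have : s.2.1.length ≤ C₀.length := by omega
          have : (s.2.1.length : ℚ) ≤ C₀.length := by exact_mod_cast this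
          linarith
      · rw [← hlennew]; exact r2 c hc
    · dsimp only
      rw [length_reduce]; omega
  · rw [hflag, if_pos one_pos]
    have hlift := lift_mem e2 hmem
    have hpl := prj_lift e2 (latt_le_sp _ hmem)
    refine ⟨⟨henv, hshort, Or.inr ⟨rfl, ?_, ?_, fun x hx => ?_⟩⟩, ?_⟩
    · rw [← hlive.latt_eq, latt_append]; exact le_sup_left
    · rw [← hlive.latt_eq, latt_append]; exact Submodule.mem_sup_right hlift
    · dsimp only
      obtain ⟨d1, d2⟩ := hlive.dist_le hx t
      have d3 := hle _ d1
      rw [hst] at d3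
      rw [prj_sub, hpl]
      have hl := hlive.length_eq
      rw [List.length_append] at hl
      -- The factor `3` of the embedding is allowed because at least three vectors remain; this is
      -- why the insertions stop at two.
      have h3 : (3 : ℚ) ≤ C₀.length - s.2.1.length := by
        have : 3 + s.2.1.length ≤ C₀.length := by omega
        have : (3 + s.2.1.length : ℚ) ≤ C₀.length := by exact_mod_cast this
        linarith
      have := dot_self_nonneg (x - t)
      nlinarith
    · dsimp only
      rw [List.length_nil]; omega

theorem lInv_init (hC : Indep C₀) (ht : t ∈ sp C₀) (hK : ∀ c ∈ C₀, c ⬝ᵥ c ≤ K) :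
    LInv B C₀ t K ((B, t), ([], (C₀, 0))) := by
  refine ⟨rfl, by simp [gso, gp], ?_⟩
  -- In rank zero the initial state already counts as finished: the target is zero, and so is the
  -- vector stored in the state.
  rcases eq_or_ne C₀ [] with rfl | h0
  · refine Or.inr ⟨rfl, by simp, zero_mem _, fun x _ => ?_⟩
    have : t = 0 := by simpa using ht
    subst this
    simp [prj_eq_zero.2]
  · refine Or.inl ⟨h0, rfl, rfl, rfl, goodL_of_norm hK, fun c hc => ?_⟩
    have h1 := hK c hc
    have h2 := (dot_self_nonneg c).trans h1
    have : 0 ≤ (C₀.length : ℚ) * K := by positivity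
    linarith

end

/-- The final state of the insertions. -/
def levels (i : Ctx) (a : Inst i) : LState i :=
  untilF (fun s => 0 < levelTest s) (levelStep i) ((a.1, a.2.2), ([], (a.2.1, 0)))

theorem levels_spec {i : Ctx} {a : Inst i} (ha : Dom (fun n m => m < n) i a) :
    ∃ K, LInv a.1 a.2.1 a.2.2 K (levels i a) ∧ (levels i a).2.2.1.length ≤ 2 := by
  obtain ⟨hB, hC, ht, hn⟩ := ha
  -- Any number above the squared lengths of the basis vectors and above `4 * (t ⬝ᵥ t)` would do.
  let K := (a.2.1.map fun c => c ⬝ᵥ c).sum + 4 * (a.2.2 ⬝ᵥ a.2.2)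
  have h0 : 0 ≤ (a.2.1.map fun c => c ⬝ᵥ c).sum := List.sum_nonneg (by
    intro x hx
    obtain ⟨c, -, rfl⟩ := List.mem_map.1 hx
    exact dot_self_nonneg c)
  have hK1 : 4 * (a.2.2 ⬝ᵥ a.2.2) ≤ K := by simp only [K]; linarith
  have hK2 : ∀ c ∈ a.2.1, c ⬝ᵥ c ≤ K := by
    intro c hc
    have h1 := List.single_le_sum (l := a.2.1.map fun c => c ⬝ᵥ c) (by
      intro x hx
      obtain ⟨c, -, rfl⟩ := List.mem_map.1 hx
      exact dot_self_nonneg c) _ (List.mem_map_of_mem (f := fun c => c ⬝ᵥ c) hc)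
    have h2 := dot_self_nonneg a.2.2
    simp only [K]; linarith
  have hinit := lInv_init (B := a.1) hC ht hK2
  have hhalt := exists_stop_nat (c := fun s => 0 < levelTest s) (I := LInv a.1 a.2.1 a.2.2 K)
    (fun s hs hc => (lInv_step hB hC ht hn hK1 hs hc).1) (fun s => s.2.2.1.length)
    (fun s hs hc => (lInv_step hB hC ht hn hK1 hs hc).2) hinit
  obtain ⟨k, -, hlt, hk, heq⟩ := exists_untilF (c := fun s => 0 < levelTest s) (f := levelStep i) hhalt
  have hfin := iterate_inv (c := fun s => 0 < levelTest s) (I := LInv a.1 a.2.1 a.2.2 K)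
    (fun s hs hc => (lInv_step hB hC ht hn hK1 hs hc).1) hinit hlt
  rw [← heq, ← levels] at hfin hk
  rw [levelTest_pos] at hk
  exact ⟨K, hfin, by omega⟩

/-- Insert short vectors as long as possible, solve what remains by `A`, and round. -/
def levelSolve (A : ∀ i, Inst i → Vec i.n) (i : Ctx) (a : Inst i) : Vec i.n :=
  let s := levels i a
  let y := if 0 < (if s.2.2.1 = [] then (0 : ℚ) else 1) then
    lift s.2.1 s.2.2.1 (A i (a.1, (s.2.2.1.map (prj s.2.1), prj s.2.1 a.2.2))) else s.2.2.2
  a.2.2 - np s.2.1 (a.2.2 - y)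

/-- Rounding costs a quarter of each squared Gram–Schmidt norm, at most `V.length * δ` in total,
which complements the factor `m - V.length` achieved in the projection. -/
theorem round_spec {n : ℕ} {V : List (Vec n)} {t y : Vec n} {δ m : ℚ}
    (hV : ∀ u ∈ gso V, u ⬝ᵥ u ≤ 4 * δ) (hy : prj V (y - t) ⬝ᵥ prj V (y - t) ≤ (m - V.length) * δ) :
    ((t - np V (t - y)) - t) ⬝ᵥ ((t - np V (t - y)) - t) ≤ m * δ := by
  have h1 := np_norm_le V (t - y)
  have h2 := gso_sum_le hV
  have h3 : prj V (t - y) = -prj V (y - t) := by rw [prj_sub, prj_sub]; abel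
  rw [h3, neg_dotProduct, dotProduct_neg, neg_neg] at h1
  have h4 : t - np V (t - y) - t = -np V (t - y) := by abel
  rw [h4, neg_dotProduct, dotProduct_neg, neg_neg]
  linarith

theorem round_mem {n : ℕ} {V : List (Vec n)} {t y : Vec n} {L : Submodule ℤ (Vec n)}
    (hV : latt V ≤ L) (hy : y ∈ L) : t - np V (t - y) ∈ L := by
  have h1 := add_mem (hV (sub_np_mem V (t - y))) hy
  have h2 : t - y - np V (t - y) + y = t - np V (t - y) := by abel
  rwa [h2] at h1

/-- In either final state the projection is solved within the factor `m - V.length`: by `A` if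
vectors remain, otherwise by the close vector found. All inserted vectors have Gram–Schmidt norms
suited to `round_spec`. -/
theorem levelSolve_spec {A : ∀ i, Inst i → Vec i.n} (hA : Solver (fun _ m => m = 1 ∨ m = 2) A)
    {i : Ctx} {a : Inst i} (ha : Dom (fun n m => m < n) i a) :
    levelSolve A i a ∈ latt a.2.1 ∧ ∀ x ∈ latt a.2.1,
      (levelSolve A i a - a.2.2) ⬝ᵥ (levelSolve A i a - a.2.2)
        ≤ a.2.1.length * ((x - a.2.2) ⬝ᵥ (x - a.2.2)) := by
  obtain ⟨K, ⟨henv, hshort, hcases⟩, hlen⟩ := levels_spec ha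
  rw [levelSolve]
  generalize levels i a = s at *
  rcases hcases with hl | hf
  · have hne := hl.ne
    rw [if_neg hne, if_pos one_pos]
    obtain ⟨e1, e2, e3, e4, e5⟩ := hl.embed_spec ha.top ha.indep ha.mem ha.rank henv
    have hdom : Dom (fun _ m => m = 1 ∨ m = 2) i
        (a.1, (s.2.2.1.map (prj s.2.1), prj s.2.1 a.2.2)) := by
      refine ⟨ha.top, e2, ?_, ?_⟩
      · rw [henv] at e5; exact e5
      · have := List.length_pos_iff.2 hne
        dsimp only
        rw [List.length_map]; omega
    have hmem := hA.mem i _ hdom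
    have hclose := hA.close i _ hdom
    dsimp only at hmem hclose
    generalize A i (a.1, (s.2.2.1.map (prj s.2.1), prj s.2.1 a.2.2)) = w at *
    refine ⟨round_mem ?_ ?_, fun x hx => round_spec (fun u hu => hshort u hu x hx) ?_⟩
    · rw [← hl.latt_eq, latt_append]; exact le_sup_left
    · rw [← hl.latt_eq, latt_append]; exact Submodule.mem_sup_right (lift_mem e2 hmem)
    · rw [prj_sub, prj_lift e2 (latt_le_sp _ hmem)]
      obtain ⟨d1, d2⟩ := hl.dist_le hx a.2.2
      refine (hclose _ d1).trans ?_
      have h1 := hl.length_eq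
      rw [List.length_append] at h1
      have h2 : (a.2.1.length : ℚ) - s.2.1.length = s.2.2.1.length := by
        rw [← h1]; push_cast; ring
      rw [h2, List.length_map]
      exact mul_le_mul_of_nonneg_left d2 (by positivity)
  · rw [if_pos hf.nil, if_neg (lt_irrefl _)]
    exact ⟨round_mem hf.le hf.mem, fun x hx =>
      round_spec (fun u hu => hshort u hu x hx) (hf.close x hx)⟩

/-! ### Polynomial cost of the solver for ranks below the dimension -/

namespace Cmp
variable {α : Ctx → Type} [∀ i, Enc (α i)] {S : ∀ i, α i → Prop}

theorem zeroVec {t : ∀ i, α i → Vec i.n} (ht : Cmp S t) : Cmp S (fun i _ => (0 : Vec i.n)) :=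
  (smul (const 0) ht).congr fun _ _ _ => zero_smul _ _

theorem levelStep : Cmp (α := LState) (fun i s => (∃ B C₀ t K, sp B = ⊤ ∧ Indep C₀ ∧ t ∈ sp C₀ ∧
    C₀.length < i.n ∧ LInv B C₀ t K s) ∧ 0 < levelTest s) levelStep := by
  set S : ∀ i, LState i → Prop := fun i s => (∃ B C₀ t K, sp B = ⊤ ∧ Indep C₀ ∧ t ∈ sp C₀ ∧
    C₀.length < i.n ∧ LInv B C₀ t K s) ∧ 0 < levelTest s
  have hB : Cmp (α := LState) S (fun _ s => s.1.1) := fst (fst ident)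
  have ht : Cmp (α := LState) S (fun _ s => s.1.2) := snd (fst ident)
  have hV : Cmp (α := LState) S (fun _ s => s.2.1) := fst (snd ident)
  have hC : Cmp (α := LState) S (fun _ s => s.2.2.1) := fst (snd (snd ident))
  have hlive : ∀ i s, S i s → sp s.1.1 = ⊤ ∧ Indep (s.2.2.1.map (LatticeProblems.prj s.2.1)) ∧
      (s.2.2.1.map (LatticeProblems.prj s.2.1)).length < i.n ∧
      s.2.2.1.map (LatticeProblems.prj s.2.1) ≠ [] ∧
      LatticeProblems.prj s.2.1 s.1.2 ∈ sp (s.2.2.1.map (LatticeProblems.prj s.2.1)) := by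
    rintro i s ⟨⟨B, C₀, t, K, h1, h2, h3, h4, h5⟩, hc⟩
    have hl : Live C₀ K s := h5.cases.resolve_right fun h => by
      rw [levelTest_pos, h.nil, List.length_nil] at hc; omega
    exact hl.embed_spec h1 h2 h3 h4 h5.env
  have hE : Cmp S levelEmbed := embed hB (mapPrj hV hC) (prj hV ht)
    (fun i s hs => ⟨(hlive i s hs).1, (hlive i s hs).2.1, (hlive i s hs).2.2.1⟩)
    (fun i s hs => (hlive i s hs).2.2.2.1) (fun i s hs => (hlive i s hs).2.2.2.2)
  have hI : Cmp S levelIns := ins (coefs hV hC (snd hE)) ht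
  have hN : Cmp S levelNew := append hV (cons (np hV (snd (fst hI))) nil)
  exact ite' (fst hE) ((fst ident).pair (hV.pair (nil.pair (lift hV hC (snd hE)))))
    ((fst ident).pair (hN.pair ((reduce hN (snd hI)).pair (snd (snd (snd ident))))))

theorem levelTest {S : ∀ i, LState i → Prop} : Cmp S (fun _ s => levelTest s) :=
  nonempty (tail (tail (fst (snd (snd ident)))))

end Cmp

/-- Bound for the size of a state while vectors are being inserted. -/
def liveB (s : ℕ) : ℕ := 3 + 2 * s + 2 * (2 + s * (1 + (2 + s * (1 + (2 * s + (4 * s + 2) + 3)))))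

theorem pb_liveB : PB liveB :=
  ((PB.const 3).add ((PB.const 2).mul PB.id)).add ((PB.const 2).mul
    (pb_short (((PB.const 4).mul PB.id).add (PB.const 2))))

/-- All vectors lie in the original lattice and so keep its common denominator, and their lengths
are bounded through the fixed `K`. The bound therefore does not depend on the number of rounds. -/
theorem Live.sz_le {i : Ctx} {B C₀ : List (Vec i.n)} {t : Vec i.n} {s : LState i} {σ : ℕ}
    (hσ : sz B + sz t + sz C₀ + sz (0 : Vec i.n) ≤ σ) (henv : s.1 = (B, t))
    (h : Live C₀ (2 ^ (3 * σ + 2)) s) : sz s ≤ liveB σ := by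
  have hn : i.n ≤ σ := (dim_le_sz t).trans (by omega)
  have hl := h.length_eq
  rw [List.length_append] at hl
  have hl0 := length_le_sz C₀
  have hpos := sz_pos t
  have hD : cden C₀ ≤ 2 ^ σ := (cden_le C₀).trans (Nat.pow_le_pow_right (by norm_num) (by omega))
  have hdiv : ∀ c ∈ s.2.1 ++ s.2.2.1, ∀ j, DivBy (cden C₀) (c j) := fun c hc =>
    divBy_latt (fun x hx j => (divBy_cden_vec x j).mono (cden_dvd_of_mem hx))
      (h.latt_eq ▸ mem_latt hc)
  have hnorm : ∀ c ∈ s.2.1 ++ s.2.2.1, c ⬝ᵥ c ≤ 2 ^ (4 * σ + 2) := fun c hc => by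
    refine (h.norm c hc).trans ?_
    have h3 : (1 + C₀.length : ℚ) ≤ 2 ^ σ := by
      refine le_trans ?_ (nat_cast_le_two_pow σ)
      have : 1 + C₀.length ≤ σ := by omega
      exact_mod_cast this
    calc (1 + C₀.length : ℚ) * 2 ^ (3 * σ + 2) ≤ 2 ^ σ * 2 ^ (3 * σ + 2) := by gcongr
      _ = 2 ^ (4 * σ + 2) := by ring
  have h1 := sz_short_le (C := s.2.1) (cden_pos C₀) hD hn (by omega)
    (fun c hc => hdiv c (by simp [hc])) (fun c hc => hnorm c (by simp [hc]))
  have h2 := sz_short_le (C := s.2.2.1) (cden_pos C₀) hD hn (by omega)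
    (fun c hc => hdiv c (by simp [hc])) (fun c hc => hnorm c (by simp [hc]))
  simp only [sz_prod, henv, h.zero, liveB] at *
  omega

theorem Cmp.levels : Cmp (Dom fun n m => m < n) levels := by
  obtain ⟨b, hb, hbs⟩ := levelStep.sz_le
  let I : ∀ i, LState i → Prop := fun i s => ∃ B C₀ t K, sp B = ⊤ ∧ Indep C₀ ∧ t ∈ sp C₀ ∧
    C₀.length < i.n ∧ 4 * (t ⬝ᵥ t) ≤ K ∧ LInv B C₀ t K s
  let S : ∀ i, LState i → Prop := fun i s => ∃ a : Inst i, Dom (fun n m => m < n) i a ∧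
    s = ((a.1, a.2.2), ([], (a.2.1, 0)))
  have hIstep : ∀ i s, I i s → 0 < LatticeProblems.levelTest s → I i (LatticeProblems.levelStep i s) := by
    rintro i s ⟨B, C₀, t, K, h1, h2, h3, h4, h5, h6⟩ hc
    exact ⟨B, C₀, t, K, h1, h2, h3, h4, h5, (lInv_step h1 h2 h3 h4 h5 h6 hc).1⟩
  have hinit : ∀ i (a : Inst i), Dom (fun n m => m < n) i a → ∀ σ,
      sz a.1 + sz a.2.2 + sz a.2.1 + sz (0 : Vec i.n) ≤ σ → 4 * (a.2.2 ⬝ᵥ a.2.2) ≤ 2 ^ (3 * σ + 2) ∧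
      LInv a.1 a.2.1 a.2.2 (2 ^ (3 * σ + 2)) ((a.1, a.2.2), ([], (a.2.1, 0))) := by
    intro i a ha σ hσ
    constructor
    · have h1 := dot_self_le_pow a.2.2
      have h2 : (2 : ℚ) ^ (3 * sz a.2.2) ≤ 2 ^ (3 * σ) :=
        pow_le_pow_right₀ (by norm_num) (by omega)
      rw [pow_add]
      linarith
    · refine lInv_init ha.indep ha.mem fun c hc => (dot_self_le_pow c).trans
        (pow_le_pow_right₀ (by norm_num) ?_)
      have := sz_le_of_mem hc
      omega
  refine (Cmp.loop (α := LState) (c := fun _ s => LatticeProblems.levelTest s)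
    (f := LatticeProblems.levelStep) (I := I) (S := S) levelTest
    (levelStep.mono ?_) ?_ hIstep (fun s => s) (fun s => s + b (liveB s)) PB.id
    (PB.id.add (hb.comp pb_liveB)) ?_ ?_).comp
    (((fst ident).pair (snd (snd ident))).pair (nil.pair ((fst (snd ident)).pair
      (zeroVec (snd (snd ident)))))) fun i a ha => ⟨a, ha, rfl⟩
  · rintro i s ⟨⟨B, C₀, t, K, h1, h2, h3, h4, h5, h6⟩, hc⟩
    exact ⟨⟨B, C₀, t, K, h1, h2, h3, h4, h6⟩, hc⟩
  · rintro i s ⟨a, ha, rfl⟩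
    obtain ⟨h1, h2⟩ := hinit i a ha _ le_rfl
    exact ⟨_, _, _, _, ha.top, ha.indep, ha.mem, ha.rank, h1, h2⟩
  · rintro i s ⟨a, ha, rfl⟩
    obtain ⟨h1, h2⟩ := hinit i a ha _ le_rfl
    obtain ⟨k, hk, hk'⟩ := exists_stop_nat (c := fun s => 0 < LatticeProblems.levelTest s)
      (fun s hs hc => (lInv_step ha.top ha.indep ha.mem ha.rank h1 hs hc).1)
      (fun s => s.2.2.1.length)
      (fun s hs hc => (lInv_step ha.top ha.indep ha.mem ha.rank h1 hs hc).2) h2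
    refine ⟨k, hk.trans ((length_le_sz _).trans ?_), hk'⟩
    simp only [sz_prod]
    omega
  · rintro i s ⟨a, ha, rfl⟩ k hk
    -- A state in which a close vector was found is not covered by `Live.sz_le`; its size is bounded
    -- by the cost of the single round that leads to it from a live state.
    rcases k with _ | k
    · exact Nat.le_add_right _ _
    · rw [Function.iterate_succ_apply']
      set s₀ : LState i := ((a.1, a.2.2), ([], (a.2.1, 0))) with hs₀
      have hσ : sz a.1 + sz a.2.2 + sz a.2.1 + sz (0 : Vec i.n) ≤ sz s₀ := by
        rw [hs₀]; simp only [sz_prod]; omega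
      obtain ⟨h1, h2⟩ := hinit i a ha _ hσ
      have hk2 := hk k (Nat.lt_succ_self k)
      have hinv := iterate_inv (k := k) (c := fun s => 0 < LatticeProblems.levelTest s)
        (I := LInv a.1 a.2.1 a.2.2 (2 ^ (3 * sz s₀ + 2))) (fun s hs hc =>
        (lInv_step ha.top ha.indep ha.mem ha.rank h1 hs hc).1) h2
        fun j hj => hk j (Nat.lt_succ_of_lt hj)
      refine (hbs i _ ⟨⟨_, _, _, _, ha.top, ha.indep, ha.mem, ha.rank, hinv⟩, hk2⟩).trans
        (le_trans (hb.1 ?_) (Nat.le_add_left _ _))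
      refine (hinv.cases.resolve_right fun h => ?_).sz_le hσ hinv.env
      rw [levelTest_pos, h.nil, List.length_nil] at hk2
      omega

theorem Solver.levelSolve {A : ∀ i, Inst i → Vec i.n}
    (hA : Solver (fun _ m => m = 1 ∨ m = 2) A) :
    Solver (fun n m => m < n) (levelSolve A) := by
  refine ⟨?_, fun i a ha => (levelSolve_spec hA ha).1, fun i a ha => (levelSolve_spec hA ha).2⟩
  have hs := Cmp.levels
  have hy : Cmp (Dom fun n m => m < n) (fun i a =>
      if 0 < (if (levels i a).2.2.1 = [] then (0 : ℚ) else 1) then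
        lift (levels i a).2.1 (levels i a).2.2.1 (A i (a.1,
          ((levels i a).2.2.1.map (prj (levels i a).2.1), prj (levels i a).2.1 a.2.2)))
      else (levels i a).2.2.2) := by
    refine Cmp.ite (Cmp.nonempty (Cmp.fst (Cmp.snd (Cmp.snd hs)))) ?_
      ((Cmp.snd (Cmp.snd (Cmp.snd hs))).mono fun _ _ h => h.1)
    have hs' := hs.mono (S := fun i (a : Inst i) => Dom (fun n m => m < n) i a ∧
      0 < (if (levels i a).2.2.1 = [] then (0 : ℚ) else 1)) fun _ _ h => h.1
    refine Cmp.lift (Cmp.fst (Cmp.snd hs')) (Cmp.fst (Cmp.snd (Cmp.snd hs')))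
      (hA.cmp.comp (Cmp.pair (Cmp.fst Cmp.ident)
      (Cmp.pair (Cmp.mapPrj (Cmp.fst (Cmp.snd hs')) (Cmp.fst (Cmp.snd (Cmp.snd hs')))) (Cmp.prj (Cmp.fst (Cmp.snd hs'))
        (Cmp.snd (Cmp.snd Cmp.ident))))) ?_)
    rintro i a ⟨ha, hc⟩
    obtain ⟨K, ⟨henv, hshort, hcases⟩, hlen⟩ := levels_spec ha
    have hne : (levels i a).2.2.1 ≠ [] := fun h => by simp [h] at hc
    have hl : Live a.2.1 K (levels i a) := hcases.resolve_right fun h => hne h.nil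
    obtain ⟨e1, e2, e3, e4, e5⟩ := hl.embed_spec ha.top ha.indep ha.mem ha.rank henv
    refine ⟨ha.top, e2, by rw [henv] at e5; exact e5, ?_⟩
    have := List.length_pos_iff.2 hne
    dsimp only
    rw [List.length_map]; omega
  exact Cmp.vsub (Cmp.snd (Cmp.snd Cmp.ident))
    (Cmp.np (Cmp.fst (Cmp.snd hs)) (Cmp.vsub (Cmp.snd (Cmp.snd Cmp.ident)) hy))

/-! ## Minkowski's theorem for a lattice and its dual -/

section
open MeasureTheory Matrix

/-- Minkowski's theorem for the closed cube of half-width `r`, whose volume `(2 * r) ^ m` equals `2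
^ m` times the covolume; compactness of the cube allows this equality. -/
theorem exists_small_comb {m : ℕ} (hm : 0 < m) (M : Matrix (Fin m) (Fin m) ℝ) (hM : M.det ≠ 0) :
    ∃ z : Fin m → ℤ, (fun i => (z i : ℝ)) ᵥ* M ≠ 0 ∧
      ∀ j, |((fun i => (z i : ℝ)) ᵥ* M) j| ≤ |M.det| ^ (1 / m : ℝ) := by
  have : Nonempty (Fin m) := ⟨⟨0, hm⟩⟩
  have hli : LinearIndependent ℝ M.row :=
    Matrix.linearIndependent_rows_iff_isUnit.2 ((Matrix.isUnit_iff_isUnit_det M).2 hM.isUnit)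
  let b := basisOfLinearIndependentOfCardEqFinrank hli (by simp)
  have hb : ⇑b = M.row := coe_basisOfLinearIndependentOfCardEqFinrank _ _
  set r : ℝ := |M.det| ^ (1 / m : ℝ) with hr
  have hr0 : 0 ≤ r := by positivity
  have hrm : r ^ m = |M.det| := by
    rw [hr, ← Real.rpow_natCast, ← Real.rpow_mul (abs_nonneg _), one_div,
      inv_mul_cancel₀ (by exact_mod_cast hm.ne'), Real.rpow_one]
  have hdisc : DiscreteTopology (Submodule.span ℤ (Set.range b)).toAddSubgroup :=
    inferInstanceAs (DiscreteTopology (Submodule.span ℤ (Set.range b)))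
  have hcount : Countable (Submodule.span ℤ (Set.range b)).toAddSubgroup :=
    inferInstanceAs (Countable (Submodule.span ℤ (Set.range b)))
  obtain ⟨⟨x, hx⟩, hx0, hxr⟩ := exists_ne_zero_mem_lattice_of_measure_mul_two_pow_le_measure
    (ZSpan.isAddFundamentalDomain' b volume) (s := Metric.closedBall 0 r)
    (fun x hx => by simpa using hx) (convex_closedBall 0 r) (isCompact_closedBall 0 r) (by
      rw [ZSpan.volume_fundamentalDomain, Real.volume_pi_closedBall 0 hr0, Module.finrank_fin_fun,
        Fintype.card_fin, hb, mul_pow, hrm, mul_comm (2 ^ m : ℝ),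
        ENNReal.ofReal_mul (abs_nonneg _), ENNReal.ofReal_pow (by norm_num)]
      simp
      rfl)
  obtain ⟨z, rfl⟩ := (Submodule.mem_span_range_iff_exists_fun ℤ).1 hx
  have hz : (fun i => (z i : ℝ)) ᵥ* M = ∑ i, z i • b i := by
    rw [hb]
    ext j
    simp [Matrix.vecMul, dotProduct, Finset.sum_apply]
  refine ⟨z, fun h => hx0 (Subtype.ext ?_), fun j => ?_⟩
  · exact hz.symm.trans h
  · rw [hz]
    have h1 := norm_le_pi_norm (∑ i, z i • b i) j
    rw [mem_closedBall_zero_iff] at hxr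
    exact h1.trans hxr

/-- Minkowski's theorem is applied to full-rank lattices, whereas the given one has rank `m` in a
space of dimension `n`. A square factor of the Gram matrix supplies an isometric copy of full rank.
-/
theorem exists_eq_mul_transpose {m : ℕ} {G : Matrix (Fin m) (Fin m) ℝ} (hG : G.PosSemidef) :
    ∃ M : Matrix (Fin m) (Fin m) ℝ, G = M * Mᵀ := by
  open scoped MatrixOrder in
  obtain ⟨B, hB⟩ := CStarAlgebra.nonneg_iff_eq_star_mul_self.mp hG.nonneg
  refine ⟨Bᵀ, ?_⟩
  rw [hB, Matrix.star_eq_conjTranspose, Matrix.conjTranspose_eq_transpose_of_trivial,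
    Matrix.transpose_transpose]

variable {n : ℕ}

/-- The Gram matrix of a list of vectors. -/
def gram {m : ℕ} (c : Fin m → Vec n) : Matrix (Fin m) (Fin m) ℝ :=
  .of fun i j => ((c i ⬝ᵥ c j : ℚ) : ℝ)

theorem dot_comb {m : ℕ} (c : Fin m → Vec n) (z : Fin m → ℤ) :
    (((∑ i, (z i : ℚ) • c i) ⬝ᵥ (∑ i, (z i : ℚ) • c i) : ℚ) : ℝ)
      = ((fun i => (z i : ℝ)) ᵥ* gram c) ⬝ᵥ fun i => (z i : ℝ) := by
  rw [sum_dotProduct]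
  simp only [dotProduct_sum, smul_dotProduct, dotProduct_smul, smul_eq_mul]
  show _ = ∑ j, (∑ i, (z i : ℝ) * ((c i ⬝ᵥ c j : ℚ) : ℝ)) * (z j : ℝ)
  simp only [Rat.cast_sum, Rat.cast_mul, Rat.cast_intCast]
  rw [Finset.sum_comm]
  refine Finset.sum_congr rfl fun j _ => ?_
  rw [Finset.sum_mul]
  refine Finset.sum_congr rfl fun i _ => ?_
  ring

/-- The squared length of a combination is that of the coefficient row times `M`, a vector with `m`
entries bounded as in `exists_small_comb`. -/
theorem exists_short_comb {m : ℕ} (hm : 0 < m) (c : Fin m → Vec n) (M : Matrix (Fin m) (Fin m) ℝ)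
    (hM : M.det ≠ 0) (hG : gram c = M * Mᵀ) : ∃ z : Fin m → ℤ, (∑ i, (z i : ℚ) • c i) ≠ 0 ∧
      (((∑ i, (z i : ℚ) • c i) ⬝ᵥ (∑ i, (z i : ℚ) • c i) : ℚ) : ℝ)
        ≤ m * (|M.det| ^ (1 / m : ℝ)) ^ 2 := by
  obtain ⟨z, hz0, hz⟩ := exists_small_comb hm M hM
  have h1 := dot_comb c z
  rw [hG, ← Matrix.vecMul_vecMul, ← Matrix.dotProduct_mulVec, Matrix.mulVec_transpose] at h1
  refine ⟨z, fun h => hz0 ?_, ?_⟩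
  · rw [h] at h1
    exact dotProduct_self_eq_zero.1 (by rw [← h1]; simp)
  · rw [h1]
    refine (Finset.sum_le_card_nsmul Finset.univ _ ((|M.det| ^ (1 / m : ℝ)) ^ 2) fun j _ => ?_).trans
      (by simp)
    rw [← sq, ← sq_abs]
    exact pow_le_pow_left₀ (abs_nonneg _) (hz j) 2

theorem list_sum_eq (C : List (Vec n)) (f : Vec n → Vec n) :
    (C.map f).sum = ∑ i, f (C.get i) := by
  rw [← List.sum_ofFn]
  congr 1
  apply List.ext_getElem <;> simp

theorem comb_mem_latt {m : ℕ} {C : List (Vec n)} {c : Fin m → Vec n} (hc : ∀ i, c i ∈ C)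
    (z : Fin m → ℤ) : ∑ i, (z i : ℚ) • c i ∈ latt C :=
  sum_mem fun i _ => intCast_smul_mem _ (mem_latt (hc i))

/-- A lattice of rank `m` and its dual contain nonzero vectors the product of whose lengths is at
most `m`. -/
theorem exists_short_pair {C : List (Vec n)} (hC : Indep C) (h0 : C ≠ []) :
    ∃ x ∈ latt C, x ≠ 0 ∧ ∃ y ∈ latt (dual C), y ≠ 0 ∧
      (x ⬝ᵥ x) * (y ⬝ᵥ y) ≤ (C.length : ℚ) ^ 2 := by
  set m := C.length with hm
  have hm0 : 0 < m := List.length_pos_iff.2 h0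
  let c : Fin m → Vec n := C.get
  let d : Fin m → Vec n := fun i => dualv C (C.get i)
  have hcm : ∀ i, c i ∈ C := fun i => List.get_mem C i
  have hdm : ∀ i, d i ∈ dual C := fun i => List.mem_map_of_mem (hcm i)
  have hdc : ∀ i k, d i ⬝ᵥ c k = if i = k then 1 else 0 := by
    intro i k
    split_ifs with h
    · rw [h]; exact dualv_dot_self hC (hcm k)
    · refine dualv_dot_of_ne (hcm k) fun h' => h ?_
      exact ((List.nodup_iff_injective_get.1 hC.nodup) h').symm
  have hHG : gram d * gram c = 1 := by
    ext i k
    rw [Matrix.mul_apply, Matrix.one_apply]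
    have h1 := dual_expand hC (dualv_mem (hcm i))
    rw [list_sum_eq] at h1
    have h2 := congrArg (fun v : Vec n => ((v ⬝ᵥ c k : ℚ) : ℝ)) h1
    simp only [sum_dotProduct, smul_dotProduct, smul_eq_mul, Rat.cast_sum, Rat.cast_mul] at h2
    have h3 : ((dualv C (c i) ⬝ᵥ c k : ℚ) : ℝ) = if i = k then 1 else 0 := by
      rw [show dualv C (c i) ⬝ᵥ c k = if i = k then 1 else 0 from hdc i k]
      split_ifs <;> simp
    rw [← h3, ← h2]
    rfl
  have hpsd : (gram c).PosSemidef := by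
    have : gram c = (Matrix.of fun i j => (c i j : ℝ)) * (Matrix.of fun i j => (c i j : ℝ))ᴴ := by
      ext i j
      simp [gram, Matrix.mul_apply, dotProduct]
    rw [this]
    exact Matrix.posSemidef_self_mul_conjTranspose _
  obtain ⟨M, hM⟩ := exists_eq_mul_transpose hpsd
  have hdet : M.det ≠ 0 := fun h => by
    have := congrArg Matrix.det hHG
    rw [hM, Matrix.det_mul, Matrix.det_mul, h] at this
    simp at this
  -- The dual Gram matrix is the inverse of the primal one, so its square factor has the reciprocal
  -- determinant.
  have hH : gram d = (M⁻¹)ᵀ * ((M⁻¹)ᵀ)ᵀ := by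
    rw [Matrix.transpose_transpose, Matrix.transpose_nonsing_inv, ← Matrix.mul_inv_rev, ← hM]
    exact (Matrix.inv_eq_left_inv hHG).symm
  have hdet' : ((M⁻¹)ᵀ).det = (M.det)⁻¹ := by
    rw [Matrix.det_transpose, Matrix.det_nonsing_inv, Ring.inverse_eq_inv']
  obtain ⟨z, hz0, hz⟩ := exists_short_comb hm0 c M hdet hM
  obtain ⟨w, hw0, hw⟩ := exists_short_comb hm0 d _ (by rw [hdet']; exact inv_ne_zero hdet) hH
  refine ⟨_, comb_mem_latt hcm z, hz0, _, comb_mem_latt hdm w, hw0, ?_⟩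
  rw [hdet', abs_inv, Real.inv_rpow (abs_nonneg _)] at hw
  have hr : |M.det| ^ (1 / m : ℝ) ≠ 0 := (Real.rpow_pos_of_pos (abs_pos.2 hdet) _).ne'
  generalize |M.det| ^ (1 / m : ℝ) = r at *
  -- In the product of the two Minkowski bounds the determinants cancel, which leaves only the rank.
  have h1 := mul_le_mul hz hw (by exact_mod_cast dot_self_nonneg _) (by positivity)
  have h2 : (m : ℝ) * r ^ 2 * (m * r⁻¹ ^ 2) = (m : ℝ) ^ 2 := by
    field_simp
  rw [h2] at h1
  exact_mod_cast h1

end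

/-! ## Raising the rank by one -/

section
variable {n : ℕ}

theorem map_prj_nil (C : List (Vec n)) : C.map (prj []) = C := by
  conv_rhs => rw [← List.map_id C]
  exact List.map_congr_left fun x _ => prj_nil x

/-- A basis of the lattice generated by `C` starting with a vector of which `b` is a multiple. -/
def extend (C : List (Vec n)) (b z : Vec n) : (ℚ × Vec n) × List (Vec n) := ins (coefs [] C b) z

/-- `b` is `g • e` with an integer `g ≥ 1`, so replacing it by the basis vector `e` does not
increase the length. The empty list `[]` makes the projection in `coefs` trivial. -/
theorem extend_spec {C : List (Vec n)} {b : Vec n} (hC : Indep C) (hb : b ∈ latt C) (hb0 : b ≠ 0)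
    (z : Vec n) : latt ((extend C b z).1.2 :: (extend C b z).2) = latt C ∧
      (extend C b z).2.length + 1 = C.length ∧ (extend C b z).1.2 ≠ 0 ∧
      (extend C b z).1.2 ⬝ᵥ (extend C b z).1.2 ≤ b ⬝ᵥ b := by
  have hC' : Indep (C.map (prj [])) := by rw [map_prj_nil]; exact hC
  have hb' : b ∈ latt (C.map (prj [])) := by rw [map_prj_nil]; exact hb
  have hint := coefs_int hC' hb'
  have hspec := ins_spec one_pos (coefs [] C b) z (fun p hp => by simpa using hint p hp)
  rw [← extend] at hspec
  have hcomb := hspec.comb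
  have hpl := prj_lift hC' (latt_le_sp _ hb')
  rw [prj_nil] at hpl
  rw [← lift_eq, hpl] at hcomb
  have hg0 : 0 < (extend C b z).1.1 := hspec.nonneg.lt_of_ne' fun h => hb0 (by
    rw [h, zero_smul] at hcomb; exact hcomb.symm)
  have hg1 : 1 ≤ (extend C b z).1.1 := unit_le one_pos hg0 hspec.int
  obtain ⟨hlatt, hlen⟩ := hspec.pos hg0
  have hfst : (coefs [] C b).map Prod.fst = C := by
    rw [coefs, List.map_map]
    exact List.map_id _
  rw [hfst] at hlatt
  rw [coefs, List.length_map] at hlen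
  refine ⟨hlatt, hlen, fun h => hb0 (by rw [← hcomb, h, smul_zero]), ?_⟩
  conv_rhs => rw [← hcomb, smul_dotProduct, dotProduct_smul, smul_eq_mul, smul_eq_mul, ← mul_assoc]
  exact le_mul_of_one_le_left (dot_self_nonneg _) (one_le_mul_of_one_le_of_one_le hg1 hg1)

theorem indep_of_latt_eq {C E : List (Vec n)} (hC : Indep C) (h : latt E = latt C)
    (hl : E.length = C.length) : Indep E :=
  indep_of_sp_eq hC (sp_eq_of_latt_eq h).symm hl.symm

/-- A list spanning the space, a basis of the sublattice orthogonal to a dual vector `w`, the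
vector `w`, a lattice vector `x` with `w ⬝ᵥ x = 1`, and the target. -/
abbrev PlaneEnv (n : ℕ) : Type := List (Vec n) × (List (Vec n) × (Vec n × (Vec n × Vec n)))

/-- The properties of these data. -/
structure PlaneOk (C : List (Vec n)) (t : Vec n) (e : PlaneEnv n) : Prop where
  top : sp e.1 = ⊤
  indep : Indep e.2.1
  length_eq : e.2.1.length + 1 = C.length
  one : e.2.2.1 ⬝ᵥ e.2.2.2.1 = 1
  zero : ∀ y ∈ sp e.2.1, e.2.2.1 ⬝ᵥ y = 0
  latt_eq : latt (e.2.2.2.1 :: e.2.1) = latt C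
  mem : e.2.2.1 ∈ sp C
  target : e.2.2.2.2 = t
  target_mem : t ∈ sp C

theorem PlaneOk.decomp {C : List (Vec n)} {t : Vec n} {e : PlaneEnv n} (h : PlaneOk C t e)
    {x : Vec n} (hx : x ∈ latt C) :
    ∃ k : ℤ, e.2.2.1 ⬝ᵥ x = k ∧ x - (k : ℚ) • e.2.2.2.1 ∈ latt e.2.1 := by
  rw [← h.latt_eq, latt_cons, Submodule.mem_sup] at hx
  obtain ⟨y, hy, z, hz, rfl⟩ := hx
  obtain ⟨k, rfl⟩ := mem_latt_singleton.1 hy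
  refine ⟨k, ?_, by rwa [add_sub_cancel_left]⟩
  rw [dotProduct_add, dotProduct_smul, h.one, h.zero z (latt_le_sp _ hz)]
  simp

theorem PlaneOk.mem_sp {C : List (Vec n)} {t : Vec n} {e : PlaneEnv n} (h : PlaneOk C t e)
    {x : Vec n} (hx : x ∈ sp C) (h0 : e.2.2.1 ⬝ᵥ x = 0) : x ∈ sp e.2.1 := by
  rw [← sp_eq_of_latt_eq h.latt_eq, sp_cons, Submodule.mem_sup] at hx
  obtain ⟨y, hy, z, hz, rfl⟩ := hx
  obtain ⟨k, rfl⟩ := mem_sp_singleton.1 hy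
  rw [dotProduct_add, dotProduct_smul, h.one, h.zero z hz, smul_eq_mul, mul_one, add_zero] at h0
  rwa [h0, zero_smul, zero_add]

end

/-- The best vector found in the plane `w ⬝ᵥ x = k`. -/
def planeSolve (A : ∀ i, Inst i → Vec i.n) (i : Ctx) (e : PlaneEnv i.n) (k : ℚ) : Vec i.n :=
  A i (e.1, (e.2.1, prj [e.2.2.1] (e.2.2.2.2 - k • e.2.2.2.1))) + k • e.2.2.2.1

section
variable {R : ℕ → ℕ → Prop} {A : ∀ i, Inst i → Vec i.n} {i : Ctx} {C : List (Vec i.n)}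
  {t : Vec i.n} {e : PlaneEnv i.n}

theorem PlaneOk.dom (h : PlaneOk C t e) (hR : R i.n (C.length - 1)) (k : ℚ) :
    Dom R i (e.1, (e.2.1, prj [e.2.2.1] (e.2.2.2.2 - k • e.2.2.2.1))) := by
  refine ⟨h.top, h.indep, h.mem_sp ?_ ?_, ?_⟩
  · have h1 : e.2.2.2.2 - k • e.2.2.2.1 ∈ sp C := by
      rw [h.target]
      refine sub_mem h.target_mem ((sp C).smul_mem k ?_)
      rw [← sp_eq_of_latt_eq h.latt_eq]
      exact LatticeProblems.mem_sp (by simp)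
    have h2 := sub_prj_mem [e.2.2.1] (e.2.2.2.2 - k • e.2.2.2.1)
    have h3 : sp [e.2.2.1] ≤ sp C := sp_le.2 fun x hx => by
      rw [List.mem_singleton.1 hx]; exact h.mem
    have h4 := sub_mem h1 (h3 h2)
    rwa [sub_sub_cancel] at h4
  · rw [dotProduct_comm]
    exact prj_dot _ (LatticeProblems.mem_sp (by simp))
  · have := h.length_eq
    have h2 : e.2.1.length = C.length - 1 := by omega
    show R i.n e.2.1.length
    rw [h2]; exact hR

theorem PlaneOk.solve_mem (hA : Solver R A) (h : PlaneOk C t e) (hR : R i.n (C.length - 1))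
    (k : ℤ) : planeSolve A i e k ∈ latt C := by
  have h1 := hA.mem i _ (h.dom hR k)
  rw [← h.latt_eq, latt_cons]
  exact add_mem (Submodule.mem_sup_right h1)
    (Submodule.mem_sup_left (mem_latt_singleton.2 ⟨k, rfl⟩))

/-- For vectors of one plane, the difference to `t` splits into a part in the directions of the
plane and a common offset along `w`. The lower-rank solver multiplies the first squared part by `m -
1` and leaves the second alone, so the total factor is at most `m`. -/
theorem PlaneOk.solve_close (hA : Solver R A) (h : PlaneOk C t e) (hR : R i.n (C.length - 1))
    {x : Vec i.n} (hx : x ∈ latt C) {k : ℤ} (hk : e.2.2.1 ⬝ᵥ x = k) :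
    (planeSolve A i e k - t) ⬝ᵥ (planeSolve A i e k - t)
      ≤ C.length * ((x - t) ⬝ᵥ (x - t)) := by
  obtain ⟨k', hk', hy⟩ := h.decomp hx
  have hkk : k' = k := by
    rw [hk] at hk'; exact_mod_cast hk'.symm
  subst hkk
  have hd := h.dom hR k'
  have h1 := hA.mem i _ hd
  have h2 := hA.close i _ hd _ hy
  dsimp only at h1 h2
  rw [planeSolve, h.target] at *
  generalize A i (e.1, (e.2.1, prj [e.2.2.1] (t - (k' : ℚ) • e.2.2.2.1))) = a at *
  set s := t - (k' : ℚ) • e.2.2.2.1 with hs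
  set y := x - (k' : ℚ) • e.2.2.2.1 with hyd
  set p := prj [e.2.2.1] s with hp
  have e1 : a + (k' : ℚ) • e.2.2.2.1 - t = (a - p) + (p - s) := by rw [hs]; abel
  have e2 : x - t = (y - p) + (p - s) := by rw [hs, hyd]; abel
  have hps : p - s ∈ sp [e.2.2.1] := by
    have := neg_mem (sub_prj_mem [e.2.2.1] s)
    rwa [neg_sub] at this
  obtain ⟨q, hq⟩ := mem_sp_singleton.1 hps
  have horth : ∀ {z}, z ∈ sp e.2.1 → z ⬝ᵥ (p - s) = 0 := by
    intro z hz
    rw [← hq, dotProduct_smul, dotProduct_comm, h.zero z hz, smul_zero]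
  have hpm : p ∈ sp e.2.1 := hd.mem
  have p1 := pythagoras (horth (sub_mem (latt_le_sp _ h1) hpm))
  have p2 := pythagoras (horth (sub_mem (latt_le_sp _ hy) hpm))
  rw [e1, e2, p1, p2]
  have hl : (C.length : ℚ) = e.2.1.length + 1 := by rw [← h.length_eq]; push_cast; rfl
  rw [hl]
  have n1 := dot_self_nonneg (y - p)
  have n2 := dot_self_nonneg (p - s)
  have : (0 : ℚ) ≤ e.2.1.length * ((p - s) ⬝ᵥ (p - s)) := by positivity
  linarith

end

/-- Consider the next plane. -/
def planeStep (A : ∀ i, Inst i → Vec i.n) (i : Ctx) (e : PlaneEnv i.n) (s : ℚ × Vec i.n) :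
    ℚ × Vec i.n :=
  if 0 < (s.2 - e.2.2.2.2) ⬝ᵥ (s.2 - e.2.2.2.2)
      - (planeSolve A i e s.1 - e.2.2.2.2) ⬝ᵥ (planeSolve A i e s.1 - e.2.2.2.2) then
    (s.1 + 1, planeSolve A i e s.1)
  else (s.1 + 1, s.2)

/-- The list is only a counter: its entries are ignored and its length is the number of planes
visited. -/
theorem planes_spec (A : ∀ i, Inst i → Vec i.n) (i : Ctx) (e : PlaneEnv i.n) (k : ℚ) (x : Vec i.n)
    (l : List (Vec i.n)) :
    let r := l.foldl (fun s _ => planeStep A i e s) (k, x)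
    r.1 = k + l.length ∧ (r.2 = x ∨ ∃ j < l.length, r.2 = planeSolve A i e (k + j)) ∧
      (r.2 - e.2.2.2.2) ⬝ᵥ (r.2 - e.2.2.2.2) ≤ (x - e.2.2.2.2) ⬝ᵥ (x - e.2.2.2.2) ∧
      ∀ j < l.length, (r.2 - e.2.2.2.2) ⬝ᵥ (r.2 - e.2.2.2.2)
        ≤ (planeSolve A i e (k + j) - e.2.2.2.2) ⬝ᵥ (planeSolve A i e (k + j) - e.2.2.2.2) := by
  induction l using List.reverseRecOn with
  | nil => exact ⟨by simp, Or.inl rfl, le_rfl, by simp⟩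
  | append_singleton l y ih =>
    intro r
    have hr : r = planeStep A i e (l.foldl (fun s _ => planeStep A i e s) (k, x)) := by
      simp only [r, List.foldl_append, List.foldl_cons, List.foldl_nil]
    rw [hr]
    generalize l.foldl (fun s _ => planeStep A i e s) (k, x) = s at *
    obtain ⟨h1, h2, h3, h4⟩ := ih
    rw [List.length_append, List.length_singleton, planeStep, h1]
    split_ifs with hc
    · rw [sub_pos] at hc
      refine ⟨by push_cast; ring, Or.inr ⟨l.length, by omega, rfl⟩, hc.le.trans h3, fun j hj => ?_⟩
      rcases Nat.lt_succ_iff_lt_or_eq.1 hj with hj | rfl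
      · exact hc.le.trans (h4 j hj)
      · exact le_rfl
    · rw [sub_pos, not_lt] at hc
      refine ⟨by push_cast; ring, h2.imp_right fun ⟨j, hj, h⟩ => ⟨j, by omega, h⟩, h3,
        fun j hj => ?_⟩
      rcases Nat.lt_succ_iff_lt_or_eq.1 hj with hj | rfl
      · exact h4 j hj
      · exact hc

/-- Project orthogonally to a short vector, solve, lift and round. -/
def projSolve (A : ∀ i, Inst i → Vec i.n) (i : Ctx) (a : Inst i) : Vec i.n :=
  let r := extend a.2.1 (svp i a.1 a.2.1) a.2.2
  a.2.2 - np [r.1.2] (a.2.2 - lift [r.1.2] r.2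
    (A i (a.1, (r.2.map (prj [r.1.2]), prj [r.1.2] a.2.2))))

/-- A dual basis starting with a short vector. -/
def dualExtend (i : Ctx) (a : Inst i) : (ℚ × Vec i.n) × List (Vec i.n) :=
  extend (dual a.2.1) (svp i a.1 (dual a.2.1)) a.2.2

/-- The planes orthogonal to a short dual vector. -/
def planeEnv (i : Ctx) (a : Inst i) : PlaneEnv i.n :=
  let r := dualExtend i a
  (a.1, (r.2.map (dualv (r.1.2 :: r.2)), (r.1.2, (dualv (r.1.2 :: r.2) r.1.2, a.2.2))))

/-- The first plane to be considered. -/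
def planeStart (i : Ctx) (a : Inst i) : ℚ :=
  ((⌊(dualExtend i a).1.2 ⬝ᵥ a.2.2⌋ : ℤ) : ℚ) - (a.2.1.map fun _ => (1 : ℚ)).sum

/-- The best of the vectors found by projection and in the planes close to the target. -/
def raise (A : ∀ i, Inst i → Vec i.n) (i : Ctx) (a : Inst i) : Vec i.n :=
  ((a.2.1 ++ (a.2.1 ++ [a.2.2])).foldl (fun s _ => planeStep A i (planeEnv i a) s)
    (planeStart i a, projSolve A i a)).2

section
variable {R : ℕ → ℕ → Prop} {A : ∀ i, Inst i → Vec i.n} {i : Ctx} {a : Inst i}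

theorem projSolve_dom (ha : Dom (fun n m => 1 ≤ m ∧ R n (m - 1)) i a) :
    let r := extend a.2.1 (svp i a.1 a.2.1) a.2.2
    Dom R i (a.1, (r.2.map (prj [r.1.2]), prj [r.1.2] a.2.2)) ∧
      Indep (r.1.2 :: r.2) ∧ latt (r.1.2 :: r.2) = latt a.2.1 ∧
      r.2.length + 1 = a.2.1.length ∧ r.1.2 ⬝ᵥ r.1.2 ≤ svp i a.1 a.2.1 ⬝ᵥ svp i a.1 a.2.1 := by
  intro r
  obtain ⟨hB, hC, ht, hm, hR⟩ := ha
  obtain ⟨s1, s2, -⟩ := svp_spec hB hC (List.length_pos_iff.1 hm)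
  obtain ⟨e1, e2, e3, e4⟩ := extend_spec hC s1 s2 a.2.2
  have hI : Indep (r.1.2 :: r.2) := indep_of_latt_eq hC e1 (by rw [List.length_cons]; exact e2)
  refine ⟨⟨hB, Indep.map_prj (V := [r.1.2]) (F := r.2) hI, prj_mem_sp_map ?_, ?_⟩, hI, e1, e2, e4⟩
  · rw [List.singleton_append, sp_eq_of_latt_eq e1]; exact ht
  · have h2 : r.2.length + 1 = a.2.1.length := e2
    have h2 : r.2.length = a.2.1.length - 1 := by omega
    show R i.n (r.2.map _).length
    rw [List.length_map, h2]; exact hR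

theorem projSolve_mem (hA : Solver R A) (ha : Dom (fun n m => 1 ≤ m ∧ R n (m - 1)) i a) :
    projSolve A i a ∈ latt a.2.1 := by
  obtain ⟨h1, h2, h3, h4, -⟩ := projSolve_dom ha
  have h5 := hA.mem i _ h1
  rw [projSolve]
  generalize extend a.2.1 (svp i a.1 a.2.1) a.2.2 = r at *
  have hI : Indep (r.2.map (prj [r.1.2])) := Indep.map_prj (V := [r.1.2]) (F := r.2) h2
  rw [latt_cons] at h3
  refine round_mem (by rw [← h3]; exact le_sup_left) ?_
  rw [← h3]
  exact Submodule.mem_sup_right (lift_mem hI h5)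

/-- The projected problem contributes the factor `m - 1`, and rounding along the one vector of
squared length at most `4 * δ` contributes the missing `δ`. -/
theorem projSolve_close (hA : Solver R A) (ha : Dom (fun n m => 1 ≤ m ∧ R n (m - 1)) i a)
    {x : Vec i.n} (hx : x ∈ latt a.2.1)
    (hs : svp i a.1 a.2.1 ⬝ᵥ svp i a.1 a.2.1 ≤ 4 * ((x - a.2.2) ⬝ᵥ (x - a.2.2))) :
    (projSolve A i a - a.2.2) ⬝ᵥ (projSolve A i a - a.2.2)
      ≤ a.2.1.length * ((x - a.2.2) ⬝ᵥ (x - a.2.2)) := by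
  obtain ⟨h1, h2, h3, h4, h6⟩ := projSolve_dom ha
  have h5 := hA.close i _ h1
  have h7 := hA.mem i _ h1
  rw [projSolve]
  generalize extend a.2.1 (svp i a.1 a.2.1) a.2.2 = r at *
  have hI : Indep (r.2.map (prj [r.1.2])) := Indep.map_prj (V := [r.1.2]) (F := r.2) h2
  refine round_spec (fun u hu => ?_) ?_
  · have hu' : u = r.1.2 := by
      have : gso [r.1.2] = [r.1.2] := by
        have := gso_append_singleton [] r.1.2
        rw [prj_nil] at this
        simpa [gso, gp] using this
      rw [this] at hu
      exact List.mem_singleton.1 hu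
    rw [hu']
    exact h6.trans hs
  · rw [prj_sub, prj_lift hI (latt_le_sp _ h7)]
    have hx' : x ∈ latt ([r.1.2] ++ r.2) := by rw [List.singleton_append, h3]; exact hx
    refine (h5 _ (prj_mem_latt_map hx')).trans ?_
    dsimp only
    rw [← prj_sub, List.length_map, ← h4]
    have h8 := prj_norm_le_self [r.1.2] (x - a.2.2)
    push_cast
    rw [List.length_singleton, Nat.cast_one, add_sub_cancel_right]
    exact mul_le_mul_of_nonneg_left h8 (by positivity)

/-- Dualizing a basis of the dual lattice that starts with `w` returns a basis of the lattice
itself: the partner of `w` lies in the plane of level one, and the other vectors are orthogonal to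
`w`. -/
theorem planeEnv_ok (ha : Dom (fun n m => 1 ≤ m ∧ R n (m - 1)) i a) :
    PlaneOk a.2.1 a.2.2 (planeEnv i a) ∧ ∀ y ∈ latt (dual a.2.1), y ≠ 0 →
      (planeEnv i a).2.2.1 ⬝ᵥ (planeEnv i a).2.2.1 ≤ 2 * (y ⬝ᵥ y) := by
  obtain ⟨hB, hC, ht, hm, hR⟩ := ha
  have hD := hC.dual
  have hD0 : dual a.2.1 ≠ [] := by
    rw [dual, Ne, List.map_eq_nil_iff]; exact List.length_pos_iff.1 hm
  obtain ⟨s1, s2, s3⟩ := svp_spec hB hD hD0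
  obtain ⟨e1, e2, e3, e4⟩ := extend_spec hD s1 s2 a.2.2
  rw [← dualExtend] at e1 e2 e3 e4
  rw [planeEnv]
  generalize dualExtend i a = r at *
  dsimp only
  have hE : Indep (r.1.2 :: r.2) := indep_of_latt_eq hD e1 (by rw [List.length_cons]; exact e2)
  have hdE : Indep (dual (r.1.2 :: r.2)) := hE.dual
  have hlat := latt_dual_eq hC hE e1
  rw [dual, List.length_map] at e2
  have hmem : r.1.2 ∈ r.1.2 :: r.2 := List.mem_cons_self
  refine ⟨⟨hB, ?_, by rw [List.length_map]; exact e2, ?_, fun y hy => ?_, hlat, ?_, rfl, ht⟩,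
    fun y hy hy0 => e4.trans (s3 y hy hy0)⟩
  · rw [dual, List.map_cons] at hdE
    exact Indep.right (V := [_]) hdE
  · dsimp only
    rw [dotProduct_comm]; exact dualv_dot_self hE hmem
  · refine dot_eq_zero_of_sp (fun z hz => ?_) hy
    obtain ⟨g, hg, rfl⟩ := List.mem_map.1 hz
    dsimp only
    rw [dotProduct_comm]
    refine dualv_dot_of_ne hmem fun h => ?_
    have := hE.nodup
    rw [List.nodup_cons] at this
    exact this.1 (h ▸ hg)
  · have h1 := mem_sp hmem
    rw [sp_eq_of_latt_eq e1, sp_dual hC] at h1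
    exact h1

theorem sum_map_one {α : Type} (l : List α) : (l.map fun _ => (1 : ℚ)).sum = l.length := by
  simp

theorem planeStart_eq (i : Ctx) (a : Inst i) :
    planeStart i a = ((⌊(planeEnv i a).2.2.1 ⬝ᵥ a.2.2⌋ - a.2.1.length : ℤ) : ℚ) := by
  rw [planeStart, sum_map_one]
  push_cast
  rfl

theorem cauchy_schwarz {n : ℕ} (x y : Vec n) : (x ⬝ᵥ y) ^ 2 ≤ (x ⬝ᵥ x) * (y ⬝ᵥ y) := by
  have := Finset.sum_mul_sq_le_sq_mul_sq Finset.univ x y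
  simpa [dotProduct, sq] using this

/-- For a given `x` the result is as good as every candidate, so one good candidate suffices. If the
short vector has squared length at most `4 * δ`, the projection provides it. Otherwise `x` is so
close to `t` that its plane is among those visited. -/
theorem raise_spec (hA : Solver R A) (ha : Dom (fun n m => 1 ≤ m ∧ R n (m - 1)) i a) :
    raise A i a ∈ latt a.2.1 ∧ ∀ x ∈ latt a.2.1, (raise A i a - a.2.2) ⬝ᵥ (raise A i a - a.2.2)
      ≤ a.2.1.length * ((x - a.2.2) ⬝ᵥ (x - a.2.2)) := by
  obtain ⟨hok, hshort⟩ := planeEnv_ok ha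
  have hR := ha.rank.2
  obtain ⟨-, h2, h3, h4⟩ := planes_spec A i (planeEnv i a) (planeStart i a) (projSolve A i a)
    (a.2.1 ++ (a.2.1 ++ [a.2.2]))
  rw [← raise] at h2 h3 h4
  rw [planeStart_eq] at h2 h4
  rw [hok.target] at h3 h4
  -- The list serves as a counter for the `2 * m + 1` planes at distance at most `m` from the floor
  -- of `w ⬝ᵥ t`.
  have hlen : (a.2.1 ++ (a.2.1 ++ [a.2.2])).length = 2 * a.2.1.length + 1 := by
    simp only [List.length_append, List.length_singleton]; omega
  rw [hlen] at h2 h4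
  constructor
  · rcases h2 with h2 | ⟨j, -, h2⟩ <;> rw [h2]
    · exact projSolve_mem hA ha
    · have := hok.solve_mem hA hR (⌊(planeEnv i a).2.2.1 ⬝ᵥ a.2.2⌋ - a.2.1.length + j)
      exact_mod_cast this
  · intro x hx
    by_cases hs : svp i a.1 a.2.1 ⬝ᵥ svp i a.1 a.2.1 ≤ 4 * ((x - a.2.2) ⬝ᵥ (x - a.2.2))
    · exact h3.trans (projSolve_close hA ha hx hs)
    · rw [not_le] at hs
      have h0 : a.2.1 ≠ [] := List.length_pos_iff.1 ha.rank.1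
      obtain ⟨-, -, s3⟩ := svp_spec ha.top ha.indep h0
      obtain ⟨u, hu, hu0, v, hv, hv0, huv⟩ := exists_short_pair ha.indep h0
      have b1 := s3 u hu hu0
      have b2 := hshort v hv hv0
      obtain ⟨k, hk, -⟩ := hok.decomp hx
      have hcl := hok.solve_close hA hR hx hk
      have hcs := cauchy_schwarz (planeEnv i a).2.2.1 (x - a.2.2)
      rw [dotProduct_sub, hk] at hcs
      generalize (planeEnv i a).2.2.1 = w at *
      have hw0 := dot_self_nonneg w
      have hv0 := dot_self_pos hv0
      -- By Cauchy–Schwarz the left side is at most `(w ⬝ᵥ w) * δ ≤ 2 * (v ⬝ᵥ v) * δ`. The failed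
      -- case distinction and the oracle's guarantee give `4 * δ < 2 * (u ⬝ᵥ u)`, and the pair `u`,
      -- `v` from Minkowski's theorem finishes.
      have hlt : ((k : ℚ) - w ⬝ᵥ a.2.2) ^ 2 < (a.2.1.length : ℚ) ^ 2 := by
        have hd0 := dot_self_nonneg (x - a.2.2)
        have h5 : (w ⬝ᵥ w) * ((x - a.2.2) ⬝ᵥ (x - a.2.2))
            ≤ (2 * (v ⬝ᵥ v)) * ((x - a.2.2) ⬝ᵥ (x - a.2.2)) := mul_le_mul_of_nonneg_right b2 hd0
        have h6 : (2 * (v ⬝ᵥ v)) * ((x - a.2.2) ⬝ᵥ (x - a.2.2)) < (u ⬝ᵥ u) * (v ⬝ᵥ v) := by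
          nlinarith
        linarith
      obtain ⟨g1, g2⟩ := abs_lt.1 (abs_lt_of_sq_lt_sq hlt (by positivity))
      have f1 := Int.floor_le (w ⬝ᵥ a.2.2)
      have f2 := Int.lt_floor_add_one (w ⬝ᵥ a.2.2)
      set f := ⌊w ⬝ᵥ a.2.2⌋
      have k1 : f - a.2.1.length < k := by
        have : ((f - a.2.1.length : ℤ) : ℚ) < k := by push_cast; linarith
        exact_mod_cast this
      have k2 : k < f + 1 + a.2.1.length := by
        have : (k : ℚ) < ((f + 1 + a.2.1.length : ℤ) : ℚ) := by push_cast; linarith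
        exact_mod_cast this
      have h6 := h4 (k - (f - a.2.1.length)).toNat (by omega)
      have h7 : ((f - a.2.1.length : ℤ) : ℚ) + ((k - (f - a.2.1.length)).toNat : ℚ) = k := by
        have : (((k - (f - a.2.1.length)).toNat : ℤ) : ℚ) = ((k - (f - a.2.1.length) : ℤ) : ℚ) := by
          rw [Int.toNat_of_nonneg (by omega)]
        rw [Int.cast_natCast] at this
        rw [this]; push_cast; ring
      rw [h7] at h6
      exact h6.trans hcl

end

/-! ### Polynomial cost of raising the rank -/

namespace Cmp
variable {α : Ctx → Type} [∀ i, Enc (α i)] {S : ∀ i, α i → Prop}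

theorem extend {C : ∀ i, α i → List (Vec i.n)} {b z : ∀ i, α i → Vec i.n} (hC : Cmp S C)
    (hb : Cmp S b) (hz : Cmp S z) : Cmp S (fun i a => extend (C i a) (b i a) (z i a)) :=
  ins (coefs nil hC hb) hz

theorem mapDualv {C F : ∀ i, α i → List (Vec i.n)} (hC : Cmp S C) (hF : Cmp S F) :
    Cmp S (fun i a => (F i a).map (LatticeProblems.dualv (C i a))) :=
  map' (ε := fun i => List (Vec i.n)) (F := fun _ s => LatticeProblems.dualv s.1 s.2)
    (dualv (fst ident) (snd ident)) hC hF

variable {R : ℕ → ℕ → Prop} {A : ∀ i, Inst i → Vec i.n}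

theorem projSolve (hA : Solver R A) :
    Cmp (Dom fun n m => 1 ≤ m ∧ R n (m - 1)) (projSolve A) := by
  have hr : Cmp (Dom fun n m => 1 ≤ m ∧ R n (m - 1))
      (fun i a => LatticeProblems.extend a.2.1 (LatticeProblems.svp i a.1 a.2.1) a.2.2) :=
    extend (fst (snd ident)) (svp (fst ident) (fst (snd ident)) fun i a ha =>
      ⟨ha.top, ha.indep, List.length_pos_iff.1 ha.rank.1⟩) (snd (snd ident))
  have he := cons (snd (fst hr)) nil
  have hy := hA.cmp.comp ((fst ident).pair ((mapPrj he (snd hr)).pair (prj he (snd (snd ident)))))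
    fun i a ha => (projSolve_dom ha).1
  exact vsub (snd (snd ident)) (np he (vsub (snd (snd ident)) (lift he (snd hr) hy)))

theorem dualExtend : Cmp (Dom fun n m => 1 ≤ m ∧ R n (m - 1)) dualExtend :=
  extend (dual (fst (snd ident))) (svp (fst ident) (dual (fst (snd ident))) fun i a ha =>
    ⟨ha.top, ha.indep.dual, by
      rw [LatticeProblems.dual, Ne, List.map_eq_nil_iff]
      exact List.length_pos_iff.1 ha.rank.1⟩) (snd (snd ident))

theorem planeEnv : Cmp (Dom fun n m => 1 ≤ m ∧ R n (m - 1)) planeEnv := by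
  have hr := dualExtend (R := R)
  have hE := cons (snd (fst hr)) (snd hr)
  exact (fst ident).pair ((mapDualv hE (snd hr)).pair ((snd (fst hr)).pair
    ((dualv hE (snd (fst hr))).pair (snd (snd ident)))))

theorem planeStart : Cmp (Dom fun n m => 1 ≤ m ∧ R n (m - 1)) planeStart :=
  sub (floor (dot (snd (fst dualExtend)) (snd (snd ident))))
    (sum (map' (ε := fun _ => ℚ) (γ := fun i => Vec i.n) (F := fun _ _ => (1 : ℚ)) (const 1)
      (const 0) (fst (snd ident))))

/-- The environments and plane numbers for which the lower-rank solver applies. -/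
def PlaneDom (R : ℕ → ℕ → Prop) (i : Ctx) (s : PlaneEnv i.n × ℚ) : Prop :=
  ∃ C t, PlaneOk C t s.1 ∧ R i.n (C.length - 1)

theorem planeSolve (hA : Solver R A) :
    Cmp (α := fun i => PlaneEnv i.n × ℚ) (PlaneDom R) (fun i s => planeSolve A i s.1 s.2) := by
  have hk : Cmp (α := fun i => PlaneEnv i.n × ℚ) (PlaneDom R) (fun _ s => s.2) := snd ident
  have hx : Cmp (α := fun i => PlaneEnv i.n × ℚ) (PlaneDom R) (fun i s => s.2 • s.1.2.2.2.1) :=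
    smul hk (fst (snd (snd (snd (fst ident)))))
  exact vadd (hA.cmp.comp ((fst (fst ident)).pair ((fst (snd (fst ident))).pair
    (prj (cons (fst (snd (snd (fst ident)))) nil) (vsub (snd (snd (snd (snd (fst ident))))) hx))))
    fun i s ⟨C, t, h, hR⟩ => h.dom hR s.2) hx

theorem raise (hA : Solver R A) : Cmp (Dom fun n m => 1 ≤ m ∧ R n (m - 1)) (raise A) := by
  let σ : Ctx → Type := fun i => PlaneEnv i.n × ((ℚ × Vec i.n) × Vec i.n)
  let Q : ∀ i, σ i → Prop := fun i s => PlaneDom R i (s.1, s.2.1.1)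
  have hc : Cmp (α := σ) Q (fun i s => LatticeProblems.planeSolve A i s.1 s.2.1.1) :=
    (planeSolve hA).comp ((fst ident).pair (fst (fst (snd ident)))) fun _ _ h => h
  have ht : Cmp (α := σ) Q (fun _ s => s.1.2.2.2.2) := snd (snd (snd (snd (fst ident))))
  have hk : Cmp (α := σ) Q (fun _ s => s.2.1.1 + 1) := add (fst (fst (snd ident))) (const 1)
  have hb : Cmp (α := σ) Q (fun _ s => s.2.1.2) := snd (fst (snd ident))
  have hF : Cmp (α := σ) Q (fun i s => planeStep A i s.1 s.2.1) :=
    ite' (sub (dot (vsub hb ht) (vsub hb ht)) (dot (vsub hc ht) (vsub hc ht))) (hk.pair hc)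
      (hk.pair hb)
  obtain ⟨be, hbe, hbe'⟩ := (planeEnv (R := R)).sz_le
  obtain ⟨bk, hbk, hbk'⟩ := (planeStart (R := R)).sz_le
  obtain ⟨bx, hbx, hbx'⟩ := (projSolve hA).sz_le
  obtain ⟨bs, hbs, hbs'⟩ := (planeSolve hA).sz_le
  let B : ℕ → ℕ := fun s => 3 * (bk s + (2 * 0 + (2 * s + 2) + 3)) + 3
  have hB : PB B := ((PB.const 3).mul (hbk.add (((PB.const (2 * 0)).add (((PB.const 2).mul
    PB.id).add (PB.const 2))).add (PB.const 3)))).add (PB.const 3)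
  refine snd (foldl (ε := fun i => PlaneEnv i.n) (β := fun i => ℚ × Vec i.n)
    (γ := fun i => Vec i.n) (F := fun i s => planeStep A i s.1 s.2.1) hF
    (e := LatticeProblems.planeEnv) planeEnv
    (planeStart.pair (projSolve hA)) (append (fst (snd ident)) (append (fst (snd ident))
      (cons (snd (snd ident)) nil))) (fun i a ha _ _ _ _ => ⟨_, _, (planeEnv_ok ha).1, ha.rank.2⟩)
    (fun s => 1 + B s + (bx s + bs (1 + be s + B s)))
    (((PB.const 1).add hB).add (hbx.add (hbs.comp (((PB.const 1).add hbe).add hB)))) ?_)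
  intro i a ha l₁ l₂ hl
  obtain ⟨h1, h2, -⟩ := planes_spec A i (LatticeProblems.planeEnv i a)
    (LatticeProblems.planeStart i a) (LatticeProblems.projSolve A i a) l₁
  have hlen : l₁.length ≤ 2 * sz a + 2 := by
    have e1 := congrArg List.length hl
    simp only [List.length_append, List.length_singleton] at e1
    have e2 := length_le_sz a.2.1
    have e3 : sz a = 1 + sz a.1 + (1 + sz a.2.1 + sz a.2.2) := rfl
    omega
  have hkj : ∀ j : ℕ, j ≤ 2 * sz a + 2 → sz (LatticeProblems.planeStart i a + j) ≤ B (sz a) := by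
    intro j hj
    have e1 := sz_add_le (LatticeProblems.planeStart i a) j
    have e2 := hbk' i a ha
    have e3 : sz (j : ℚ) ≤ 2 * 0 + (2 * sz a + 2) + 3 := by
      refine sz_rat_le (D := 1) one_pos le_rfl (divBy_int 1 j) ?_
      rw [abs_of_nonneg (by positivity)]
      exact (nat_cast_le_two_pow j).trans (pow_le_pow_right₀ (by norm_num) hj)
    simp only [B]
    omega
  show sz (l₁.foldl (fun s _ => planeStep A i (LatticeProblems.planeEnv i a) s)
    (LatticeProblems.planeStart i a, LatticeProblems.projSolve A i a)) ≤ _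
  generalize l₁.foldl (fun s _ => planeStep A i (LatticeProblems.planeEnv i a) s)
    (LatticeProblems.planeStart i a, LatticeProblems.projSolve A i a) = r at h1 h2 ⊢
  have e1 : sz r.1 ≤ B (sz a) := by rw [h1]; exact hkj _ hlen
  -- The best vector so far is always the direct output of the projection or of one plane, so its
  -- size does not accumulate over the fold.
  have e2 : sz r.2 ≤ bx (sz a) + bs (1 + be (sz a) + B (sz a)) := by
    rcases h2 with h2 | ⟨j, hj, h2⟩ <;> rw [h2]
    · exact (hbx' i a ha).trans (Nat.le_add_right _ _)
    · refine le_trans ((hbs' i (LatticeProblems.planeEnv i a, LatticeProblems.planeStart i a + j)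
        ⟨_, _, (planeEnv_ok ha).1, ha.rank.2⟩).trans (hbs.1 ?_)) (Nat.le_add_left _ _)
      have e3 := hbe' i a ha
      have e4 := hkj j (by omega)
      rw [sz_prod]
      dsimp only
      omega
  rw [sz_prod]
  omega

end Cmp

theorem Solver.raise {R : ℕ → ℕ → Prop} {A : ∀ i, Inst i → Vec i.n} (hA : Solver R A) :
    Solver (fun n m => 1 ≤ m ∧ R n (m - 1)) (raise A) :=
  ⟨Cmp.raise hA, fun _ _ ha => (raise_spec hA ha).1, fun _ _ ha => (raise_spec hA ha).2⟩

/-! ## The reduction -/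

theorem Solver.mono {R R' : ℕ → ℕ → Prop} {A : ∀ i, Inst i → Vec i.n} (hA : Solver R' A)
    (h : ∀ n m, R n m → R' n m) : Solver R A := by
  have hd : ∀ i a, Dom R i a → Dom R' i a := fun i a ha =>
    ⟨ha.top, ha.indep, ha.mem, h _ _ ha.rank⟩
  exact ⟨hA.cmp.mono hd, fun i a ha => hA.mem i a (hd i a ha),
    fun i a ha => hA.close i a (hd i a ha)⟩

/-- In rank zero the target is the only lattice vector. -/
theorem solver_target : Solver (fun _ m => m = 0) fun _ a => a.2.2 := by
  refine ⟨.snd (.snd .ident), fun i a ha => ?_, fun i a ha x _ => by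
    rw [sub_self, zero_dotProduct, ha.rank]; simp⟩
  have h := ha.mem
  rw [List.length_eq_zero_iff.1 ha.rank] at h ⊢
  rw [sp_nil, Submodule.mem_bot] at h
  rw [h]; exact zero_mem _

/-- A solver for rank one. -/
def solveOne : ∀ i : Ctx, Inst i → Vec i.n := raise fun _ a => a.2.2

/-- A solver for rank two. -/
def solveTwo : ∀ i : Ctx, Inst i → Vec i.n := raise solveOne

/-- A solver for ranks one and two. -/
def solveSmall (i : Ctx) (a : Inst i) : Vec i.n :=
  if 0 < (if a.2.1.tail = [] then (0 : ℚ) else 1) then solveTwo i a else solveOne i a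

theorem solver_solveOne : Solver (fun _ m => m = 1) solveOne :=
  solver_target.raise.mono fun n m h => by omega

theorem solver_solveTwo : Solver (fun _ m => m = 2) solveTwo :=
  solver_solveOne.raise.mono fun n m h => by omega

theorem tail_test_pos {α : Type} {l : List α} :
    0 < (if l.tail = [] then (0 : ℚ) else 1) ↔ 2 ≤ l.length := by
  rcases l with _ | ⟨a, _ | ⟨b, l⟩⟩ <;> simp

theorem solver_solveSmall : Solver (fun _ m => m = 1 ∨ m = 2) solveSmall := by
  have h2 : ∀ i (a : Inst i), Dom (fun _ m => m = 1 ∨ m = 2) i a →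
      0 < (if a.2.1.tail = [] then (0 : ℚ) else 1) → Dom (fun _ m => m = 2) i a :=
    fun i a ha hc => ⟨ha.top, ha.indep, ha.mem, by
      have := ha.rank; rw [tail_test_pos] at hc; omega⟩
  have h1 : ∀ i (a : Inst i), Dom (fun _ m => m = 1 ∨ m = 2) i a →
      ¬ 0 < (if a.2.1.tail = [] then (0 : ℚ) else 1) → Dom (fun _ m => m = 1) i a :=
    fun i a ha hc => ⟨ha.top, ha.indep, ha.mem, by
      have := ha.rank; rw [tail_test_pos] at hc; omega⟩
  refine ⟨.ite (.nonempty (.tail (.fst (.snd .ident))))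
    (solver_solveTwo.cmp.mono fun i a h => h2 i a h.1 h.2)
    (solver_solveOne.cmp.mono fun i a h => h1 i a h.1 h.2), fun i a ha => ?_, fun i a ha => ?_⟩ <;>
  rw [solveSmall] <;> by_cases hc : 0 < (if a.2.1.tail = [] then (0 : ℚ) else 1)
  · rw [if_pos hc]; exact solver_solveTwo.mem i a (h2 i a ha hc)
  · rw [if_neg hc]; exact solver_solveOne.mem i a (h1 i a ha hc)
  · rw [if_pos hc]; exact solver_solveTwo.close i a (h2 i a ha hc)
  · rw [if_neg hc]; exact solver_solveOne.close i a (h1 i a ha hc)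

/-- A solver for full rank. -/
def solveFull : ∀ i : Ctx, Inst i → Vec i.n := raise (levelSolve solveSmall)

/-- Rank `n` is raised from rank `n - 1`, where a spare dimension for the embedding exists. -/
theorem solver_solveFull : Solver (fun n m => 1 ≤ n ∧ m = n) solveFull :=
  solver_solveSmall.levelSolve.raise.mono fun n m h => by omega

/-! ### Instances of the closest vector problem as inputs of the solver -/

theorem indep_basis {n : ℕ} (B : LatticeBasis n) : Indep (List.ofFn B.vec) := by
  have h1 : LinearIndependent ℝ fun i => fun j => (B.vec i j : ℝ) :=
    B.linearIndependent.map' (WithLp.linearEquiv 2 ℝ (Fin n → ℝ)).toLinearMap (LinearEquiv.ker _)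
  have h2 : IsUnit ((Rat.castHom ℝ).mapMatrix (Matrix.of B.vec)) :=
    Matrix.linearIndependent_rows_iff_isUnit.1 h1
  have h3 : IsUnit (Matrix.of B.vec) := by
    rw [Matrix.isUnit_iff_isUnit_det, ← RingHom.map_det, isUnit_iff_ne_zero] at h2
    rw [Matrix.isUnit_iff_isUnit_det, isUnit_iff_ne_zero]
    exact fun h => h2 (by rw [h, map_zero])
  have h4 : LinearIndependent ℚ B.vec := Matrix.linearIndependent_rows_iff_isUnit.2 h3
  have h5 : Set.range B.vec = {x | x ∈ List.ofFn B.vec} := by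
    ext x; simp [List.mem_ofFn]
  rw [Indep, sp, ← h5, finrank_span_eq_card h4]
  simp

theorem sp_basis {n : ℕ} (B : LatticeBasis n) : sp (List.ofFn B.vec) = ⊤ := by
  apply Submodule.eq_top_of_finrank_eq
  rw [(indep_basis B).finrank_eq, List.length_ofFn, Module.finrank_fin_fun]

/-- The solver on inputs consisting of a basis and a target. -/
def solveCVP (i : Ctx) (a : List (Vec i.n) × Vec i.n) : Vec i.n := solveFull i (a.1, a)

theorem cmp_solveCVP : Cmp (α := fun i => List (Vec i.n) × Vec i.n)
    (fun i a => Dom (fun n m => 1 ≤ n ∧ m = n) i (a.1, a)) solveCVP :=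
  solver_solveFull.cmp.comp (Cmp.pair (.fst .ident) .ident) fun _ _ h => h

theorem dom_basis (i : Ctx) (B : LatticeBasis i.n) (t : Vec i.n) :
    Dom (fun n m => 1 ≤ n ∧ m = n) i (List.ofFn B.vec, (List.ofFn B.vec, t)) :=
  ⟨sp_basis B, indep_basis B, by rw [sp_basis]; trivial, B.one_le, List.length_ofFn⟩

/-- A comparison with every lattice vector bounds the distance after division by `√n`, so the
infimum need not be attained for the argument; squaring gives the rational inequality. -/
theorem isSolution_of_close {n : ℕ} {B : LatticeBasis n} {x t : Vec n}
    (hx : x ∈ latt (List.ofFn B.vec)) (h : ∀ y ∈ latt (List.ofFn B.vec),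
      (x - t) ⬝ᵥ (x - t) ≤ n * ((y - t) ⬝ᵥ (y - t))) :
    (CVP fun n => Real.sqrt n).IsSolution (n := n) (B, t) (enc x) := by
  refine ⟨x, rfl, mem_lattice.2 hx, ?_⟩
  have hn : (0 : ℝ) < Real.sqrt n := Real.sqrt_pos.2 (by exact_mod_cast B.one_le)
  rw [← div_le_iff₀' hn, Metric.le_infDist ⟨0, zero_mem _⟩]
  intro y hy
  obtain ⟨z, hz, rfl⟩ := exists_of_mem_lattice hy
  rw [div_le_iff₀' hn, dist_comm, dist_eq_norm, ratPoint_sub, ratPoint_sub,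
    norm_ratPoint_le_iff _ (by positivity), mul_pow, Real.sq_sqrt (Nat.cast_nonneg n),
    norm_ratPoint_sq]
  exact_mod_cast h z hz

theorem solveCVP_isSolution (i : Ctx) (B : LatticeBasis i.n) (t : Vec i.n) :
    (CVP fun n => Real.sqrt n).IsSolution (n := i.n) (B, t)
      (enc (solveCVP i (List.ofFn B.vec, t))) := by
  have hd := dom_basis i B t
  have h1 := solver_solveFull.mem i _ hd
  have h2 := solver_solveFull.close i _ hd
  rw [solveCVP]
  dsimp only at h1 h2 ⊢
  generalize solveFull i (List.ofFn B.vec, (List.ofFn B.vec, t)) = x at *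
  refine isSolution_of_close h1 fun y hy => ?_
  have h3 := h2 y hy
  rwa [List.length_ofFn] at h3

theorem encode_CVP {γ : ℕ → ℝ} {n : ℕ} (B : LatticeBasis n) (t : Vec n) :
    (CVP γ).encode (n := n) (B, t) = enc (List.ofFn B.vec, t) := by
  show Val.pair (Val.ofVecs B.vec) (Val.ofVec t) = Val.pair (enc (List.ofFn B.vec)) (enc t)
  rw [enc_vecs]
  rfl

end LatticeProblems

end

theorem corollary2p11 :
    LatticeProblems.EfficientDimPreservingReduction
      (LatticeProblems.CVP fun n => Real.sqrt n)
      (LatticeProblems.SVP fun _ => Real.sqrt 2) := by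
  obtain ⟨M, b, ⟨-, p, hp⟩, hM⟩ := LatticeProblems.cmp_solveCVP
  refine ⟨M, p, fun O hO n ⟨B, t⟩ => ?_⟩
  have hsol := LatticeProblems.solveCVP_isSolution ⟨O, hO, n⟩ B t
  obtain ⟨T, qs, hrun, hT, hqs⟩ := hM ⟨O, hO, n⟩ (List.ofFn B.vec, t)
    (LatticeProblems.dom_basis ⟨O, hO, n⟩ B t)
  generalize LatticeProblems.Enc.enc
    (LatticeProblems.solveCVP ⟨O, hO, n⟩ (List.ofFn B.vec, t)) = w at *
  rw [LatticeProblems.encode_CVP]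
  exact ⟨w, T, qs, hrun, hsol, hT.trans (hp _), hqs⟩
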